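/- Let $1<s\le 2$ and let $X$ be a Banach space of martingale type $s$; that is, there is a constant $c$ with $(\mathbb E\|\sum_i d_i\|^s)^{1/s}\le c\,(\sum_i\mathbb E\|d_i\|^s)^{1/s}$ for all finite martingale difference sequences $(d_i)$ in $L^s(\Omega;X)$ on any probability space. Let $S=(S(t))_{t\ge0}$ be a bounded $C_0$-semigroup on $X$ which has an isometric dilation on a Banach space $Y$ of martingale type $s$: there are an isomorphic embedding $Q:X\to Y$, a bounded projection $R$ of $Y$ onto $QX$, and a strongly continuous group $(U(t))_{t\in\mathbb R}$ of isometries of $Y$ such that $QS(t)=RU(t)Q$ for all $t>0$. Let $(J,\mathcal J,\nu)$ be a $\sigma$-finite measure space and $N$ a Poisson random measure on $\mathbb R_+\times J$, defined on a probability space $(\Omega,\mathcal F,\mathbb P)$, with intensity measure $\mu=dt\times\nu$. Put $\tilde N(A)=N(A)-\mu(A)$ for $\mu(A)<\infty$, and let $\mathcal F_t$ be the $\sigma$-algebra generated by the random variables $N((r,u]\times A)$, $0\le r<u\le t$, $A\in\mathcal J$. A simple, adapted $X$-valued process is a finite sum $\phi=\sum_{i,j,k}F_{ijk}\mathbf 1_{(t_i,t_{i+1}]}\mathbf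 1_{A_j}x_{ijk}$ with $0=t_1<t_2<\dots<t_{l+1}<\infty$, disjoint sets $A_j\in\mathcal J$ with $\nu(A_j)<\infty$, $F_{ijk}\in L^\infty(\Omega,\mathcal F_{t_i})$ and $x_{ijk}\in X$; for $t>0$ and $B\in\mathcal J$ put $\int_{(0,t]\times B}\phi\,d\tilde N=\sum_{i,j,k}F_{ijk}\tilde N((t_i\wedge t,t_{i+1}\wedge t]\times(A_j\cap B))\,x_{ijk}$. A process $\psi$ is $L^p$-stochastically integrable if there are simple, adapted $\phi_n\to\psi$ almost everywhere on $\Omega\times\mathbb R_+\times J$ whose integrals over every set $(0,t]\times B$ converge in $L^p(\Omega;X)$; the limits are the integrals of $\psi$. Write $\mathcal D^p_{q,X}=L^p(\Omega;L^q(\mathbb R_+\times J;X))$, and give intersections and sums of these spaces their usual norms, namely the maximum of the two norms, and the infimum of $\|\phi_1\|+\|\phi_2\|$ over all decompositions $\phi=\phi_1+\phi_2$ (not necessarily adapted), respectively. Let $1\le p<\infty$. There is a constant $C$ depending only on $p,s,X,S$ such that, for all such $(\Omega,\mathcal F,\mathbb P)$, $(J,\mathcal J,\nu)$ and $N$, every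 simple, adapted $X$-valued process $\phi$ and every $B\in\mathcal J$, the following holds. For each $t>0$ the process $u\mapsto\mathbf 1_{(0,t]}(u)S(t-u)\phi(u)$ is $L^p$-stochastically integrable, the stochastic convolution $t\mapsto\int_{(0,t]\times B}S(t-u)\phi(u)\,d\tilde N$ has a càdlàg version, and, for this version, $$\Big(\mathbb E\sup_{t>0}\Big\|\int_{(0,t]\times B}S(t-u)\phi(u)\,d\tilde N\Big\|_X^p\Big)^{1/p}\le C\,\|\phi\mathbf 1_B\|_{\mathcal D^p_{s,X}\cap\mathcal D^p_{p,X}}\qquad\text{if } s\le p<\infty,$$ $$\Big(\mathbb E\sup_{t>0}\Big\|\int_{(0,t]\times B}S(t-u)\phi(u)\,d\tilde N\Big\|_X^p\Big)^{1/p}\le C\,\|\phi\mathbf 1_B\|_{\mathcal D^p_{s,X}+\mathcal D^p_{p,X}}\qquad\text{if } 1\le p<s.$$ -/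

import Mathlib

open MeasureTheory ProbabilityTheory Filter Topology Set
open scoped NNReal ENNReal

universe w v u y

noncomputable section

/-! ### Martingale type -/

/-- `(d i)` is a martingale difference sequence with respect to the filtration `ℱ`. -/
structure IsMartingaleDifference {Ω X : Type*} {mΩ : MeasurableSpace Ω} [NormedAddCommGroup X]
    [NormedSpace ℝ X] [CompleteSpace X] (P : Measure Ω) (ℱ : Filtration ℕ mΩ)
    (d : ℕ → Ω → X) : Prop where
  adapted : ∀ i, StronglyMeasurable[ℱ i] (d i)
  integrable : ∀ i, Integrable (d i) P
  condExp_eq_zero : ∀ i, P[d (i + 1) | ℱ i] =ᵐ[P] 0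

/-- `X` has martingale type `s`: there is one constant, depending only on `s` and `X`, with
`(E ‖∑ d_i‖ ^ s) ^ (1/s) ≤ C (∑ E ‖d_i‖ ^ s) ^ (1/s)` for all finite martingale difference
sequences in `L^s(Ω; X)`, over all probability spaces. -/
def HasMartingaleType (X : Type u) [NormedAddCommGroup X] [NormedSpace ℝ X]
    [CompleteSpace X] (s : ℝ) : Prop :=
  ∃ C : ℝ≥0, ∀ (Ω : Type w) [mΩ : MeasurableSpace Ω] (P : Measure Ω) [IsProbabilityMeasure P]
    (ℱ : Filtration ℕ mΩ) (d : ℕ → Ω → X) (n : ℕ),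
    IsMartingaleDifference P ℱ d → (∀ i, MemLp (d i) (ENNReal.ofReal s) P) →
      (∫⁻ ω, ‖∑ i ∈ Finset.range n, d i ω‖ₑ ^ s ∂P) ^ (1 / s) ≤
        C * (∑ i ∈ Finset.range n, ∫⁻ ω, ‖d i ω‖ₑ ^ s ∂P) ^ (1 / s)

/-! ### Semigroups and dilations -/

/-- Bounded strongly continuous one-parameter semigroups of bounded linear operators. -/
structure IsBoundedC0Semigroup {𝕜 X : Type*} [RCLike 𝕜] [NormedAddCommGroup X]
    [NormedSpace 𝕜 X] (S : ℝ≥0 → X →L[𝕜] X) : Prop where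
  map_zero : S 0 = ContinuousLinearMap.id 𝕜 X
  map_add : ∀ t u, S (t + u) = (S t).comp (S u)
  strong_continuous : ∀ x, Continuous fun t => S t x
  bounded : ∃ M : ℝ, ∀ t, ‖S t‖ ≤ M

/-- `S` has an isometric dilation on `Y`: there are an isomorphic embedding `Q : X → Y`, a bounded
projection `R` of `Y` onto `Q X` and a strongly continuous group `U` of linear isometries of `Y`
with `Q S(t) = R U(t) Q` for all `t > 0`. -/
def HasIsometricDilation {𝕜 X : Type*} [RCLike 𝕜] [NormedAddCommGroup X] [NormedSpace 𝕜 X]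
    (S : ℝ≥0 → X →L[𝕜] X) (Y : Type*) [NormedAddCommGroup Y] [NormedSpace 𝕜 Y] : Prop :=
  ∃ (Q : X →L[𝕜] Y) (R : Y →L[𝕜] Y) (U : ℝ → Y ≃ₗᵢ[𝕜] Y),
    (∃ c : ℝ, 0 < c ∧ ∀ x, c * ‖x‖ ≤ ‖Q x‖) ∧
    R.comp R = R ∧ range R = range Q ∧
    (∀ y, U 0 y = y) ∧ (∀ t u y, U (t + u) y = U t (U u y)) ∧
    (∀ y, Continuous fun t => U t y) ∧
    ∀ t : ℝ≥0, 0 < t → ∀ x, Q (S t x) = R (U t (Q x))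

/-! ### Poisson random measures -/

/-- Lebesgue measure on the half-line `[0, ∞)`. -/
def lebesgueHalfLine : Measure ℝ≥0 := (volume : Measure ℝ).comap ((↑) : ℝ≥0 → ℝ)

/-- `N` is a Poisson random measure with intensity measure `μ`. (A kernel is a map `(ω, B) ↦ N ω B`
that is a measure in `B` and measurable in `ω`.) -/
structure IsPoissonRandomMeasure {Ω E : Type*} [MeasurableSpace Ω] [MeasurableSpace E]
    (P : Measure Ω) (μ : Measure E) (N : Kernel Ω E) : Prop where
  integer_valued : ∀ ω B, MeasurableSet B → N ω B = ∞ ∨ ∃ n : ℕ, N ω B = n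
  poisson : ∀ B, MeasurableSet B → μ B < ∞ →
    P.map (fun ω => N ω B) = (poissonMeasure (μ B).toNNReal).map (fun n : ℕ => (n : ℝ≥0∞))
  infinite : ∀ B, MeasurableSet B → μ B = ∞ → ∀ᵐ ω ∂P, N ω B = ∞
  indep : ∀ (n : ℕ) (B : Fin n → Set E), (∀ i, MeasurableSet (B i)) →
    (∀ i j, i ≠ j → Disjoint (B i) (B j)) → iIndepFun (fun i ω => N ω (B i)) P

/-- The compensated random measure `N(B) - μ(B)`, used only for sets `B` with `μ B < ∞`. -/
def compensated {Ω E : Type*} [MeasurableSpace Ω] [MeasurableSpace E]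
    (μ : Measure E) (N : Kernel Ω E) (B : Set E) (ω : Ω) : ℝ :=
  (N ω B).toReal - (μ B).toReal

/-- The `σ`-algebra at time `t` generated by the random variables `N((s, u] × A)`, where
`0 ≤ s < u ≤ t` and `A` is measurable. -/
abbrev poissonHistory {Ω J : Type*} [MeasurableSpace Ω] [MeasurableSpace J]
    (N : Kernel Ω (ℝ≥0 × J)) (t : ℝ≥0) : MeasurableSpace Ω :=
  ⨆ (s : ℝ≥0) (u : ℝ≥0) (A : Set J) (_ : s < u) (_ : u ≤ t) (_ : MeasurableSet A),
    MeasurableSpace.comap (fun ω => N ω (Ioc s u ×ˢ A)) inferInstance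

/-! ### Simple adapted processes and the stochastic integral -/

section Integral

variable {Ω J : Type*} [MeasurableSpace Ω] [MeasurableSpace J]

/-- A simple adapted process
`∑_{i,j,k} F_{ijk} 1_{(t_i, t_{i+1}]} 1_{A_j} x_{ijk}`
with its data: a partition `0 = t_0 < ... < t_l`, disjoint measurable sets `A_j` of finite measure,
essentially bounded `F_{ijk}` measurable at time `t_i`, and vectors `x_{ijk}`. -/
structure SimpleAdaptedProcess (𝕜 X : Type*) [RCLike 𝕜] [NormedAddCommGroup X] [NormedSpace 𝕜 X]
    (P : Measure Ω) (ν : Measure J) (N : Kernel Ω (ℝ≥0 × J)) where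
  l : ℕ
  m : ℕ
  n : ℕ
  time : Fin (l + 1) → ℝ≥0
  time_zero : time 0 = 0
  time_strictMono : StrictMono time
  A : Fin m → Set J
  measurableSet_A : ∀ j, MeasurableSet (A j)
  measure_A_lt_top : ∀ j, ν (A j) < ∞
  disjoint_A : ∀ j j', j ≠ j' → Disjoint (A j) (A j')
  F : Fin l → Fin m → Fin n → Ω → 𝕜
  adapted : ∀ i j k, StronglyMeasurable[poissonHistory N (time i.castSucc)] (F i j k)
  bounded : ∀ i j k, MemLp (F i j k) ∞ P
  x : Fin l → Fin m → Fin n → X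

variable {𝕜 X : Type*} [RCLike 𝕜] [NormedAddCommGroup X] [NormedSpace 𝕜 X]
  {P : Measure Ω} {ν : Measure J} {N : Kernel Ω (ℝ≥0 × J)}

/-- The process `Ω × [0, ∞) × J → X` given by the data. -/
def SimpleAdaptedProcess.value (φ : SimpleAdaptedProcess 𝕜 X P ν N) (ω : Ω) (z : ℝ≥0 × J) : X :=
  ∑ i, ∑ j, ∑ k, (Ioc (φ.time i.castSucc) (φ.time i.succ) ×ˢ φ.A j).indicator
    (fun _ => φ.F i j k ω • φ.x i j k) z

/-- The compensated Poisson integral of a simple adapted process over `(0, t] × B`. -/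
def SimpleAdaptedProcess.integral (φ : SimpleAdaptedProcess 𝕜 X P ν N) (t : ℝ≥0) (B : Set J)
    (ω : Ω) : X :=
  ∑ i, ∑ j, ∑ k,
    (φ.F i j k ω * ((compensated (lebesgueHalfLine.prod ν) N
      (Ioc (min (φ.time i.castSucc) t) (min (φ.time i.succ) t) ×ˢ (φ.A j ∩ B)) ω : ℝ) : 𝕜)) •
        φ.x i j k

/-- `ψ` is `L^p`-stochastically integrable and `I` is (a version of) its integral over
`(0, t] × B`: some sequence of simple adapted processes converges to `ψ` almost everywhere, its
integrals over all the sets `(0, t'] × B'` converge in `L^p(Ω; X)`, and `I` is the limit for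
`(0, t] × B`. -/
def IsLpStochIntegral (𝕜 : Type*) [RCLike 𝕜] [NormedSpace 𝕜 X]
    (P : Measure Ω) (ν : Measure J) (N : Kernel Ω (ℝ≥0 × J)) (p : ℝ)
    (ψ : Ω → ℝ≥0 × J → X) (t : ℝ≥0) (B : Set J) (I : Ω → X) : Prop :=
  ∃ φ : ℕ → SimpleAdaptedProcess 𝕜 X P ν N,
    (∀ᵐ z ∂P.prod (lebesgueHalfLine.prod ν),
      Tendsto (fun n => (φ n).value z.1 z.2) atTop (𝓝 (ψ z.1 z.2))) ∧
    (∀ (t' : ℝ≥0) (B' : Set J), 0 < t' → MeasurableSet B' →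
      ∃ I' : Ω → X, MemLp I' (ENNReal.ofReal p) P ∧
        Tendsto (fun n => eLpNorm ((φ n).integral t' B' - I') (ENNReal.ofReal p) P)
          atTop (𝓝 0)) ∧
    MemLp I (ENNReal.ofReal p) P ∧
    Tendsto (fun n => eLpNorm ((φ n).integral t B - I) (ENNReal.ofReal p) P) atTop (𝓝 0)

/-- Right-continuous paths with left limits. -/
def IsCadlagPath (f : ℝ≥0 → X) : Prop :=
  ∀ t, ContinuousWithinAt f (Ici t) t ∧ ∃ x, Tendsto f (𝓝[<] t) (𝓝 x)

/-- `Z` is a càdlàg version of the stochastic convolution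
`t ↦ ∫_{(0, t] × B} S(t - u) φ(u) dÑ`: for each `t > 0` the process
`(ω, u, j) ↦ 1_{(0, t]}(u) S(t - u) φ(ω, u, j)` is `L^p`-stochastically integrable with integral
`Z t` over `(0, t] × B`, and all paths of `Z` are càdlàg. -/
structure IsStochConvolution (p : ℝ) (S : ℝ≥0 → X →L[𝕜] X)
    (φ : SimpleAdaptedProcess 𝕜 X P ν N) (B : Set J) (Z : ℝ≥0 → Ω → X) : Prop where
  integral : ∀ t : ℝ≥0, 0 < t → IsLpStochIntegral 𝕜 P ν N p
    (fun ω => (Ioc 0 t ×ˢ univ).indicator fun z => S (t - z.1) (φ.value ω z)) t B (Z t)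
  cadlag : ∀ ω, IsCadlagPath fun t => Z t ω

/-- The process `φ 1_B`. -/
def restrictMarks (φ : Ω → ℝ≥0 × J → X) (B : Set J) (ω : Ω) : ℝ≥0 × J → X :=
  (univ ×ˢ B).indicator (φ ω)

end Integral

/-! ### Norms -/

section Norms

variable {Ω E X : Type*} [MeasurableSpace Ω] [MeasurableSpace E] [NormedAddCommGroup X]

/-- The norm of `φ` in `D_q^p = L^p(Ω; L^q(E; X))`. -/
def mixedNorm (P : Measure Ω) (μ : Measure E) (p q : ℝ) (φ : Ω → E → X) : ℝ≥0∞ :=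
  (∫⁻ ω, (∫⁻ z, ‖φ ω z‖ₑ ^ q ∂μ) ^ (p / q) ∂P) ^ (1 / p)

/-- The norm of `φ` in `D_s^p ∩ D_p^p`. -/
def intersectionNorm (P : Measure Ω) (μ : Measure E) (p s : ℝ) (φ : Ω → E → X) : ℝ≥0∞ :=
  max (mixedNorm P μ p s φ) (mixedNorm P μ p p φ)

/-- The norm of `φ` in `D_s^p + D_p^p`. -/
def sumNorm (P : Measure Ω) (μ : Measure E) (p s : ℝ) (φ : Ω → E → X) : ℝ≥0∞ :=
  ⨅ (φ₁ : Ω → E → X) (φ₂ : Ω → E → X)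
    (_ : AEStronglyMeasurable (Function.uncurry φ₁) (P.prod μ))
    (_ : AEStronglyMeasurable (Function.uncurry φ₂) (P.prod μ))
    (_ : ∀ᵐ z ∂P.prod μ, φ z.1 z.2 = φ₁ z.1 z.2 + φ₂ z.1 z.2),
    mixedNorm P μ p s φ₁ + mixedNorm P μ p p φ₂

/-- The maximal norm `(E sup_{t > 0} ‖Z_t‖ ^ p) ^ (1/p)`. -/
def maximalNorm (P : Measure Ω) (p : ℝ) (Z : ℝ≥0 → Ω → X) : ℝ≥0∞ :=
  (∫⁻ ω, (⨆ t : Ioi (0 : ℝ≥0), ‖Z t ω‖ₑ ^ p) ∂P) ^ (1 / p)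

end Norms

end

/-! The dilation turns a convolution into an integral. With `L = Q⁻¹R` one has S(t-u) = L U(t) U(-u)
Q for u ≤ t, so the convolution at time t is L U(t) I_t, where I_t is the integral over (0,t] × B of
the Y-valued process U(-u)Qφ(u) against Ñ (`IsCompression.dilatedConvolution_eq`). As U(t) is
isometric, the supremum of the convolution is at most ‖L‖ sup ‖I_t‖, and strong continuity of the
group transfers càdlàg paths from I to the convolution. The integrand of I is dominated by ‖Q‖‖φ‖,
so what remains is a maximal inequality for Poisson integrals in Y.

Since φ is simple, almost every path of N is finite where φ lives, and all integrals are pathwise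
Bochner integrals. Dominated convergence allows U(-u)Q to be frozen at left grid points. Nested
dense grids, right-continuity and Fatou's lemma reduce the supremum to the maximum over the
partition points of simple Y-valued processes whose cells have measure at most one
(`IsCompression.lintegral_iSup_le`).

With the cells in lexicographic order, the integral becomes a transform ∑ ξ_k v_k: ξ_k is the
compensated measure of the k-th cell, independent of a past that determines v_k, with r-th moment at
most c_r m_k where m_k is the measure of the cell, and ξ_k = -m_k unless the cell is hit, which has
probability at most m_k (`IsNoise`). Martingale type s gives an L^s bound for all bounded
predictable v (`TransformBound`), in particular for stopped or truncated ones. Everything after that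
is scalar.

For p ≥ s, a good-λ inequality (`TransformBound.goodLambda`) compares the maximum with the largest
jump and with (∑ m_k ‖v_k‖^s)^(1/s). The p-th power of the largest jump is at most the sum of the
p-th powers of all jumps, whose expectation is controlled by the D_p^p norm.

For p < s, a decomposition φ = φ₁ + φ₂ need not be adapted, so the parts cannot be integrated
separately. Instead P(max > 2L) is estimated through φ alone: by E min(1, ∑ m_k min(1, (‖v_k‖/L)^s))
and by the probability that the compensator of the coefficients larger than L exceeds L
(`TransformBound.meas_two_mul_lt_transformMax_le`). Integration over L yields the pathwise quantity
`levelFunctional`, which `levelFunctional_le` bounds, for each ω separately, by any decomposition;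
adaptedness of the parts plays no role there. -/

noncomputable section

/-! ### Poisson random measures: independence -/

/-- The `σ`-algebra generated by the restriction of a random measure to a region. -/
abbrev regionHistory {Ω E : Type*} [MeasurableSpace Ω] [MeasurableSpace E] (N : Kernel Ω E)
    (D : Set E) : MeasurableSpace Ω :=
  ⨆ (A : {A : Set E // MeasurableSet A ∧ A ⊆ D}),
    MeasurableSpace.comap (fun ω => N ω A) inferInstance

section Region

variable {Ω E : Type*} [MeasurableSpace Ω] [MeasurableSpace E] {N : Kernel Ω E}

lemma regionHistory_le (D : Set E) : regionHistory N D ≤ ‹MeasurableSpace Ω› :=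
  iSup_le fun A => (N.measurable_coe A.2.1).comap_le

lemma regionHistory_mono {D D' : Set E} (h : D ⊆ D') :
    regionHistory N D ≤ regionHistory N D' :=
  iSup_le fun A => le_iSup (fun A : {A : Set E // MeasurableSet A ∧ A ⊆ D'} =>
    MeasurableSpace.comap (fun ω => N ω A) inferInstance) ⟨A.1, A.2.1, A.2.2.trans h⟩

lemma measurable_regionHistory {D A : Set E} (hA : MeasurableSet A) (h : A ⊆ D) :
    Measurable[regionHistory N D] fun ω => N ω A := by
  rw [measurable_iff_comap_le]
  exact le_iSup (fun A : {A : Set E // MeasurableSet A ∧ A ⊆ D} =>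
    MeasurableSpace.comap (fun ω => N ω A) inferInstance) ⟨A, hA, h⟩

/-- The cell of the finite partition of `D` generated by the sets `A i`. -/
def atomCell {E ι : Type*} (D : Set E) (A : ι → Set E) (b : Finset ι) : Set E :=
  {z | z ∈ D ∧ ∀ i, z ∈ A i ↔ i ∈ b}

lemma measurableSet_atomCell {ι : Type*} [Finite ι] {D : Set E} {A : ι → Set E}
    (hD : MeasurableSet D) (hA : ∀ i, MeasurableSet (A i)) (b : Finset ι) :
    MeasurableSet (atomCell D A b) := by
  have : atomCell D A b = D ∩ ⋂ i, {z | z ∈ A i ↔ i ∈ b} := by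
    ext z; simp [atomCell]
  rw [this]
  refine hD.inter (MeasurableSet.iInter fun i => ?_)
  exact (hA i).iff (MeasurableSet.const _)

lemma disjoint_atomCell {E ι : Type*} {D : Set E} {A : ι → Set E} {b b' : Finset ι}
    (h : b ≠ b') : Disjoint (atomCell D A b) (atomCell D A b') := by
  rw [Set.disjoint_left]
  rintro z ⟨-, hz⟩ ⟨-, hz'⟩
  exact h (Finset.ext fun i => (hz i).symm.trans (hz' i))

/-- Each `A i` is the disjoint union of the cells whose label contains `i`. Overlapping sets are
thereby traded for disjoint ones, the only kind for which independence is given. -/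
lemma measurable_of_atomCell {ι : Type*} [Fintype ι] {D : Set E} {A : ι → Set E}
    (hD : MeasurableSet D) (hA : ∀ i, MeasurableSet (A i)) (hAD : ∀ i, A i ⊆ D) (i : ι) :
    Measurable[⨆ b : Finset ι, MeasurableSpace.comap (fun ω => N ω (atomCell D A b)) inferInstance]
      fun ω => N ω (A i) := by
  classical
  have : (fun ω => N ω (A i)) =
      fun ω => ∑ b ∈ Finset.univ.filter (fun b : Finset ι => i ∈ b), N ω (atomCell D A b) := by
    ext ω
    rw [← measure_biUnion_finset]
    · congr 1
      ext z
      simp only [Finset.mem_filter, Finset.mem_univ, true_and, mem_iUnion, exists_prop]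
      constructor
      · intro hz
        exact ⟨Finset.univ.filter (fun i => z ∈ A i), by simpa using hz, hAD i hz, by simp⟩
      · rintro ⟨b, hb, hz⟩
        exact (hz.2 i).2 hb
    · intro b _ b' _ h
      exact disjoint_atomCell h
    · intro b _
      exact measurableSet_atomCell hD hA b
  rw [this]
  refine Finset.measurable_sum _ fun b _ => ?_
  rw [measurable_iff_comap_le]
  exact le_iSup (fun b : Finset ι =>
    MeasurableSpace.comap (fun ω => N ω (atomCell D A b)) inferInstance) b

lemma IsPoissonRandomMeasure.iIndepFun_of_fintype {P : Measure Ω} {μ : Measure E}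
    (hN : IsPoissonRandomMeasure P μ N) {ι : Type*} [Fintype ι] (B : ι → Set E)
    (hB : ∀ i, MeasurableSet (B i)) (hd : ∀ i j, i ≠ j → Disjoint (B i) (B j)) :
    iIndepFun (fun i ω => N ω (B i)) P := by
  have e := Fintype.equivFin ι
  have h := hN.indep _ (fun k => B (e.symm k)) (fun i => hB _) fun i j hij =>
    hd _ _ (e.symm.injective.ne hij)
  have := h.precomp e.injective
  simpa [Function.comp_def] using this

/-- A Poisson random measure on `D` is independent of its value on any set disjoint from `D`. -/
lemma IsPoissonRandomMeasure.indep_regionHistory {P : Measure Ω} [IsProbabilityMeasure P]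
    {μ : Measure E} (hN : IsPoissonRandomMeasure P μ N) {D C : Set E} (hD : MeasurableSet D)
    (hC : MeasurableSet C) (hDC : Disjoint D C) :
    Indep (regionHistory N D) (MeasurableSpace.comap (fun ω => N ω C) inferInstance) P := by
  classical
  let 𝒜 := {A : Set E // MeasurableSet A ∧ A ⊆ D}
  -- The history is a directed union over finite families of sets, so independence need only be
  -- checked for each finite family.
  let m : Finset 𝒜 → MeasurableSpace Ω := fun F =>
    ⨆ A : F, MeasurableSpace.comap (fun ω => N ω A.1.1) inferInstance
  have hm : regionHistory N D = ⨆ F, m F := by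
    refine le_antisymm (iSup_le fun A => ?_) (iSup_le fun F => iSup_le fun A => ?_)
    · refine le_trans ?_ (le_iSup m {A})
      exact le_iSup (fun A' : ({A} : Finset 𝒜) =>
        MeasurableSpace.comap (fun ω => N ω A'.1.1) inferInstance) ⟨A, by simp⟩
    · exact le_iSup (fun A : 𝒜 => MeasurableSpace.comap (fun ω => N ω A) inferInstance) A.1
  have hmono : Monotone m := fun F F' h => iSup_le fun A =>
    le_iSup (fun A : F' => MeasurableSpace.comap (fun ω => N ω A.1.1) inferInstance)
      ⟨A.1, h A.2⟩
  rw [hm]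
  refine indep_iSup_of_monotone (fun F => ?_) (fun F => ?_) (N.measurable_coe hC).comap_le hmono
  · let A : F → Set E := fun a => a.1.1
    have hA : ∀ i, MeasurableSet (A i) := fun a => a.1.2.1
    -- `none` stands for `C`. Together with the cells of `D` it forms one disjoint family, whose
    -- independence is then split into the cells against `C`.
    let B : Option (Finset F) → Set E := fun o => o.elim C (atomCell D A)
    have hB : ∀ o, MeasurableSet (B o) := by
      rintro (_ | b)
      · exact hC
      · exact measurableSet_atomCell hD hA b
    have hBD : ∀ b, Disjoint (atomCell D A b) C := fun b => hDC.mono_left fun z hz => hz.1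
    have hd : ∀ i j, i ≠ j → Disjoint (B i) (B j) := by
      rintro (_ | b) (_ | b') h
      · exact absurd rfl h
      · exact (hBD b').symm
      · exact hBD b
      · exact disjoint_atomCell fun hb => h (by rw [hb])
    have hi := hN.iIndepFun_of_fintype B hB hd
    have h2 := indep_iSup_of_disjoint (S := range (some : Finset F → Option (Finset F)))
      (T := {none}) (fun o => (N.measurable_coe (hB o)).comap_le) hi (by simp)
    rw [iSup_range, iSup_singleton] at h2
    refine indep_of_indep_of_le_left h2 (iSup_le fun a => ?_)
    exact (measurable_of_atomCell hD hA (fun a => a.1.2.2) a).comap_le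
  · exact iSup_le fun A => (N.measurable_coe A.1.2.1).comap_le

end Region

/-! ### Poisson random measures: moments -/

/-- The constant in the moment bound for the Poisson distribution. -/
def poissonMomentConst (r : ℝ) : ℝ := ∑' n : ℕ, (n : ℝ) ^ r / n.factorial

/-- For a natural number `k ≥ r` and `n ≥ 1`, `n ^ r ≤ (exp n) ^ k = (exp k) ^ n`, so the
exponential series at `exp k * x` dominates. -/
lemma summable_rpow_mul_pow_div_factorial (r : ℝ) {x : ℝ} (hx : 0 ≤ x) :
    Summable fun n : ℕ => (n : ℝ) ^ r * x ^ n / n.factorial := by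
  obtain ⟨k, hk⟩ := exists_nat_ge r
  refine Summable.of_norm_bounded_eventually_nat
    (g := fun n : ℕ => ((Real.exp k * x) ^ n / n.factorial)) (Real.summable_pow_div_factorial _) ?_
  filter_upwards [eventually_ge_atTop 1] with n hn
  have hn' : (1 : ℝ) ≤ n := by exact_mod_cast hn
  rw [Real.norm_of_nonneg (by positivity), mul_pow]
  gcongr
  calc (n : ℝ) ^ r ≤ (n : ℝ) ^ (k : ℝ) := Real.rpow_le_rpow_of_exponent_le hn' hk
    _ = (n : ℝ) ^ k := Real.rpow_natCast _ _
    _ ≤ (Real.exp n) ^ k := by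
      gcongr
      linarith [Real.add_one_le_exp (n : ℝ)]
    _ = (Real.exp k) ^ n := by
      rw [← Real.exp_nat_mul, ← Real.exp_nat_mul, mul_comm]

lemma summable_rpow_div_factorial (r : ℝ) : Summable fun n : ℕ => (n : ℝ) ^ r / n.factorial := by
  simpa using summable_rpow_mul_pow_div_factorial r zero_le_one

lemma lintegral_poissonMeasure_rpow_lt_top {r : ℝ} (hr : 0 ≤ r) (m : ℝ≥0) :
    ∫⁻ n, (n : ℝ≥0∞) ^ r ∂(poissonMeasure m) < ∞ := by
  rw [poissonMeasure, lintegral_sum_measure]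
  simp only [lintegral_smul_measure, lintegral_dirac]
  have h : ∀ n : ℕ, ENNReal.ofReal (Real.exp (-m) * m ^ n / n.factorial) • (n : ℝ≥0∞) ^ r =
      ENNReal.ofReal (Real.exp (-m) * ((n : ℝ) ^ r * m ^ n / n.factorial)) := by
    intro n
    rw [← ENNReal.ofReal_natCast, ENNReal.ofReal_rpow_of_nonneg (by positivity) hr, smul_eq_mul,
      ← ENNReal.ofReal_mul (by positivity)]
    congr 1
    ring
  simp_rw [h]
  have hsum : Summable fun n : ℕ => Real.exp (-(m : ℝ)) * ((n : ℝ) ^ r * (m : ℝ) ^ n / n.factorial) :=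
    (summable_rpow_mul_pow_div_factorial r m.2).mul_left _
  rw [← ENNReal.ofReal_tsum_of_nonneg (fun n => by positivity) hsum]
  exact ENNReal.ofReal_lt_top

/-- The term `n = 0` vanishes because `r > 0`, and `m ^ n ≤ m` for `n ≥ 1` because `m ≤ 1`.
Linearity in the mean is what later turns sums over cells into integrals against the intensity, and
it is the reason why cells have to be small. -/
lemma lintegral_poissonMeasure_rpow_le {r : ℝ} (hr : 0 < r) {m : ℝ≥0} (hm : m ≤ 1) :
    ∫⁻ n, (n : ℝ≥0∞) ^ r ∂(poissonMeasure m) ≤ ENNReal.ofReal (poissonMomentConst r) * m := by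
  rw [poissonMeasure, lintegral_sum_measure]
  simp only [lintegral_smul_measure, lintegral_dirac]
  rw [poissonMomentConst, ENNReal.ofReal_tsum_of_nonneg (fun n => by positivity)
    (summable_rpow_div_factorial r), ← ENNReal.tsum_mul_right]
  refine ENNReal.tsum_le_tsum fun n => ?_
  rcases Nat.eq_zero_or_pos n with rfl | hn
  · simp [hr]
  · have h1 : ((n : ℝ≥0∞)) ^ r = ENNReal.ofReal ((n : ℝ) ^ r) := by
      rw [← ENNReal.ofReal_rpow_of_nonneg (by positivity) hr.le, ENNReal.ofReal_natCast]
    have h2 : (m : ℝ≥0∞) = ENNReal.ofReal m := by simp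
    rw [h1, h2, smul_eq_mul, ← ENNReal.ofReal_mul (by positivity), ← ENNReal.ofReal_mul (by positivity)]
    refine ENNReal.ofReal_le_ofReal ?_
    have hmn : (m : ℝ) ^ n ≤ m := by
      have : (m : ℝ) ^ n ≤ (m : ℝ) ^ 1 :=
        pow_le_pow_of_le_one m.2 (by exact_mod_cast hm) hn
      simpa using this
    have he : Real.exp (-m) ≤ 1 := by
      rw [Real.exp_le_one_iff]; simp
    calc Real.exp (-m) * m ^ n / n.factorial * (n : ℝ) ^ r
        ≤ 1 * m / n.factorial * (n : ℝ) ^ r := by gcongr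
      _ = _ := by ring

lemma lintegral_poissonMeasure_id (m : ℝ≥0) :
    ∫⁻ n, (n : ℝ≥0∞) ∂(poissonMeasure m) = m := by
  rw [poissonMeasure, lintegral_sum_measure]
  simp only [lintegral_smul_measure, lintegral_dirac]
  rw [tsum_eq_zero_add' ENNReal.summable]
  have : ∀ n : ℕ, ENNReal.ofReal (Real.exp (-m) * m ^ (n + 1) / (n + 1).factorial) •
      ((n + 1 : ℕ) : ℝ≥0∞) = ENNReal.ofReal (Real.exp (-m) * m ^ n / n.factorial) * m := by
    intro n
    have h2 : (m : ℝ≥0∞) = ENNReal.ofReal m := by simp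
    rw [smul_eq_mul, h2, ← ENNReal.ofReal_natCast, ← ENNReal.ofReal_mul (by positivity),
      ← ENNReal.ofReal_mul (by positivity)]
    congr 1
    rw [Nat.factorial_succ]
    push_cast
    field_simp
    ring
  simp only [this]
  rw [ENNReal.tsum_mul_right, ← ENNReal.ofReal_tsum_of_nonneg (fun n => by positivity)
    (hasSum_one_poissonMeasure m).summable, (hasSum_one_poissonMeasure m).tsum_eq]
  simp

lemma measurable_compensated {Ω E : Type*} {m : MeasurableSpace Ω} [MeasurableSpace Ω]
    [MeasurableSpace E] {N : Kernel Ω E} {μ : Measure E} {C : Set E}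
    (h : Measurable[m] fun ω => N ω C) : Measurable[m] (compensated μ N C) :=
  Measurable.sub_const (ENNReal.measurable_toReal.comp h) _

section Moments

variable {Ω E : Type*} [MeasurableSpace Ω] [MeasurableSpace E] {N : Kernel Ω E}
  {P : Measure Ω} {μ : Measure E}

lemma IsPoissonRandomMeasure.lintegral_comp (hN : IsPoissonRandomMeasure P μ N) {C : Set E}
    (hC : MeasurableSet C) (hμ : μ C < ∞) {f : ℝ≥0∞ → ℝ≥0∞} (hf : Measurable f) :
    ∫⁻ ω, f (N ω C) ∂P = ∫⁻ n, f (n : ℝ≥0∞) ∂(poissonMeasure (μ C).toNNReal) := by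
  rw [← lintegral_map (f := f) hf (N.measurable_coe hC), hN.poisson C hC hμ, lintegral_map hf]
  exact measurable_from_nat

lemma IsPoissonRandomMeasure.lintegral_eq (hN : IsPoissonRandomMeasure P μ N) {C : Set E}
    (hC : MeasurableSet C) (hμ : μ C < ∞) : ∫⁻ ω, N ω C ∂P = μ C := by
  rw [hN.lintegral_comp hC hμ measurable_id']
  rw [lintegral_poissonMeasure_id, ENNReal.coe_toNNReal hμ.ne]

lemma IsPoissonRandomMeasure.ae_lt_top (hN : IsPoissonRandomMeasure P μ N) {C : Set E}
    (hC : MeasurableSet C) (hμ : μ C < ∞) : ∀ᵐ ω ∂P, N ω C < ∞ :=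
  MeasureTheory.ae_lt_top (N.measurable_coe hC) (by rw [hN.lintegral_eq hC hμ]; exact hμ.ne)

/-- The constant in the moment bound for the compensated Poisson random measure. -/
def compensatedMomentConst (r : ℝ) : ℝ≥0 :=
  2 ^ r * ((poissonMomentConst r).toNNReal + 1)

/-- Moments of the compensated random measure of small sets. -/
lemma IsPoissonRandomMeasure.lintegral_compensated_rpow_le [IsProbabilityMeasure P]
    (hN : IsPoissonRandomMeasure P μ N) {C : Set E}
    (hC : MeasurableSet C) (hμ : μ C ≤ 1) {r : ℝ} (hr : 1 ≤ r) :
    ∫⁻ ω, ‖compensated μ N C ω‖ₑ ^ r ∂P ≤ compensatedMomentConst r * μ C := by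
  have hμ' : μ C < ∞ := hμ.trans_lt ENNReal.one_lt_top
  have hr0 : 0 ≤ r := by linarith
  have h1 : ∀ ω, ‖compensated μ N C ω‖ₑ ^ r ≤ 2 ^ r * ((N ω C) ^ r + μ C) := by
    intro ω
    have h2 : ‖compensated μ N C ω‖ₑ ≤ N ω C + μ C := by
      refine (enorm_sub_le).trans (add_le_add ?_ ?_)
      · rw [Real.enorm_eq_ofReal ENNReal.toReal_nonneg]; exact ENNReal.ofReal_toReal_le
      · rw [Real.enorm_eq_ofReal ENNReal.toReal_nonneg]; exact ENNReal.ofReal_toReal_le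
    have h3 : N ω C + μ C ≤ 2 * max (N ω C) (μ C) := by
      rw [two_mul]; exact add_le_add (le_max_left _ _) (le_max_right _ _)
    calc ‖compensated μ N C ω‖ₑ ^ r ≤ (2 * max (N ω C) (μ C)) ^ r := by gcongr; exact h2.trans h3
      _ = 2 ^ r * max (N ω C ^ r) (μ C ^ r) := by
        rw [ENNReal.mul_rpow_of_nonneg _ _ hr0]
        congr 1
        exact (ENNReal.monotone_rpow_of_nonneg hr0).map_max
      _ ≤ 2 ^ r * (N ω C ^ r + μ C ^ r) := by
        gcongr; exact max_le_add_of_nonneg (by positivity) (by positivity)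
      _ ≤ _ := by
        gcongr
        calc μ C ^ r ≤ μ C ^ (1 : ℝ) := ENNReal.rpow_le_rpow_of_exponent_ge hμ hr
          _ = μ C := by simp
  calc ∫⁻ ω, ‖compensated μ N C ω‖ₑ ^ r ∂P ≤ ∫⁻ ω, 2 ^ r * ((N ω C) ^ r + μ C) ∂P :=
        lintegral_mono h1
    _ = 2 ^ r * (∫⁻ ω, (N ω C) ^ r ∂P + μ C) := by
        rw [lintegral_const_mul _ (((N.measurable_coe hC).pow_const r).add_const _),
          lintegral_add_right _ measurable_const]
        simp
    _ ≤ 2 ^ r * (ENNReal.ofReal (poissonMomentConst r) * μ C + μ C) := by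
        gcongr
        rw [hN.lintegral_comp hC hμ' (f := fun x => x ^ r) (by fun_prop)]
        refine (lintegral_poissonMeasure_rpow_le (by linarith) ?_).trans ?_
        · exact ENNReal.toNNReal_mono (by simp) hμ
        · rw [ENNReal.coe_toNNReal hμ'.ne]
    _ = _ := by
        rw [compensatedMomentConst, ENNReal.ofReal]
        push_cast
        rw [ENNReal.coe_rpow_of_nonneg _ hr0]
        push_cast
        ring

lemma IsPoissonRandomMeasure.memLp_toReal (hN : IsPoissonRandomMeasure P μ N) {C : Set E}
    (hC : MeasurableSet C) (hμ : μ C < ∞) {r : ℝ} (hr : 1 ≤ r) :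
    MemLp (fun ω => (N ω C).toReal) (ENNReal.ofReal r) P := by
  refine ⟨(N.measurable_coe hC).ennreal_toReal.aestronglyMeasurable, ?_⟩
  rw [eLpNorm_lt_top_iff_lintegral_rpow_enorm_lt_top (by simp; linarith) (by simp),
    ENNReal.toReal_ofReal (by linarith)]
  refine lt_of_le_of_lt (lintegral_mono fun ω => ?_)
    ((hN.lintegral_comp hC hμ (f := fun x => x ^ r) (by fun_prop)).trans_lt
      (lintegral_poissonMeasure_rpow_lt_top (by linarith) _))
  refine ENNReal.rpow_le_rpow ?_ (by linarith)
  rw [Real.enorm_eq_ofReal ENNReal.toReal_nonneg]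
  exact ENNReal.ofReal_toReal_le

lemma IsPoissonRandomMeasure.integral_compensated [IsProbabilityMeasure P]
    (hN : IsPoissonRandomMeasure P μ N) {C : Set E}
    (hC : MeasurableSet C) (hμ : μ C < ∞) : ∫ ω, compensated μ N C ω ∂P = 0 := by
  have h : Integrable (fun ω => (N ω C).toReal) P :=
    integrable_toReal_of_lintegral_ne_top (N.measurable_coe hC).aemeasurable
      (by rw [hN.lintegral_eq hC hμ]; exact hμ.ne)
  unfold compensated
  rw [integral_sub h (integrable_const _), integral_toReal (N.measurable_coe hC).aemeasurable
    (hN.ae_lt_top hC hμ), hN.lintegral_eq hC hμ]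
  simp

end Moments

/-! ### Transforms of independent noise -/

/-- Centred real random variables `ξ k`, each independent of the past `𝒢 k`, with moments controlled
by small numbers `m k`, and with `ξ k = - m k` outside an event of probability at most `m k`. -/
structure IsNoise {Ω : Type*} {mΩ : MeasurableSpace Ω} (P : Measure Ω) (𝒢 : Filtration ℕ mΩ)
    (ξ : ℕ → Ω → ℝ) (m : ℕ → ℝ≥0∞) (c : ℝ → ℝ≥0) : Prop where
  measurable : ∀ k, Measurable[𝒢 (k + 1)] (ξ k)
  indep : ∀ k, Indep (𝒢 k) (MeasurableSpace.comap (ξ k) inferInstance) P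
  integral_eq_zero : ∀ k, ∫ ω, ξ k ω ∂P = 0
  moment : ∀ r, 1 ≤ r → ∀ k, ∫⁻ ω, ‖ξ k ω‖ₑ ^ r ∂P ≤ c r * m k
  le_one : ∀ k, m k ≤ 1
  jump : ∀ k, P {ω | ξ k ω ≠ -(m k).toReal} ≤ m k

/-- Bounded predictable sequences. -/
structure IsBoundedPredictable {Ω V : Type*} {mΩ : MeasurableSpace Ω} [NormedAddCommGroup V]
    (P : Measure Ω) (𝒢 : Filtration ℕ mΩ) (v : ℕ → Ω → V) : Prop where
  stronglyMeasurable : ∀ k, StronglyMeasurable[𝒢 k] (v k)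
  bounded : ∀ k, ∃ K : ℝ, ∀ᵐ ω ∂P, ‖v k ω‖ ≤ K

/-- Partial sums of the transform of `ξ` by `v`. -/
def transformSum {Ω V : Type*} [NormedAddCommGroup V] [NormedSpace ℝ V] (ξ : ℕ → Ω → ℝ)
    (v : ℕ → Ω → V) (n : ℕ) (ω : Ω) : V :=
  ∑ k ∈ Finset.range n, ξ k ω • v k ω

/-- The maximal function of the partial sums up to `n`. -/
def transformMax {Ω V : Type*} [NormedAddCommGroup V] [NormedSpace ℝ V] (ξ : ℕ → Ω → ℝ)
    (v : ℕ → Ω → V) (n : ℕ) (ω : Ω) : ℝ≥0∞ :=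
  (Finset.range (n + 1)).sup fun k => ‖transformSum ξ v k ω‖ₑ

section Transform

variable {Ω V : Type*} {mΩ : MeasurableSpace Ω} [NormedAddCommGroup V] [NormedSpace ℝ V]
  {P : Measure Ω} {𝒢 : Filtration ℕ mΩ} {ξ : ℕ → Ω → ℝ} {m : ℕ → ℝ≥0∞} {c : ℝ → ℝ≥0}
  {v : ℕ → Ω → V}

lemma IsNoise.measurable' (hξ : IsNoise P 𝒢 ξ m c) (k : ℕ) : Measurable (ξ k) :=
  (hξ.measurable k).mono (𝒢.le _) le_rfl

lemma IsNoise.lintegral_lt_top (hξ : IsNoise P 𝒢 ξ m c) {r : ℝ} (hr : 1 ≤ r) (k : ℕ) :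
    ∫⁻ ω, ‖ξ k ω‖ₑ ^ r ∂P < ∞ :=
  (hξ.moment r hr k).trans_lt (ENNReal.mul_lt_top (by simp)
    ((hξ.le_one k).trans_lt ENNReal.one_lt_top))

lemma IsNoise.memLp (hξ : IsNoise P 𝒢 ξ m c) {r : ℝ} (hr : 1 ≤ r) (k : ℕ) :
    MemLp (ξ k) (ENNReal.ofReal r) P := by
  refine ⟨(hξ.measurable' k).aestronglyMeasurable, ?_⟩
  rw [eLpNorm_lt_top_iff_lintegral_rpow_enorm_lt_top (by simp; linarith) (by simp),
    ENNReal.toReal_ofReal (by linarith)]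
  exact hξ.lintegral_lt_top hr k

lemma IsBoundedPredictable.indicator (hv : IsBoundedPredictable P 𝒢 v) {A : ℕ → Set Ω}
    (hA : ∀ k, MeasurableSet[𝒢 k] (A k)) :
    IsBoundedPredictable P 𝒢 fun k => (A k).indicator (v k) where
  stronglyMeasurable k := (hv.stronglyMeasurable k).indicator (hA k)
  bounded k := by
    obtain ⟨K, hK⟩ := hv.bounded k
    exact ⟨K, hK.mono fun ω hω => (norm_indicator_le_norm_self _ _).trans hω⟩

lemma IsBoundedPredictable.measurable_enorm (hv : IsBoundedPredictable P 𝒢 v) (k : ℕ) :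
    Measurable[𝒢 k] fun ω => ‖v k ω‖ₑ :=
  (hv.stronglyMeasurable k).enorm

lemma IsBoundedPredictable.measurable_enorm' (hv : IsBoundedPredictable P 𝒢 v) (k : ℕ) :
    Measurable fun ω => ‖v k ω‖ₑ :=
  (hv.measurable_enorm k).mono (𝒢.le _) le_rfl

lemma IsBoundedPredictable.memLp_smul (hv : IsBoundedPredictable P 𝒢 v) (hξ : IsNoise P 𝒢 ξ m c) {r : ℝ}
    (hr : 1 ≤ r) (k : ℕ) : MemLp (ξ k • v k) (ENNReal.ofReal r) P := by
  obtain ⟨K, hK⟩ := hv.bounded k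
  refine (hξ.memLp hr k).of_le_mul (c := K) ?_ ?_
  · exact ((hξ.measurable' k).aestronglyMeasurable).smul
      ((hv.stronglyMeasurable k).mono (𝒢.le k)).aestronglyMeasurable
  · filter_upwards [hK] with ω hω
    rw [Pi.smul_apply', norm_smul, mul_comm]
    gcongr

lemma stronglyMeasurable_transformSum (hξ : IsNoise P 𝒢 ξ m c) (hv : IsBoundedPredictable P 𝒢 v)
    (n : ℕ) : StronglyMeasurable[𝒢 n] (transformSum ξ v n) := by
  refine Finset.stronglyMeasurable_fun_sum _ fun k hk => ?_
  have hk' : k < n := Finset.mem_range.1 hk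
  exact StronglyMeasurable.smul
    (((hξ.measurable k).mono (𝒢.mono hk') le_rfl).stronglyMeasurable)
    ((hv.stronglyMeasurable k).mono (𝒢.mono hk'.le))

lemma measurable_transformMax (hξ : IsNoise P 𝒢 ξ m c) (hv : IsBoundedPredictable P 𝒢 v)
    (n : ℕ) : Measurable[𝒢 n] (transformMax ξ v n) := by
  unfold transformMax
  simp_rw [Finset.sup_eq_iSup]
  refine Measurable.iSup fun k => Measurable.iSup fun hk => ?_
  have hk' : k ≤ n := Nat.lt_succ_iff.1 (Finset.mem_range.1 hk)
  exact ((stronglyMeasurable_transformSum hξ hv k).mono (𝒢.mono hk')).enorm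

lemma measurable_transformMax' (hξ : IsNoise P 𝒢 ξ m c) (hv : IsBoundedPredictable P 𝒢 v)
    (n : ℕ) : Measurable (transformMax ξ v n) :=
  (measurable_transformMax hξ hv n).mono (𝒢.le _) le_rfl

lemma enorm_transformSum_le_transformMax {k n : ℕ} (h : k ≤ n) (ω : Ω) :
    ‖transformSum ξ v k ω‖ₑ ≤ transformMax ξ v n ω :=
  Finset.le_sup (f := fun k => ‖transformSum ξ v k ω‖ₑ) (Finset.mem_range.2 (Nat.lt_succ_of_le h))

lemma transformMax_mono {k n : ℕ} (h : k ≤ n) (ω : Ω) :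
    transformMax ξ v k ω ≤ transformMax ξ v n ω :=
  Finset.sup_mono (Finset.range_mono (Nat.succ_le_succ h))

lemma transformMax_lt_top (n : ℕ) (ω : Ω) : transformMax ξ v n ω < ∞ := by
  rw [transformMax, Finset.sup_lt_iff (by simp)]
  simp

lemma lt_transformMax_iff {n : ℕ} {ω : Ω} {L : ℝ≥0∞} :
    L < transformMax ξ v n ω ↔ ∃ k ≤ n, L < ‖transformSum ξ v k ω‖ₑ := by
  simp [transformMax, Finset.lt_sup_iff]

/-- The first index at which the partial sums exceed a level. -/
lemma exists_first_lt {n : ℕ} {ω : Ω} {L : ℝ≥0∞} (h : L < transformMax ξ v n ω) :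
    ∃ k ≤ n, 0 < k ∧ L < ‖transformSum ξ v k ω‖ₑ ∧
      ∀ j, L < transformMax ξ v j ω ↔ k ≤ j := by
  classical
  obtain ⟨k, hkn, hk⟩ := lt_transformMax_iff.1 h
  have hex : ∃ k, L < ‖transformSum ξ v k ω‖ₑ := ⟨k, hk⟩
  refine ⟨Nat.find hex, (Nat.find_min' hex hk).trans hkn, ?_, Nat.find_spec hex, fun j => ?_⟩
  · rw [Nat.pos_iff_ne_zero]
    intro h0
    have := Nat.find_spec hex
    rw [h0] at this
    simp [transformSum] at this
  · rw [lt_transformMax_iff]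
    constructor
    · rintro ⟨i, hij, hi⟩
      exact (Nat.find_min' hex hi).trans hij
    · intro hj
      exact ⟨_, hj, Nat.find_spec hex⟩

/-- The `L^s`-bound for transforms given by martingale type `s`. -/
def TransformBound (V : Type*) [NormedAddCommGroup V] [NormedSpace ℝ V] (P : Measure Ω)
    (𝒢 : Filtration ℕ mΩ) (ξ : ℕ → Ω → ℝ) (m : ℕ → ℝ≥0∞) (s : ℝ) (C : ℝ≥0) : Prop :=
  ∀ v : ℕ → Ω → V, IsBoundedPredictable P 𝒢 v → ∀ n,
    ∫⁻ ω, ‖transformSum ξ v n ω‖ₑ ^ s ∂P ≤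
      C * ∫⁻ ω, ∑ k ∈ Finset.range n, m k * ‖v k ω‖ₑ ^ s ∂P

lemma lintegral_enorm_smul_rpow (hξ : IsNoise P 𝒢 ξ m c) (hv : IsBoundedPredictable P 𝒢 v) {r : ℝ}
    (hr : 0 ≤ r) (k : ℕ) :
    ∫⁻ ω, ‖ξ k ω • v k ω‖ₑ ^ r ∂P = (∫⁻ ω, ‖v k ω‖ₑ ^ r ∂P) * ∫⁻ ω, ‖ξ k ω‖ₑ ^ r ∂P := by
  rw [← lintegral_mul_eq_lintegral_mul_lintegral_of_independent_measurableSpace (𝒢.le k)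
    (hξ.measurable' k).comap_le (hξ.indep k) ((hv.measurable_enorm k).pow_const r)]
  · refine lintegral_congr fun ω => ?_
    rw [enorm_smul, ENNReal.mul_rpow_of_nonneg _ _ hr, mul_comm]
  · exact (measurable_enorm.pow_const r).comp (comap_measurable (ξ k))

/-- Independence of `ξ k` from the past that determines `v k` factorises each moment, and the moment
of `ξ k` is linear in `m k`. -/
lemma lintegral_sum_enorm_smul_rpow_le (hξ : IsNoise P 𝒢 ξ m c) (hv : IsBoundedPredictable P 𝒢 v)
    {r : ℝ} (hr : 1 ≤ r) (n : ℕ) :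
    ∑ k ∈ Finset.range n, ∫⁻ ω, ‖ξ k ω • v k ω‖ₑ ^ r ∂P ≤
      c r * ∫⁻ ω, ∑ k ∈ Finset.range n, m k * ‖v k ω‖ₑ ^ r ∂P := by
  rw [lintegral_finsetSum _ fun k _ => ((hv.measurable_enorm' k).pow_const r).const_mul _,
    Finset.mul_sum]
  refine Finset.sum_le_sum fun k _ => ?_
  rw [lintegral_enorm_smul_rpow hξ hv (by linarith), lintegral_const_mul _
    ((hv.measurable_enorm' k).pow_const r)]
  calc _ ≤ (∫⁻ ω, ‖v k ω‖ₑ ^ r ∂P) * (c r * m k) := by gcongr; exact hξ.moment r hr k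
    _ = _ := by ring

lemma condExp_smul_eq_zero [CompleteSpace V] [IsProbabilityMeasure P] (hξ : IsNoise P 𝒢 ξ m c)
    (hv : IsBoundedPredictable P 𝒢 v) (k : ℕ) : P[ξ k • v k | 𝒢 k] =ᵐ[P] 0 := by
  have h1 : Integrable (ξ k) P := by
    have := hξ.memLp le_rfl k
    rw [ENNReal.ofReal_one] at this
    exact memLp_one_iff_integrable.1 this
  have h2 : Integrable (ξ k • v k) P := by
    have := hv.memLp_smul hξ le_rfl k
    rw [ENNReal.ofReal_one] at this
    exact memLp_one_iff_integrable.1 this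
  have h3 := condExp_smul_of_aestronglyMeasurable_right h1 h2
    (hv.stronglyMeasurable k).aestronglyMeasurable
  have h4 := condExp_indep_eq (hξ.measurable' k).comap_le (𝒢.le k)
    (comap_measurable (ξ k)).stronglyMeasurable (hξ.indep k).symm
  filter_upwards [h3, h4] with ω h h'
  rw [h, Pi.smul_apply', h', hξ.integral_eq_zero]
  simp

end Transform

/-- A predictable transform of centred noise is a martingale difference sequence. The constant `C ^
s * c s` sees the noise only through its moment constants, so it is uniform over all probability
spaces and cell partitions. -/
lemma HasMartingaleType.exists_transformBound {V : Type u} [NormedAddCommGroup V] [NormedSpace ℝ V]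
    [CompleteSpace V] {s : ℝ} (hV : HasMartingaleType.{w} V s) (hs : 1 ≤ s) (c : ℝ → ℝ≥0) :
    ∃ C : ℝ≥0, ∀ (Ω : Type w) [mΩ : MeasurableSpace Ω] (P : Measure Ω) [IsProbabilityMeasure P]
      (𝒢 : Filtration ℕ mΩ) (ξ : ℕ → Ω → ℝ) (m : ℕ → ℝ≥0∞), IsNoise P 𝒢 ξ m c →
      TransformBound V P 𝒢 ξ m s C := by
  obtain ⟨C, hC⟩ := hV
  refine ⟨C ^ s * c s, fun Ω mΩ P _ 𝒢 ξ m hξ v hv n => ?_⟩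
  have hs0 : 0 < s := by linarith
  -- The filtration is shifted by one: `ξ k • v k` is known at time `k + 1` of `𝒢` and is centred
  -- given `𝒢 k`.
  let ℱ : Filtration ℕ mΩ :=
    ⟨fun k => 𝒢 (k + 1), fun i j h => 𝒢.mono (Nat.succ_le_succ h), fun k => 𝒢.le _⟩
  have hd : IsMartingaleDifference P ℱ (fun k => ξ k • v k) := by
    refine ⟨fun k => ?_, fun k => ?_, fun k => condExp_smul_eq_zero hξ hv (k + 1)⟩
    · exact StronglyMeasurable.smul (hξ.measurable k).stronglyMeasurable
        ((hv.stronglyMeasurable k).mono (𝒢.mono (Nat.le_succ k)))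
    · have := hv.memLp_smul hξ le_rfl k
      rw [ENNReal.ofReal_one] at this
      exact memLp_one_iff_integrable.1 this
  have h := hC Ω P ℱ (fun k => ξ k • v k) n hd fun k => hv.memLp_smul hξ hs k
  have h' := ENNReal.rpow_le_rpow h hs0.le
  rw [ENNReal.mul_rpow_of_nonneg _ _ hs0.le, ← ENNReal.rpow_mul, ← ENNReal.rpow_mul,
    one_div_mul_cancel hs0.ne', ENNReal.rpow_one, ENNReal.rpow_one] at h'
  refine h'.trans ?_
  push_cast
  rw [ENNReal.coe_rpow_of_nonneg _ hs0.le, mul_assoc]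
  gcongr
  exact lintegral_sum_enorm_smul_rpow_le hξ hv hs n

section Transform

variable {Ω V : Type*} {mΩ : MeasurableSpace Ω} [NormedAddCommGroup V] [NormedSpace ℝ V]
  {P : Measure Ω} {𝒢 : Filtration ℕ mΩ} {ξ : ℕ → Ω → ℝ} {m : ℕ → ℝ≥0∞} {c : ℝ → ℝ≥0}
  {v : ℕ → Ω → V}

/-- Restricting the coefficients to a random window `[i, j)` produces the increment of the partial
sums over it. When the window is predictable, this expresses stopping within the class of
transforms. -/
lemma transformSum_indicator {A : ℕ → Set Ω} {i j n : ℕ} {ω : Ω} (hij : i ≤ j) (hjn : j ≤ n)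
    (hA : ∀ k < n, ω ∈ A k ↔ i ≤ k ∧ k < j) :
    transformSum ξ (fun k => (A k).indicator (v k)) n ω =
      transformSum ξ v j ω - transformSum ξ v i ω := by
  classical
  unfold transformSum
  rw [← Finset.sum_Ico_eq_sub _ hij, ← Finset.sum_filter_add_sum_filter_not (Finset.range n)
    (fun k => ω ∈ A k), Finset.sum_congr rfl (g := fun k => ξ k ω • v k ω), add_eq_left.2]
  · refine Finset.sum_congr ?_ fun _ _ => rfl
    ext k
    simp only [Finset.mem_filter, Finset.mem_range, Finset.mem_Ico]
    constructor
    · rintro ⟨h1, h2⟩; exact (hA k h1).1 h2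
    · intro h; exact ⟨by omega, (hA k (by omega)).2 h⟩
  · refine Finset.sum_eq_zero fun k hk => ?_
    simp [Set.indicator_of_notMem (Finset.mem_filter.1 hk).2]
  · intro k hk
    simp [Set.indicator_of_mem (Finset.mem_filter.1 hk).2]

lemma meas_lt_le_lintegral_div {f : Ω → ℝ≥0∞} (hf : AEMeasurable f P) {L : ℝ≥0∞} (hL : L ≠ 0)
    (hL' : L ≠ ∞) {s : ℝ} (hs : 0 < s) :
    P {ω | L < f ω} ≤ (∫⁻ ω, f ω ^ s ∂P) / L ^ s := by
  refine le_trans (measure_mono fun ω hω => ?_) (meas_ge_le_lintegral_div (hf.pow_const s)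
    (by simp [hL, hL']) (ENNReal.rpow_ne_top_of_nonneg hs.le hL'))
  exact ENNReal.rpow_le_rpow (le_of_lt hω) hs.le

/-- Sums stopped before they exceed a level do not exceed it. -/
lemma sum_stopped_le {a : ℕ → ℝ≥0∞} {K : ℝ≥0∞} {A : ℕ → Prop} [DecidablePred A]
    (hA : ∀ k, A k → ∑ i ∈ Finset.range (k + 1), a i ≤ K) (n : ℕ) :
    ∑ k ∈ Finset.range n, (if A k then a k else 0) ≤ min K (∑ k ∈ Finset.range n, a k) := by
  refine le_min ?_ (Finset.sum_le_sum fun k _ => by split_ifs <;> simp)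
  induction n with
  | zero => simp
  | succ n ih =>
    -- If the last index is kept, the hypothesis bounds even the unstopped sum; if not, it
    -- contributes nothing.
    by_cases h : A n
    · refine le_trans (Finset.sum_le_sum fun k _ => ?_) (hA n h)
      split_ifs <;> simp
    · rw [Finset.sum_range_succ, if_neg h, add_zero]; exact ih

/-- The weak-type maximal inequality. -/
lemma TransformBound.meas_lt_transformMax_le {s : ℝ} {C : ℝ≥0} (h : TransformBound V P 𝒢 ξ m s C)
    (hs : 0 < s) (hξ : IsNoise P 𝒢 ξ m c) (hv : IsBoundedPredictable P 𝒢 v) (n : ℕ) {L : ℝ≥0∞}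
    (hL : L ≠ 0) (hL' : L ≠ ∞) :
    P {ω | L < transformMax ξ v n ω} ≤
      C * (∫⁻ ω, ∑ k ∈ Finset.range n, m k * ‖v k ω‖ₑ ^ s ∂P) / L ^ s := by
  -- The coefficients are switched off once the level has been passed, so the sum freezes at its
  -- first value above `L` and Chebyshev's inequality for the frozen sum controls the maximum.
  let A : ℕ → Set Ω := fun k => {ω | transformMax ξ v k ω ≤ L}
  have hA : ∀ k, MeasurableSet[𝒢 k] (A k) := fun k =>
    measurable_transformMax hξ hv k measurableSet_Iic
  have hv' := hv.indicator hA
  have h1 : {ω | L < transformMax ξ v n ω} ⊆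
      {ω | L < ‖transformSum ξ (fun k => (A k).indicator (v k)) n ω‖ₑ} := by
    intro ω hω
    obtain ⟨j, hjn, -, hj, hj'⟩ := exists_first_lt hω
    have : transformSum ξ (fun k => (A k).indicator (v k)) n ω =
        transformSum ξ v j ω - transformSum ξ v 0 ω := by
      refine transformSum_indicator (Nat.zero_le _) hjn fun k _ => ?_
      have := hj' k
      simp only [A, mem_ofPred_eq, ← not_lt, this]
      omega
    rw [mem_ofPred_eq, this]
    simpa [transformSum] using hj
  refine (measure_mono h1).trans ((meas_lt_le_lintegral_div
    (((stronglyMeasurable_transformSum hξ hv' n).mono (𝒢.le n)).enorm).aemeasurable hL hL' hs).trans ?_)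
  gcongr
  refine (h _ hv' n).trans ?_
  gcongr with ω k
  exact enorm_indicator_le_enorm_self _ _

/-- The layer cake formula for functions with values in `[0, ∞)`. -/
lemma lintegral_rpow_eq_layercake {f : Ω → ℝ≥0∞} (hf : Measurable f) (hf' : ∀ ω, f ω < ∞) {p : ℝ}
    (hp : 0 < p) {a : ℝ} (ha : 0 < a) :
    ∫⁻ ω, f ω ^ p ∂P = ENNReal.ofReal a ^ p * (ENNReal.ofReal p *
      ∫⁻ t in Ioi (0 : ℝ), P {ω | ENNReal.ofReal (a * t) < f ω} * ENNReal.ofReal (t ^ (p - 1))) := by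
  have h := lintegral_rpow_eq_lintegral_meas_lt_mul P (f := fun ω => (f ω).toReal / a)
    (Eventually.of_forall fun ω => by positivity) (by fun_prop) hp
  have h1 : ∀ ω, f ω ^ p = ENNReal.ofReal a ^ p * ENNReal.ofReal (((f ω).toReal / a) ^ p) := by
    intro ω
    rw [← ENNReal.ofReal_rpow_of_nonneg (by positivity) hp.le, ← ENNReal.mul_rpow_of_nonneg _ _ hp.le,
      ← ENNReal.ofReal_mul ha.le, mul_div_cancel₀ _ ha.ne', ENNReal.ofReal_toReal (hf' ω).ne]
  simp_rw [h1]
  rw [lintegral_const_mul _ (by fun_prop), h]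
  congr 2
  refine setLIntegral_congr_fun measurableSet_Ioi fun t ht => ?_
  have ht' : (0 : ℝ) < t := ht
  congr 2
  ext ω
  rw [mem_ofPred_eq, mem_ofPred_eq, lt_div_iff₀ ha, mul_comm,
    ENNReal.ofReal_lt_iff_lt_toReal (by positivity) (hf' ω).ne]

end Transform

/-! ### The good-`λ` method and the maximal inequality with two norms. -/

section GoodLambda

variable {Ω V : Type*} {mΩ : MeasurableSpace Ω} [NormedAddCommGroup V] [NormedSpace ℝ V]
  {P : Measure Ω} {𝒢 : Filtration ℕ mΩ} {ξ : ℕ → Ω → ℝ} {m : ℕ → ℝ≥0∞} {c : ℝ → ℝ≥0}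
  {v : ℕ → Ω → V}

/-- Integration of a good-`λ` inequality. -/
lemma lintegral_rpow_le_of_goodLambda {F G : Ω → ℝ≥0∞} (hF : Measurable F) (hG : Measurable G)
    (hF' : ∀ ω, F ω < ∞) (hG' : ∀ ω, G ω < ∞) {p : ℝ} (hp : 0 < p)
    (hint : ∫⁻ ω, F ω ^ p ∂P < ∞) {δ : ℝ} (hδ : 0 < δ) {ε : ℝ≥0∞} (hε : 3 ^ p * ε ≤ 2⁻¹)
    (h : ∀ t : ℝ, 0 < t → P {ω | ENNReal.ofReal (3 * t) < F ω ∧ G ω ≤ ENNReal.ofReal (δ * t)} ≤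
      ε * P {ω | ENNReal.ofReal (1 * t) < F ω}) :
    ENNReal.ofReal δ ^ p * ∫⁻ ω, F ω ^ p ∂P ≤ 2 * 3 ^ p * ∫⁻ ω, G ω ^ p ∂P := by
  let I : (Ω → ℝ≥0∞) → ℝ → ℝ≥0∞ := fun f a => ENNReal.ofReal p *
      ∫⁻ t in Ioi (0 : ℝ), P {ω | ENNReal.ofReal (a * t) < f ω} * ENNReal.ofReal (t ^ (p - 1))
  have h3 : ∫⁻ ω, F ω ^ p ∂P = 3 ^ p * I F 3 := by
    rw [lintegral_rpow_eq_layercake hF hF' hp (a := 3) (by norm_num)]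
    simp [I]
  have h1 : ∫⁻ ω, F ω ^ p ∂P = I F 1 := by
    rw [lintegral_rpow_eq_layercake hF hF' hp (a := 1) (by norm_num)]
    simp [I]
  have hG2 : ∫⁻ ω, G ω ^ p ∂P = ENNReal.ofReal δ ^ p * I G δ :=
    lintegral_rpow_eq_layercake hG hG' hp hδ
  have hmeas : ∀ f : Ω → ℝ≥0∞, ∀ a : ℝ, 0 ≤ a → Measurable fun t : ℝ =>
      P {ω | ENNReal.ofReal (a * t) < f ω} := by
    intro f a ha
    refine Antitone.measurable fun x y hxy => measure_mono fun ω hω => ?_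
    refine lt_of_le_of_lt (ENNReal.ofReal_le_ofReal ?_) hω
    gcongr
  have hI : I F 3 ≤ ε * I F 1 + I G δ := by
    have hm1 : Measurable fun t : ℝ => P {ω | ENNReal.ofReal (1 * t) < F ω} *
        ENNReal.ofReal (t ^ (p - 1)) := by
      exact (hmeas F 1 zero_le_one).mul (by fun_prop)
    calc I F 3 ≤ ENNReal.ofReal p * ∫⁻ t in Ioi (0 : ℝ),
          (ε * (P {ω | ENNReal.ofReal (1 * t) < F ω} * ENNReal.ofReal (t ^ (p - 1))) +
            P {ω | ENNReal.ofReal (δ * t) < G ω} * ENNReal.ofReal (t ^ (p - 1))) := by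
          refine mul_le_mul_right (setLIntegral_mono' measurableSet_Ioi fun t ht => ?_) _
          rw [← mul_assoc, ← add_mul]
          refine mul_le_mul_left ?_ _
          refine le_trans ?_ (add_le_add_left (h t ht) _)
          refine le_trans (measure_mono fun ω hω => ?_) (measure_union_le _ _)
          by_cases hg : G ω ≤ ENNReal.ofReal (δ * t)
          · exact Or.inl ⟨hω, hg⟩
          · exact Or.inr (not_le.1 hg)
      _ = _ := by
          rw [lintegral_add_left (hm1.const_mul _), lintegral_const_mul _ hm1, mul_add]
          simp only [I]
          ring
  rw [← h1] at hI
  set X := ∫⁻ ω, F ω ^ p ∂P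
  have hX : X ≤ 2⁻¹ * X + 3 ^ p * I G δ := by
    calc X = 3 ^ p * I F 3 := h3
      _ ≤ 3 ^ p * (ε * X + I G δ) := by gcongr
      _ = 3 ^ p * ε * X + 3 ^ p * I G δ := by ring
      _ ≤ _ := by gcongr
  -- Half of `X` is absorbed into the left side, which requires `X` to be finite.
  have hX2 : X ≤ 2 * (3 ^ p * I G δ) := by
    have h4 : 2⁻¹ * X ≤ 3 ^ p * I G δ := by
      have : 2⁻¹ * X + 2⁻¹ * X ≤ 2⁻¹ * X + 3 ^ p * I G δ := by
        rw [← add_mul, ENNReal.inv_two_add_inv_two, one_mul]; exact hX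
      exact (ENNReal.add_le_add_iff_left (ENNReal.mul_ne_top (by simp) hint.ne)).1 this
    calc X = 2 * (2⁻¹ * X) := by
          rw [← mul_assoc, ENNReal.mul_inv_cancel (by simp) (by simp), one_mul]
      _ ≤ _ := by gcongr
  calc ENNReal.ofReal δ ^ p * X ≤ ENNReal.ofReal δ ^ p * (2 * (3 ^ p * I G δ)) := by gcongr
    _ = 2 * 3 ^ p * (ENNReal.ofReal δ ^ p * I G δ) := by ring
    _ = _ := by rw [hG2]

/-- A priori finiteness, without any uniformity in `n`; it serves only to justify the absorption in
`lintegral_rpow_le_of_goodLambda`. -/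
lemma lintegral_transformMax_rpow_lt_top (hξ : IsNoise P 𝒢 ξ m c) (hv : IsBoundedPredictable P 𝒢 v)
    {p : ℝ} (hp : 1 ≤ p) (n : ℕ) : ∫⁻ ω, transformMax ξ v n ω ^ p ∂P < ∞ := by
  have h1 : MemLp (fun ω => ∑ k ∈ Finset.range n, ‖(ξ k • v k) ω‖) (ENNReal.ofReal p) P :=
    memLp_finsetSum _ fun k _ => (hv.memLp_smul hξ hp k).norm
  have h2 := h1.2
  rw [eLpNorm_lt_top_iff_lintegral_rpow_enorm_lt_top (by simp; linarith) (by simp),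
    ENNReal.toReal_ofReal (by linarith)] at h2
  refine lt_of_le_of_lt (lintegral_mono fun ω => ?_) h2
  refine ENNReal.rpow_le_rpow ?_ (by linarith)
  refine Finset.sup_le fun k hk => ?_
  have hk' : k ≤ n := Nat.lt_succ_iff.1 (Finset.mem_range.1 hk)
  rw [Real.enorm_of_nonneg (by positivity), ENNReal.ofReal_sum_of_nonneg (fun _ _ => by positivity)]
  refine (enorm_sum_le _ _).trans ?_
  calc _ ≤ ∑ i ∈ Finset.range n, ‖ξ i ω • v i ω‖ₑ :=
        Finset.sum_le_sum_of_subset (Finset.range_mono hk')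
    _ = _ := by simp

/-- The good-`λ` inequality for transforms. -/
lemma TransformBound.goodLambda {s : ℝ} {C : ℝ≥0} (h : TransformBound V P 𝒢 ξ m s C)
    (hs : 0 < s) (hξ : IsNoise P 𝒢 ξ m c) (hv : IsBoundedPredictable P 𝒢 v) (n : ℕ) {L D : ℝ≥0∞}
    (hL : L ≠ 0) (hL' : L ≠ ∞) (hD : D ≤ L) :
    P {ω | 3 * L < transformMax ξ v n ω ∧ (∀ k < n, ‖ξ k ω • v k ω‖ₑ ≤ D) ∧
        ∑ k ∈ Finset.range n, m k * ‖v k ω‖ₑ ^ s ≤ D ^ s} ≤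
      C * (D / L) ^ s * P {ω | L < transformMax ξ v n ω} := by
  classical
  -- The window between passing `L` and passing `3 * L`, cut off when the `s`-variation exceeds `D ^
  -- s`. The sum may include index `k` and the window is still predictable, since `v k` is
  -- measurable at time `k`.
  let A : ℕ → Set Ω := fun k => {ω | L < transformMax ξ v k ω} ∩
    ({ω | transformMax ξ v k ω ≤ 3 * L} ∩
      {ω | ∑ i ∈ Finset.range (k + 1), m i * ‖v i ω‖ₑ ^ s ≤ D ^ s})
  have hA : ∀ k, MeasurableSet[𝒢 k] (A k) := by
    intro k
    refine MeasurableSet.inter (measurable_transformMax hξ hv k measurableSet_Ioi)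
      (MeasurableSet.inter (measurable_transformMax hξ hv k measurableSet_Iic) ?_)
    have : Measurable[𝒢 k] fun ω => ∑ i ∈ Finset.range (k + 1), m i * ‖v i ω‖ₑ ^ s := by
      refine Finset.measurable_sum _ fun i hi => ?_
      have hik : i ≤ k := Nat.lt_succ_iff.1 (Finset.mem_range.1 hi)
      exact (((hv.measurable_enorm i).mono (𝒢.mono hik) le_rfl).pow_const s).const_mul _
    exact this measurableSet_Iic
  have hv' := hv.indicator hA
  have h1 : {ω | 3 * L < transformMax ξ v n ω ∧ (∀ k < n, ‖ξ k ω • v k ω‖ₑ ≤ D) ∧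
        ∑ k ∈ Finset.range n, m k * ‖v k ω‖ₑ ^ s ≤ D ^ s} ⊆
      {ω | L < ‖transformSum ξ (fun k => (A k).indicator (v k)) n ω‖ₑ} := by
    rintro ω ⟨hω, hd, hσ⟩
    obtain ⟨j, hjn, -, hj, hj'⟩ := exists_first_lt hω
    have hω' : L < transformMax ξ v n ω :=
      lt_of_le_of_lt (by
        calc L = 1 * L := (one_mul L).symm
          _ ≤ 3 * L := by gcongr; norm_num) hω
    obtain ⟨i, hin, hi0, hi, hi'⟩ := exists_first_lt hω'
    have hij : i ≤ j := by
      rw [← hi']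
      have := (hj' j).2 le_rfl
      exact lt_of_le_of_lt (by
        calc L = 1 * L := (one_mul L).symm
          _ ≤ 3 * L := by gcongr; norm_num) this
    have hsum : transformSum ξ (fun k => (A k).indicator (v k)) n ω =
        transformSum ξ v j ω - transformSum ξ v i ω := by
      refine transformSum_indicator hij hjn fun k hkn => ?_
      have e1 := hi' k
      have e2 := hj' k
      have e3 : ∑ i ∈ Finset.range (k + 1), m i * ‖v i ω‖ₑ ^ s ≤ D ^ s :=
        (Finset.sum_le_sum_of_subset (Finset.range_mono hkn)).trans hσ
      have e4 : transformMax ξ v k ω ≤ 3 * L ↔ k < j := by rw [← not_lt, e2, not_le]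
      simp only [A, mem_inter_iff, mem_ofPred_eq, e1, e3, and_true, e4]
    -- The first crossing of `L` overshoots by at most one jump, which is at most `D ≤ L`. The
    -- increment from there to beyond `3 * L` must therefore exceed `L`.
    have hMi : ‖transformSum ξ v i ω‖ₑ ≤ 2 * L := by
      obtain ⟨i, rfl⟩ : ∃ i', i = i' + 1 := ⟨i - 1, by omega⟩
      have e1 : ‖transformSum ξ v i ω‖ₑ ≤ L := by
        by_contra hc
        have := (hi' i).1 (lt_transformMax_iff.2 ⟨i, le_rfl, not_le.1 hc⟩)
        omega
      rw [transformSum, Finset.sum_range_succ, two_mul]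
      exact (enorm_add_le _ _).trans (add_le_add e1 ((hd i (by omega)).trans hD))
    rw [mem_ofPred_eq, hsum]
    have e4 : ‖transformSum ξ v j ω‖ₑ ≤ ‖transformSum ξ v j ω - transformSum ξ v i ω‖ₑ + 2 * L := by
      calc ‖transformSum ξ v j ω‖ₑ =
          ‖(transformSum ξ v j ω - transformSum ξ v i ω) + transformSum ξ v i ω‖ₑ := by simp
        _ ≤ _ := (enorm_add_le _ _).trans (by gcongr)
    by_contra hc
    have : ‖transformSum ξ v j ω‖ₑ ≤ 3 * L := by
      refine e4.trans ?_
      calc _ ≤ L + 2 * L := by gcongr; exact not_lt.1 hc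
        _ = 3 * L := by ring
    exact absurd hj (not_lt.2 this)
  refine (measure_mono h1).trans ((meas_lt_le_lintegral_div
    (((stronglyMeasurable_transformSum hξ hv' n).mono (𝒢.le n)).enorm).aemeasurable hL hL' hs).trans ?_)
  have hE : MeasurableSet {ω | L < transformMax ξ v n ω} :=
    measurable_transformMax' hξ hv n measurableSet_Ioi
  -- The stopped `s`-variation is at most `D ^ s` and vanishes where the level `L` is never passed;
  -- this is the source of the factor `P {L < max}` on the right.
  have h2 : ∫⁻ ω, ∑ k ∈ Finset.range n, m k * ‖(A k).indicator (v k) ω‖ₑ ^ s ∂P ≤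
      D ^ s * P {ω | L < transformMax ξ v n ω} := by
    rw [← lintegral_indicator_const hE]
    refine lintegral_mono fun ω => ?_
    have e : ∀ k, m k * ‖(A k).indicator (v k) ω‖ₑ ^ s =
        if ω ∈ A k then m k * ‖v k ω‖ₑ ^ s else 0 := by
      intro k
      by_cases hk : ω ∈ A k <;> simp [hk, hs]
    simp_rw [e]
    by_cases hω : L < transformMax ξ v n ω
    · rw [indicator_of_mem (show ω ∈ {ω | L < transformMax ξ v n ω} from hω)]
      exact (sum_stopped_le (fun k hk => hk.2.2) n).trans (min_le_left _ _)
    · rw [Finset.sum_eq_zero]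
      · positivity
      · intro k hk
        rw [if_neg]
        intro hk'
        exact hω (lt_of_lt_of_le hk'.1 (transformMax_mono (Finset.mem_range.1 hk).le ω))
  calc _ ≤ (C * (D ^ s * P {ω | L < transformMax ξ v n ω})) / L ^ s := by
        gcongr
        exact (h _ hv' n).trans (by gcongr)
    _ = _ := by
        rw [ENNReal.div_rpow_of_nonneg _ _ hs.le]
        simp only [div_eq_mul_inv]
        ring

/-- The maximal inequality of Rosenthal type for transforms. -/
lemma exists_lintegral_transformMax_rpow_le {s : ℝ} (hs : 1 ≤ s) (C : ℝ≥0) (c : ℝ → ℝ≥0) {p : ℝ}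
    (hp : 1 ≤ p) : ∃ K : ℝ≥0, ∀ {Ω V : Type*} {mΩ : MeasurableSpace Ω} [NormedAddCommGroup V]
      [NormedSpace ℝ V] {P : Measure Ω} {𝒢 : Filtration ℕ mΩ} {ξ : ℕ → Ω → ℝ} {m : ℕ → ℝ≥0∞}
      {v : ℕ → Ω → V}, TransformBound V P 𝒢 ξ m s C → IsNoise P 𝒢 ξ m c → IsBoundedPredictable P 𝒢 v →
      ∀ n, ∫⁻ ω, transformMax ξ v n ω ^ p ∂P ≤
        K * (∫⁻ ω, (∑ k ∈ Finset.range n, m k * ‖v k ω‖ₑ ^ s) ^ (p / s) ∂P +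
          ∫⁻ ω, ∑ k ∈ Finset.range n, m k * ‖v k ω‖ₑ ^ p ∂P) := by
  have hs0 : 0 < s := by linarith
  have hp0 : 0 < p := by linarith
  have hC1 : (1 : ℝ) ≤ 2 * 3 ^ p * (C + 1) := by
    have h1 : (1 : ℝ) ≤ 3 ^ p := Real.one_le_rpow (by norm_num) hp0.le
    have h2 : (0 : ℝ) ≤ C := C.2
    nlinarith
  -- Chosen so that `3 ^ p * C * δ ^ s ≤ 1 / 2`, as the absorption requires; `C + 1` guards against
  -- `C = 0` and ensures `δ ≤ 1`.
  set δ : ℝ := (1 / (2 * 3 ^ p * (C + 1))) ^ (1 / s) with hδdef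
  have hδ0 : 0 < δ := by positivity
  have hδ1 : δ ≤ 1 := by
    refine Real.rpow_le_one (by positivity) ?_ (by positivity)
    rw [div_le_one (by linarith)]; exact hC1
  have hδs : δ ^ s = 1 / (2 * 3 ^ p * (C + 1)) := by
    rw [hδdef, ← Real.rpow_mul (by positivity), one_div_mul_cancel hs0.ne', Real.rpow_one]
  have hε : (3 : ℝ≥0∞) ^ p * (C * ENNReal.ofReal δ ^ s) ≤ 2⁻¹ := by
    have e1 : (3 : ℝ≥0∞) ^ p = ENNReal.ofReal (3 ^ p) := by
      rw [← ENNReal.ofReal_rpow_of_nonneg (by norm_num) hp0.le]; norm_num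
    have e2 : (2 : ℝ≥0∞)⁻¹ = ENNReal.ofReal (2⁻¹) := by
      rw [ENNReal.ofReal_inv_of_pos (by norm_num)]; norm_num
    rw [ENNReal.ofReal_rpow_of_nonneg hδ0.le hs0.le, hδs, e1, e2, ← ENNReal.ofReal_coe_nnreal,
      ← ENNReal.ofReal_mul (by positivity), ← ENNReal.ofReal_mul (by positivity)]
    refine ENNReal.ofReal_le_ofReal ?_
    have h2 : (0 : ℝ) ≤ C := C.2
    have h3 : (0 : ℝ) < 3 ^ p := by positivity
    field_simp
    linarith
  refine ⟨(2 * 3 ^ p * (1 / δ.toNNReal) ^ p) * (2 ^ p * (1 + c p)), ?_⟩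
  intro Ω V mΩ _ _ P 𝒢 ξ m v h hξ hv n
  let d : Ω → ℝ≥0∞ := fun ω => (Finset.range n).sup fun k => ‖ξ k ω • v k ω‖ₑ
  let σ : Ω → ℝ≥0∞ := fun ω => (∑ k ∈ Finset.range n, m k * ‖v k ω‖ₑ ^ s) ^ (1 / s)
  have hm1 : Measurable fun ω => ∑ k ∈ Finset.range n, m k * ‖v k ω‖ₑ ^ s :=
    Finset.measurable_sum _ fun k _ => ((hv.measurable_enorm' k).pow_const s).const_mul _
  have hm2 : ∀ k, Measurable fun ω => ‖ξ k ω • v k ω‖ₑ := fun k => by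
    simp_rw [enorm_smul]
    exact ((hξ.measurable' k).enorm).mul (hv.measurable_enorm' k)
  have hdm : Measurable d := by
    simp only [d, Finset.sup_eq_iSup]
    exact Measurable.iSup fun k => Measurable.iSup fun _ => hm2 k
  have hσm : Measurable σ := hm1.pow_const _
  have hdf : ∀ ω, d ω < ∞ := fun ω => by
    simp only [d]
    rw [Finset.sup_lt_iff (by simp)]
    simp
  have hσf : ∀ ω, σ ω < ∞ := fun ω => by
    refine ENNReal.rpow_lt_top_of_nonneg (by positivity) (ENNReal.sum_lt_top.2 fun k _ => ?_).ne
    exact ENNReal.mul_lt_top ((hξ.le_one k).trans_lt ENNReal.one_lt_top)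
      (ENNReal.rpow_lt_top_of_nonneg hs0.le (by simp))
  have key := lintegral_rpow_le_of_goodLambda (P := P) (F := transformMax ξ v n)
    (G := fun ω => d ω + σ ω)
    (measurable_transformMax' hξ hv n) (hdm.add hσm) (transformMax_lt_top n)
    (fun ω => ENNReal.add_lt_top.2 ⟨hdf ω, hσf ω⟩) hp0
    (lintegral_transformMax_rpow_lt_top hξ hv hp n) hδ0 hε ?_
  · have hG : ∫⁻ ω, (d ω + σ ω) ^ p ∂P ≤ 2 ^ p * (1 + c p) *
        (∫⁻ ω, (∑ k ∈ Finset.range n, m k * ‖v k ω‖ₑ ^ s) ^ (p / s) ∂P +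
          ∫⁻ ω, ∑ k ∈ Finset.range n, m k * ‖v k ω‖ₑ ^ p ∂P) := by
      have e1 : ∀ ω, (d ω + σ ω) ^ p ≤ 2 ^ p * (∑ k ∈ Finset.range n, ‖ξ k ω • v k ω‖ₑ ^ p +
          (∑ k ∈ Finset.range n, m k * ‖v k ω‖ₑ ^ s) ^ (p / s)) := by
        intro ω
        -- The largest jump is replaced by the sum over all jumps, whose expectation is computable
        -- by independence; this gives the `D_p^p` term.
        have e2 : d ω ^ p ≤ ∑ k ∈ Finset.range n, ‖ξ k ω • v k ω‖ₑ ^ p := by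
          rcases Nat.eq_zero_or_pos n with rfl | hn
          · simp [d, hp0]
          · obtain ⟨k, hk, hk'⟩ := Finset.exists_mem_eq_sup (Finset.range n) ⟨0, by simpa⟩
              (fun k => ‖ξ k ω • v k ω‖ₑ)
            simp only [d, hk']
            exact Finset.single_le_sum (f := fun k => ‖ξ k ω • v k ω‖ₑ ^ p)
              (fun _ _ => zero_le) hk
        have e3 : σ ω ^ p = (∑ k ∈ Finset.range n, m k * ‖v k ω‖ₑ ^ s) ^ (p / s) := by
          simp only [σ]
          rw [← ENNReal.rpow_mul]; congr 1; ring
        rw [← e3]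
        calc (d ω + σ ω) ^ p ≤ (2 * max (d ω) (σ ω)) ^ p := by
              gcongr
              rw [two_mul]; exact add_le_add (le_max_left _ _) (le_max_right _ _)
          _ = 2 ^ p * max (d ω ^ p) (σ ω ^ p) := by
              rw [ENNReal.mul_rpow_of_nonneg _ _ hp0.le]
              congr 1
              exact (ENNReal.monotone_rpow_of_nonneg hp0.le).map_max
          _ ≤ 2 ^ p * (d ω ^ p + σ ω ^ p) := by
              gcongr; exact max_le_add_of_nonneg (by positivity) (by positivity)
          _ ≤ _ := by gcongr
      refine (lintegral_mono e1).trans ?_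
      have hm3 : Measurable fun ω => ∑ k ∈ Finset.range n, ‖ξ k ω • v k ω‖ₑ ^ p :=
        Finset.measurable_sum _ fun k _ => (hm2 k).pow_const p
      rw [lintegral_const_mul _ (show Measurable fun ω => ∑ k ∈ Finset.range n, ‖ξ k ω • v k ω‖ₑ ^ p +
          (∑ k ∈ Finset.range n, m k * ‖v k ω‖ₑ ^ s) ^ (p / s) from hm3.add (hm1.pow_const _)), lintegral_add_left hm3,
        lintegral_finsetSum _ fun k _ => (hm2 k).pow_const p, mul_assoc]
      gcongr
      refine (add_le_add_left (lintegral_sum_enorm_smul_rpow_le hξ hv hp n) _).trans ?_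
      rw [add_comm, add_mul, mul_add, mul_add, one_mul, one_mul]
      refine add_le_add ?_ ?_
      · exact le_self_add
      · exact le_add_self
    have hδp : ENNReal.ofReal δ ^ p ≠ 0 := by
      simp [hδ0, hp0]
    have hδp' : ENNReal.ofReal δ ^ p ≠ ∞ := ENNReal.rpow_ne_top_of_nonneg hp0.le (by simp)
    calc ∫⁻ ω, transformMax ξ v n ω ^ p ∂P
        = (ENNReal.ofReal δ ^ p)⁻¹ * (ENNReal.ofReal δ ^ p * ∫⁻ ω, transformMax ξ v n ω ^ p ∂P) := by
          rw [← mul_assoc, ENNReal.inv_mul_cancel hδp hδp', one_mul]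
      _ ≤ (ENNReal.ofReal δ ^ p)⁻¹ * (2 * 3 ^ p * (2 ^ p * (1 + c p) *
          (∫⁻ ω, (∑ k ∈ Finset.range n, m k * ‖v k ω‖ₑ ^ s) ^ (p / s) ∂P +
          ∫⁻ ω, ∑ k ∈ Finset.range n, m k * ‖v k ω‖ₑ ^ p ∂P))) := by
          exact mul_le_mul_right (key.trans (mul_le_mul_right hG _)) _
      _ = _ := by
          push_cast
          rw [ENNReal.coe_rpow_of_nonneg _ hp0.le, ENNReal.coe_rpow_of_nonneg _ hp0.le,
            ENNReal.coe_rpow_of_nonneg _ hp0.le, one_div, ENNReal.coe_inv (by simpa using hδ0),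
            ENNReal.inv_rpow]
          simp only [ENNReal.ofReal]
          push_cast
          ring
  · intro t ht
    have hL : ENNReal.ofReal t ≠ 0 := by simpa using ht
    have := h.goodLambda hs0 hξ hv n (L := ENNReal.ofReal t) (D := ENNReal.ofReal (δ * t)) hL
      (by simp) (ENNReal.ofReal_le_ofReal (by nlinarith))
    refine le_trans (measure_mono ?_) (this.trans_eq ?_)
    · rintro ω ⟨h1, h2⟩
      refine ⟨?_, fun k hk => ?_, ?_⟩
      · rw [ENNReal.ofReal_mul (by norm_num)] at h1
        simpa using h1
      · exact (Finset.le_sup (f := fun k => ‖ξ k ω • v k ω‖ₑ) (Finset.mem_range.2 hk)).trans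
          (le_self_add.trans h2)
      · have h3 : σ ω ≤ ENNReal.ofReal (δ * t) := le_add_self.trans h2
        have h4 := ENNReal.rpow_le_rpow h3 hs0.le
        simp only [σ] at h4
        rwa [← ENNReal.rpow_mul, one_div_mul_cancel hs0.ne', ENNReal.rpow_one] at h4
    · rw [one_mul, ENNReal.ofReal_mul hδ0.le, ENNReal.mul_div_cancel_right hL (by simp)]

end GoodLambda

/-! ### Exponents below the martingale type -/

section Truncation

variable {Ω V : Type*} {mΩ : MeasurableSpace Ω} [NormedAddCommGroup V] [NormedSpace ℝ V]
  {P : Measure Ω} {𝒢 : Filtration ℕ mΩ} {ξ : ℕ → Ω → ℝ} {m : ℕ → ℝ≥0∞} {c : ℝ → ℝ≥0}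
  {v : ℕ → Ω → V}

/-- The `s`-th power, scaled by `L` and truncated at `1`. -/
def truncPow (s : ℝ) (L x : ℝ≥0∞) : ℝ≥0∞ := min 1 ((x / L) ^ s)

lemma measurable_truncPow (s : ℝ) : Measurable fun q : ℝ≥0∞ × ℝ≥0∞ => truncPow s q.1 q.2 := by
  unfold truncPow
  fun_prop

lemma truncPow_of_lt {s : ℝ} (hs : 0 ≤ s) {L x : ℝ≥0∞} (hL : L ≠ 0) (h : L < x) :
    truncPow s L x = 1 := by
  refine min_eq_left ?_
  have h1 : 1 ≤ x / L := by
    rw [ENNReal.le_div_iff_mul_le (Or.inl hL) (Or.inl h.ne_top), one_mul]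
    exact h.le
  calc (1 : ℝ≥0∞) = 1 ^ s := (ENNReal.one_rpow s).symm
    _ ≤ _ := ENNReal.rpow_le_rpow h1 hs

lemma rpow_eq_mul_truncPow {s : ℝ} (hs : 0 ≤ s) {L x : ℝ≥0∞} (hL : L ≠ 0) (hL' : L ≠ ∞)
    (h : x ≤ L) : x ^ s = L ^ s * truncPow s L x := by
  have h1 : (x / L) ^ s ≤ 1 := ENNReal.rpow_le_one (ENNReal.div_le_of_le_mul (by simpa using h)) hs
  rw [truncPow, min_eq_right h1, ← ENNReal.mul_rpow_of_nonneg _ _ hs, ENNReal.mul_div_cancel hL hL']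

/-- The part of `x` above the level `L`. -/
def abovePart (L x : ℝ≥0∞) : ℝ≥0∞ := if L < x then x else 0

lemma measurable_abovePart : Measurable fun q : ℝ≥0∞ × ℝ≥0∞ => abovePart q.1 q.2 := by
  unfold abovePart
  exact Measurable.ite (measurableSet_lt measurable_fst measurable_snd) measurable_snd
    measurable_const

/-- Tail estimate for the maximal function of a transform in terms of truncations. -/
lemma TransformBound.meas_two_mul_lt_transformMax_le [IsProbabilityMeasure P] {s : ℝ} {C : ℝ≥0}
    (h : TransformBound V P 𝒢 ξ m s C)
    (hs : 0 < s) (hξ : IsNoise P 𝒢 ξ m c) (hv : IsBoundedPredictable P 𝒢 v) (n : ℕ) {L : ℝ≥0∞}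
    (hL : L ≠ 0) (hL' : L ≠ ∞) :
    P {ω | 2 * L < transformMax ξ v n ω} ≤
      (C + 2) * ∫⁻ ω, min 1 (∑ k ∈ Finset.range n, m k * truncPow s L ‖v k ω‖ₑ) ∂P +
      P {ω | L < ∑ k ∈ Finset.range n, m k * abovePart L ‖v k ω‖ₑ} := by
  classical
  let Λ : ℕ → Ω → ℝ≥0∞ := fun k ω => ∑ i ∈ Finset.range k, m i * truncPow s L ‖v i ω‖ₑ
  have hθ : Measurable (truncPow s L) :=
    (measurable_truncPow s).comp (measurable_const.prodMk measurable_id)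
  have hΛ : ∀ k, Measurable[𝒢 k] (Λ (k + 1)) := fun k => by
    refine Finset.measurable_sum _ fun i hi => ?_
    have hik : i ≤ k := Nat.lt_succ_iff.1 (Finset.mem_range.1 hi)
    exact (hθ.comp ((hv.measurable_enorm i).mono (𝒢.mono hik) le_rfl)).const_mul _
  have hΛ' : Measurable (Λ n) :=
    Finset.measurable_sum _ fun i _ => (hθ.comp (hv.measurable_enorm' i)).const_mul _
  -- Small coefficients are collected on `A`, large ones on `B`, both only while the truncated sum
  -- `Λ`, the `k`-th coefficient included, is at most one.
  let A : ℕ → Set Ω := fun k => {ω | ‖v k ω‖ₑ ≤ L} ∩ {ω | Λ (k + 1) ω ≤ 1}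
  let B : ℕ → Set Ω := fun k => {ω | L < ‖v k ω‖ₑ} ∩ {ω | Λ (k + 1) ω ≤ 1}
  have hA : ∀ k, MeasurableSet[𝒢 k] (A k) := fun k =>
    MeasurableSet.inter (hv.measurable_enorm k measurableSet_Iic) (hΛ k measurableSet_Iic)
  have hB : ∀ k, MeasurableSet[𝒢 k] (B k) := fun k =>
    MeasurableSet.inter (hv.measurable_enorm k measurableSet_Ioi) (hΛ k measurableSet_Iic)
  let a : ℕ → Ω → V := fun k => (A k).indicator (v k)
  have ha : IsBoundedPredictable P 𝒢 a := hv.indicator hA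
  let J : ℕ → Set Ω := fun k => {ω | ξ k ω ≠ -(m k).toReal}
  -- Outside the four events the maximum stays below `2 * L`. The small part contributes at most
  -- `L`. No large coefficient meets a jump, so there `ξ k = -m k` and the large part is pure
  -- compensation, again at most `L`.
  have hincl : {ω | 2 * L < transformMax ξ v n ω} ⊆
      ({ω | 1 ≤ min 1 (Λ n ω)} ∪ ⋃ k ∈ Finset.range n, B k ∩ J k) ∪
        ({ω | L < transformMax ξ a n ω} ∪
          {ω | L < ∑ k ∈ Finset.range n, m k * abovePart L ‖v k ω‖ₑ}) := by
    intro ω hω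
    by_contra hc
    simp only [mem_union, not_or, mem_iUnion, not_exists, mem_ofPred_eq, not_lt,
      Finset.mem_range] at hc
    obtain ⟨⟨hc1, hc2⟩, hc3, hc4⟩ := hc
    have hΛ1 : Λ n ω ≤ 1 := by
      by_contra hcc
      exact hc1 (by rw [min_eq_left (not_le.1 hcc).le])
    have hΛk : ∀ k < n, Λ (k + 1) ω ≤ 1 := fun k hk =>
      (Finset.sum_le_sum_of_subset (Finset.range_mono hk)).trans hΛ1
    obtain ⟨j, hjn, hj⟩ := lt_transformMax_iff.1 hω
    have hsum : transformSum ξ v j ω = transformSum ξ a j ω +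
        ∑ k ∈ Finset.range j, (if L < ‖v k ω‖ₑ then ξ k ω • v k ω else 0) := by
      rw [transformSum, transformSum, ← Finset.sum_add_distrib]
      refine Finset.sum_congr rfl fun k hk => ?_
      have hk' : k < n := (Finset.mem_range.1 hk).trans_le hjn
      by_cases hb : L < ‖v k ω‖ₑ
      · have : ω ∉ A k := fun hh => absurd hb (not_lt.2 hh.1)
        simp [a, this, hb]
      · have : ω ∈ A k := ⟨not_lt.1 hb, hΛk k hk'⟩
        simp [a, this, hb]
    have hbig : ‖∑ k ∈ Finset.range j, (if L < ‖v k ω‖ₑ then ξ k ω • v k ω else 0)‖ₑ ≤ L := by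
      refine (enorm_sum_le _ _).trans (le_trans ?_ hc4)
      refine le_trans ?_ (Finset.sum_le_sum_of_subset (Finset.range_mono hjn))
      refine Finset.sum_le_sum fun k hk => ?_
      have hk' : k < n := (Finset.mem_range.1 hk).trans_le hjn
      by_cases hb : L < ‖v k ω‖ₑ
      · have hJ : ξ k ω = -(m k).toReal := by
          by_contra hh
          exact hc2 k hk' ⟨⟨hb, hΛk k hk'⟩, hh⟩
        rw [if_pos hb, abovePart, if_pos hb, hJ, enorm_smul, enorm_neg,
          Real.enorm_of_nonneg (by positivity),
          ENNReal.ofReal_toReal ((hξ.le_one k).trans_lt ENNReal.one_lt_top).ne]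
      · simp [hb, abovePart]
    have h5 : ‖transformSum ξ v j ω‖ₑ ≤ 2 * L := by
      rw [hsum, two_mul]
      exact (enorm_add_le _ _).trans
        (add_le_add ((enorm_transformSum_le_transformMax hjn ω).trans hc3) hbig)
    exact absurd hj (not_lt.2 h5)
  refine (measure_mono hincl).trans ((measure_union_le _ _).trans ?_)
  set I := ∫⁻ ω, min 1 (Λ n ω) ∂P with hI
  have hstopped : ∀ ω, ∑ k ∈ Finset.range n,
      (if Λ (k + 1) ω ≤ 1 then m k * truncPow s L ‖v k ω‖ₑ else 0) ≤ min 1 (Λ n ω) := fun ω =>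
    sum_stopped_le (A := fun k => Λ (k + 1) ω ≤ 1) (fun k hk => hk) n
  have h1 : P {ω | 1 ≤ min 1 (Λ n ω)} ≤ I := by
    have := mul_meas_ge_le_lintegral (μ := P) (measurable_const.min hΛ' : Measurable fun ω =>
      min 1 (Λ n ω)) 1
    simpa using this
  have h2 : P (⋃ k ∈ Finset.range n, B k ∩ J k) ≤ I := by
    refine (measure_biUnion_finset_le _ _).trans ?_
    -- `B k` belongs to the past of `ξ k`, so the two probabilities multiply. As `truncPow` equals
    -- one on `B k`, the weights `m k` then add up to part of the stopped `Λ`.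
    have hBJ : ∀ k, P (B k ∩ J k) ≤ ∫⁻ ω, (B k).indicator (fun _ => m k) ω ∂P := by
      intro k
      have hJ : MeasurableSet[MeasurableSpace.comap (ξ k) inferInstance] (J k) :=
        ⟨{x | x ≠ -(m k).toReal}, (measurableSet_singleton _).compl, rfl⟩
      rw [(Indep_iff _ _ _).1 (hξ.indep k) _ _ (hB k) hJ, lintegral_indicator_const (𝒢.le k _ (hB k)),
        mul_comm]
      gcongr
      exact hξ.jump k
    refine (Finset.sum_le_sum fun k _ => hBJ k).trans ?_
    rw [← lintegral_finsetSum _ fun k _ => measurable_const.indicator (𝒢.le k _ (hB k))]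
    refine lintegral_mono fun ω => le_trans (Finset.sum_le_sum fun k _ => ?_) (hstopped ω)
    by_cases hk : ω ∈ B k
    · rw [indicator_of_mem hk, if_pos (show Λ (k + 1) ω ≤ 1 from hk.2), truncPow_of_lt hs.le hL hk.1, mul_one]
    · rw [indicator_of_notMem hk]; exact zero_le
  have h3 : P {ω | L < transformMax ξ a n ω} ≤ C * I := by
    refine (h.meas_lt_transformMax_le hs hξ ha n hL hL').trans ?_
    have hLs : L ^ s ≠ 0 := by simp [hL, hL']
    have hLs' : L ^ s ≠ ∞ := ENNReal.rpow_ne_top_of_nonneg hs.le hL'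
    rw [ENNReal.div_le_iff hLs hLs', mul_assoc]
    gcongr
    rw [hI, ← lintegral_mul_const _ (measurable_const.min hΛ')]
    refine lintegral_mono fun ω => ?_
    refine le_trans ?_ (mul_le_mul_left (hstopped ω) _)
    rw [Finset.sum_mul]
    refine Finset.sum_le_sum fun k _ => ?_
    by_cases hk : ω ∈ A k
    · simp only [a]
      rw [indicator_of_mem hk, if_pos (show Λ (k + 1) ω ≤ 1 from hk.2), rpow_eq_mul_truncPow hs.le hL hL' hk.1]
      exact le_of_eq (by ring)
    · simp only [a]
      rw [indicator_of_notMem hk]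
      simp [hs]
  calc _ ≤ (I + I) + (C * I + P {ω | L < ∑ k ∈ Finset.range n, m k * abovePart L ‖v k ω‖ₑ}) := by
        refine add_le_add ((measure_union_le _ _).trans (add_le_add h1 h2))
          ((measure_union_le _ _).trans (add_le_add_left h3 _))
    _ = _ := by ring

/-- The integrated level functional of a function in terms of its truncated powers `Φ (truncPow ..)`
and of its parts above a level. -/
def levelFunctional (p s : ℝ) (Φ : (ℝ≥0∞ → ℝ≥0∞) → ℝ≥0∞) : ℝ≥0∞ :=
  ∫⁻ t in Ioi (0 : ℝ), (min 1 (Φ (truncPow s (ENNReal.ofReal t))) +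
    (if ENNReal.ofReal t < Φ (abovePart (ENNReal.ofReal t)) then 1 else 0)) *
      ENNReal.ofReal (t ^ (p - 1))

/-- The layer cake formula at scale 2, followed by Tonelli. The expectation ends up outermost, so
that the integral over levels can be estimated path by path. -/
lemma lintegral_rpow_le_of_tail_le [SFinite P] {F : Ω → ℝ≥0∞} (hF : Measurable F)
    (hF' : ∀ ω, F ω < ∞) {p : ℝ} (hp : 0 < p) {K : ℝ≥0∞} {g : Ω → ℝ → ℝ≥0∞}
    (hg : Measurable (Function.uncurry g))
    (h : ∀ t : ℝ, 0 < t → P {ω | 2 * ENNReal.ofReal t < F ω} ≤ K * ∫⁻ ω, g ω t ∂P) :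
    ∫⁻ ω, F ω ^ p ∂P ≤ 2 ^ p * (ENNReal.ofReal p * (K *
      ∫⁻ ω, (∫⁻ t in Ioi (0 : ℝ), g ω t * ENNReal.ofReal (t ^ (p - 1))) ∂P)) := by
  rw [lintegral_rpow_eq_layercake hF hF' hp (a := 2) (by norm_num)]
  have h2 : ENNReal.ofReal 2 = 2 := by norm_num
  have hgw : Measurable (Function.uncurry fun ω t => g ω t * ENNReal.ofReal (t ^ (p - 1))) :=
    hg.mul ((by fun_prop : Measurable fun t : ℝ => ENNReal.ofReal (t ^ (p - 1))).comp measurable_snd)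
  have hgw' : Measurable fun t => ∫⁻ ω, g ω t * ENNReal.ofReal (t ^ (p - 1)) ∂P :=
    hgw.lintegral_prod_left'
  rw [h2, lintegral_lintegral_swap hgw.aemeasurable, ← lintegral_const_mul _ hgw']
  refine mul_le_mul_right (mul_le_mul_right (setLIntegral_mono' measurableSet_Ioi fun t ht => ?_) _) _
  have hgt : Measurable fun ω => g ω t := hg.comp (measurable_id.prodMk measurable_const)
  rw [lintegral_mul_const _ hgt, ← mul_assoc, ENNReal.ofReal_mul (by norm_num), h2]
  exact mul_le_mul_left (h t ht) _

lemma lintegral_min_add_le (hv : IsBoundedPredictable P 𝒢 v) {s : ℝ} {K : ℝ≥0∞} (n : ℕ)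
    (L : ℝ≥0∞) :
    (K + 2) * ∫⁻ ω, min 1 (∑ k ∈ Finset.range n, m k * truncPow s L ‖v k ω‖ₑ) ∂P +
      P {ω | L < ∑ k ∈ Finset.range n, m k * abovePart L ‖v k ω‖ₑ} ≤
    (K + 2) * ∫⁻ ω, (min 1 (∑ k ∈ Finset.range n, m k * truncPow s L ‖v k ω‖ₑ) +
      (if L < ∑ k ∈ Finset.range n, m k * abovePart L ‖v k ω‖ₑ then 1 else 0)) ∂P := by
  have hmv : ∀ k, Measurable fun ω => (L, ‖v k ω‖ₑ) := fun k =>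
    measurable_const.prodMk (hv.measurable_enorm' k)
  have hm1 : Measurable fun ω => ∑ k ∈ Finset.range n, m k * truncPow s L ‖v k ω‖ₑ :=
    Finset.measurable_sum _ fun k _ => ((measurable_truncPow s).comp (hmv k)).const_mul _
  have hm2 : Measurable fun ω => ∑ k ∈ Finset.range n, m k * abovePart L ‖v k ω‖ₑ :=
    Finset.measurable_sum _ fun k _ => (measurable_abovePart.comp (hmv k)).const_mul _
  have hset : MeasurableSet {ω | L < ∑ k ∈ Finset.range n, m k * abovePart L ‖v k ω‖ₑ} :=
    measurableSet_lt measurable_const hm2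
  have hind : ∫⁻ ω, (if L < ∑ k ∈ Finset.range n, m k * abovePart L ‖v k ω‖ₑ then 1 else 0) ∂P =
      P {ω | L < ∑ k ∈ Finset.range n, m k * abovePart L ‖v k ω‖ₑ} := by
    rw [← lintegral_indicator_one hset]
    refine lintegral_congr fun ω => ?_
    simp only [indicator, mem_ofPred_eq, Pi.one_apply]
  rw [lintegral_add_left (measurable_const.min hm1), hind, mul_add]
  refine add_le_add le_rfl ?_
  calc _ = 1 * P {ω | L < ∑ k ∈ Finset.range n, m k * abovePart L ‖v k ω‖ₑ} := (one_mul _).symm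
    _ ≤ _ := by
      refine mul_le_mul_left ?_ _
      calc (1 : ℝ≥0∞) ≤ 2 := by norm_num
        _ ≤ _ := le_add_self

lemma TransformBound.lintegral_transformMax_rpow_le_levelFunctional [IsProbabilityMeasure P]
    {s : ℝ} {C : ℝ≥0} (h : TransformBound V P 𝒢 ξ m s C)
    (hs : 0 < s) (hξ : IsNoise P 𝒢 ξ m c) (hv : IsBoundedPredictable P 𝒢 v) (n : ℕ)
    {p : ℝ} (hp : 0 < p) :
    ∫⁻ ω, transformMax ξ v n ω ^ p ∂P ≤ 2 ^ p * (ENNReal.ofReal p * ((C + 2) *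
      ∫⁻ ω, levelFunctional p s (fun f => ∑ k ∈ Finset.range n, m k * f ‖v k ω‖ₑ) ∂P)) := by
  unfold levelFunctional
  have hmv : ∀ k, Measurable fun q : Ω × ℝ => (ENNReal.ofReal q.2, ‖v k q.1‖ₑ) := fun k =>
    (by fun_prop : Measurable fun q : Ω × ℝ => ENNReal.ofReal q.2).prodMk
      ((hv.measurable_enorm' k).comp measurable_fst)
  have hm1 : Measurable fun q : Ω × ℝ =>
      ∑ k ∈ Finset.range n, m k * truncPow s (ENNReal.ofReal q.2) ‖v k q.1‖ₑ :=
    Finset.measurable_sum _ fun k _ => ((measurable_truncPow s).comp (hmv k)).const_mul _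
  have hm2 : Measurable fun q : Ω × ℝ =>
      ∑ k ∈ Finset.range n, m k * abovePart (ENNReal.ofReal q.2) ‖v k q.1‖ₑ :=
    Finset.measurable_sum _ fun k _ => (measurable_abovePart.comp (hmv k)).const_mul _
  have hm3 : Measurable fun q : Ω × ℝ => (if ENNReal.ofReal q.2 <
      ∑ k ∈ Finset.range n, m k * abovePart (ENNReal.ofReal q.2) ‖v k q.1‖ₑ then 1 else 0 : ℝ≥0∞) :=
    Measurable.ite (measurableSet_lt (by fun_prop) hm2) measurable_const measurable_const
  have hm4 : Measurable (Function.uncurry fun (ω : Ω) (t : ℝ) => min 1 (∑ k ∈ Finset.range n,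
      m k * truncPow s (ENNReal.ofReal t) ‖v k ω‖ₑ) + (if ENNReal.ofReal t <
      ∑ k ∈ Finset.range n, m k * abovePart (ENNReal.ofReal t) ‖v k ω‖ₑ then 1 else 0)) :=
    (measurable_const.min hm1).add hm3
  refine lintegral_rpow_le_of_tail_le (P := P) (K := C + 2) (measurable_transformMax' hξ hv n)
    (transformMax_lt_top n) hp hm4 fun t ht => ?_
  have ht0 : ENNReal.ofReal t ≠ 0 := by simpa using ht
  refine (h.meas_two_mul_lt_transformMax_le hs hξ hv n ht0 (by simp)).trans ?_
  generalize ENNReal.ofReal t = L at ht0 ⊢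
  exact lintegral_min_add_le hv n L

end Truncation

/-! ### Pathwise estimates of the level functional by arbitrary decompositions. -/

section LevelFunctional

lemma setLIntegral_Ioc_rpow {p r : ℝ} (hp : 0 < p) (hr : 0 ≤ r) :
    ∫⁻ t in Ioc 0 r, ENNReal.ofReal (t ^ (p - 1)) = ENNReal.ofReal (r ^ p / p) := by
  have h1 : IntervalIntegrable (fun t : ℝ => t ^ (p - 1)) volume 0 r :=
    intervalIntegral.intervalIntegrable_rpow' (by linarith)
  rw [intervalIntegrable_iff_integrableOn_Ioc_of_le hr] at h1
  rw [← ofReal_integral_eq_lintegral_ofReal h1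
    ((ae_restrict_mem measurableSet_Ioc).mono fun t ht => Real.rpow_nonneg ht.1.le _),
    ← intervalIntegral.integral_of_le hr, integral_rpow (Or.inl (by linarith))]
  simp [hp.ne']

lemma setLIntegral_Ioi_rpow {q r : ℝ} (hq : 0 < q) (hr : 0 < r) :
    ∫⁻ t in Ioi r, ENNReal.ofReal (t ^ (-1 - q)) = ENNReal.ofReal (r ^ (-q) / q) := by
  have h1 := integrableOn_Ioi_rpow_of_lt (a := -1 - q) (by linarith) hr
  rw [← ofReal_integral_eq_lintegral_ofReal h1
    ((ae_restrict_mem measurableSet_Ioi).mono fun t ht => Real.rpow_nonneg (hr.trans ht).le _),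
    integral_Ioi_rpow_of_lt (by linarith) hr]
  congr 1
  rw [show -1 - q + 1 = -q by ring, neg_div_neg_eq]

/-- The constant in `lintegral_truncPow_le`. -/
def truncPowConst (p s : ℝ) : ℝ≥0 := (1 / p + 1 / (s - p)).toNNReal

/-- For `t ≤ x` the truncation is at most one and contributes at most `x ^ p / p`. For `t > x` the
integrand is at most `x ^ s * t ^ (p - 1 - s)`, integrable at infinity because `p < s`, which
contributes at most `x ^ p / (s - p)`. -/
lemma lintegral_truncPow_le {p s : ℝ} (hp : 0 < p) (hps : p < s) (x : ℝ≥0∞) :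
    ∫⁻ t in Ioi (0 : ℝ), truncPow s (ENNReal.ofReal t) x * ENNReal.ofReal (t ^ (p - 1)) ≤
      truncPowConst p s * x ^ p := by
  have hs : 0 < s := hp.trans hps
  have hsp : 0 < s - p := sub_pos.2 hps
  have hc : 0 < 1 / p + 1 / (s - p) := by positivity
  rcases eq_or_ne x ∞ with rfl | hx
  · rw [ENNReal.top_rpow_of_pos hp, ENNReal.mul_top]
    · exact le_top
    · simpa [truncPowConst] using hc
  obtain ⟨r, hr0, rfl⟩ : ∃ r : ℝ, 0 ≤ r ∧ x = ENNReal.ofReal r :=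
    ⟨x.toReal, ENNReal.toReal_nonneg, (ENNReal.ofReal_toReal hx).symm⟩
  rcases hr0.eq_or_lt with rfl | hr
  · refine le_of_eq_of_le ?_ zero_le
    simp [truncPow, hs]
  rw [← Ioc_union_Ioi_eq_Ioi hr.le, lintegral_union measurableSet_Ioi
    (Set.disjoint_left.2 fun t ht ht' => not_lt.2 ht.2 ht')]
  have h1 : ∫⁻ t in Ioc 0 r, truncPow s (ENNReal.ofReal t) (ENNReal.ofReal r) *
      ENNReal.ofReal (t ^ (p - 1)) ≤ ENNReal.ofReal (r ^ p / p) := by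
    rw [← setLIntegral_Ioc_rpow hp hr.le]
    refine lintegral_mono fun t => ?_
    calc _ ≤ 1 * ENNReal.ofReal (t ^ (p - 1)) := by gcongr; exact min_le_left _ _
      _ = _ := one_mul _
  have h2 : ∫⁻ t in Ioi r, truncPow s (ENNReal.ofReal t) (ENNReal.ofReal r) *
      ENNReal.ofReal (t ^ (p - 1)) ≤ ENNReal.ofReal (r ^ p / (s - p)) := by
    have : ∫⁻ t in Ioi r, truncPow s (ENNReal.ofReal t) (ENNReal.ofReal r) *
      ENNReal.ofReal (t ^ (p - 1)) ≤ ∫⁻ t in Ioi r, ENNReal.ofReal (r ^ s) *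
        ENNReal.ofReal (t ^ (-1 - (s - p))) := by
      refine setLIntegral_mono' measurableSet_Ioi fun t ht => ?_
      have ht0 : 0 < t := hr.trans ht
      calc _ ≤ (ENNReal.ofReal r / ENNReal.ofReal t) ^ s * ENNReal.ofReal (t ^ (p - 1)) := by
            gcongr; exact min_le_right _ _
        _ = _ := by
            rw [← ENNReal.ofReal_div_of_pos ht0, ENNReal.ofReal_rpow_of_nonneg (by positivity) hs.le,
              ← ENNReal.ofReal_mul (by positivity), ← ENNReal.ofReal_mul (by positivity)]
            congr 1
            rw [Real.div_rpow hr.le ht0.le, div_mul_eq_mul_div, mul_div_assoc, ← Real.rpow_sub ht0]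
            congr 2
            ring
    refine this.trans_eq ?_
    rw [lintegral_const_mul _ (by fun_prop), setLIntegral_Ioi_rpow hsp hr,
      ← ENNReal.ofReal_mul (by positivity)]
    congr 1
    rw [← mul_div_assoc, ← Real.rpow_add hr]
    congr 2
    ring
  refine (add_le_add h1 h2).trans_eq ?_
  rw [← ENNReal.ofReal_add (by positivity) (by positivity), truncPowConst,
    ENNReal.ofReal_rpow_of_nonneg hr.le hp.le]
  change _ = ENNReal.ofReal (1 / p + 1 / (s - p)) * _
  rw [← ENNReal.ofReal_mul hc.le]
  congr 1
  ring

lemma truncPow_mono {s : ℝ} (hs : 0 ≤ s) (L : ℝ≥0∞) : Monotone (truncPow s L) := by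
  intro x x' h
  unfold truncPow
  gcongr

/-- The larger of the two summands is at least half of the sum. -/
lemma truncPow_add_le {s : ℝ} (hs : 0 ≤ s) (L x x' : ℝ≥0∞) :
    truncPow s L (x + x') ≤ truncPow s L (2 * x) + truncPow s L (2 * x') := by
  rcases le_total x x' with h | h
  · refine (truncPow_mono hs L ?_).trans le_add_self
    rw [two_mul]; gcongr
  · refine (truncPow_mono hs L ?_).trans le_self_add
    rw [two_mul]; gcongr

/-- Where `x > L` the ratio `x' / L` is at least one and is only increased by the power `q ≥ 1`. It
is used with `q = s` and with `q = p`, and this is where `p ≥ 1` enters. -/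
lemma abovePart_le_mul_rpow {q : ℝ} (hq : 1 ≤ q) {L x x' : ℝ≥0∞} (hL : L ≠ 0) (hL' : L ≠ ∞)
    (h : x ≤ x') : abovePart L x ≤ L * (x' / L) ^ q := by
  unfold abovePart
  split_ifs with hx
  · have h1 : 1 ≤ x' / L := by
      rw [ENNReal.le_div_iff_mul_le (Or.inl hL) (Or.inl hL'), one_mul]
      exact hx.le.trans h
    calc x ≤ x' := h
      _ = L * (x' / L) ^ (1 : ℝ) := by rw [ENNReal.rpow_one, ENNReal.mul_div_cancel hL hL']
      _ ≤ _ := by gcongr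
  · exact zero_le

variable {E : Type*} [MeasurableSpace E] {μ : Measure E}

lemma lintegral_div_rpow {a : E → ℝ≥0∞} (ha : Measurable a) {L : ℝ≥0∞} {q : ℝ} (hq : 0 ≤ q) :
    ∫⁻ z, (a z / L) ^ q ∂μ = (∫⁻ z, a z ^ q ∂μ) / L ^ q := by
  simp_rw [ENNReal.div_rpow_of_nonneg _ _ hq, div_eq_mul_inv]
  rw [lintegral_mul_const _ (ha.pow_const q)]

/-- The level functional is bounded by the norm of any decomposition. -/
lemma levelFunctional_le [SFinite μ] {p s : ℝ} (hp : 1 ≤ p) (hps : p < s) {g a b : E → ℝ≥0∞}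
    (ha : Measurable a) (hb : Measurable b) (h : ∀ᵐ z ∂μ, g z ≤ a z + b z) :
    levelFunctional p s (fun f => ∫⁻ z, f (g z) ∂μ) ≤
      truncPowConst p s * 2 ^ p * (3 + 2 ^ (p / s)) *
        ((∫⁻ z, a z ^ s ∂μ) ^ (p / s) + ∫⁻ z, b z ^ p ∂μ) := by
  have hp0 : 0 < p := by linarith
  have hs : 0 < s := by linarith
  set A := ∫⁻ z, (2 * a z) ^ s ∂μ with hA
  set B := ∫⁻ z, (2 * b z) ^ p ∂μ with hB
  have ha2 : Measurable fun z => 2 * a z := ha.const_mul 2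
  have hb2 : Measurable fun z => 2 * b z := hb.const_mul 2
  let T : ℝ → ℝ≥0∞ → ℝ≥0∞ := fun t => truncPow s (ENNReal.ofReal t)
  have hTm : Measurable fun q : ℝ × ℝ≥0∞ => T q.1 q.2 :=
    (measurable_truncPow s).comp
      ((by fun_prop : Measurable fun q : ℝ × ℝ≥0∞ => ENNReal.ofReal q.1).prodMk measurable_snd)
  have hTx : ∀ x, Measurable fun t => T t x := fun x =>
    hTm.comp (measurable_id.prodMk measurable_const)
  have hTt : ∀ t, Measurable (T t) := fun t =>
    hTm.comp (measurable_const.prodMk measurable_id)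
  have hTb : Measurable fun q : ℝ × E => T q.1 (2 * b q.2) :=
    hTm.comp (measurable_fst.prodMk (hb2.comp measurable_snd))
  let w : ℝ → ℝ≥0∞ := fun t => ENNReal.ofReal (t ^ (p - 1))
  have hw : Measurable w := by fun_prop
  -- The first two pieces bound the truncated integral through `a` and `b`; the last two cover the
  -- two ways in which the large part can exceed `t`. All are written with `T t`, so that
  -- `lintegral_truncPow_le` integrates each of them.
  have hpt : ∀ t ∈ Ioi (0 : ℝ), (min 1 (∫⁻ z, truncPow s (ENNReal.ofReal t) (g z) ∂μ) +
      (if ENNReal.ofReal t < ∫⁻ z, abovePart (ENNReal.ofReal t) (g z) ∂μ then 1 else 0)) * w t ≤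
      (T t (A ^ (1 / s)) * w t + ∫⁻ z, T t (2 * b z) * w t ∂μ) +
        (T t ((2 * A) ^ (1 / s)) * w t + T t ((2 * B) ^ (1 / p)) * w t) := by
    intro t ht
    have ht0 : ENNReal.ofReal t ≠ 0 := by simpa using ht
    have ht1 : ENNReal.ofReal t ≠ ∞ := by simp
    set L := ENNReal.ofReal t with hLdef
    have hTb2 : Measurable fun z => T t (2 * b z) := (hTt t).comp hb2
    rw [lintegral_mul_const _ hTb2, ← add_mul, ← add_mul, ← add_mul]
    gcongr
    · have e1 : ∫⁻ z, truncPow s L (g z) ∂μ ≤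
          (∫⁻ z, truncPow s L (2 * a z) ∂μ) + ∫⁻ z, T t (2 * b z) ∂μ := by
        rw [← lintegral_add_right _ hTb2]
        refine lintegral_mono_ae (h.mono fun z hz => ?_)
        exact (truncPow_mono hs.le L hz).trans (truncPow_add_le hs.le L _ _)
      have e2 : ∫⁻ z, truncPow s L (2 * a z) ∂μ ≤ (A ^ (1 / s) / L) ^ s := by
        rw [ENNReal.div_rpow_of_nonneg _ _ hs.le, ← ENNReal.rpow_mul, one_div_mul_cancel hs.ne',
          ENNReal.rpow_one, hA, ← lintegral_div_rpow ha2 hs.le]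
        exact lintegral_mono fun z => min_le_right _ _
      calc min 1 (∫⁻ z, truncPow s L (g z) ∂μ)
          ≤ min 1 ((A ^ (1 / s) / L) ^ s + ∫⁻ z, T t (2 * b z) ∂μ) := by
            gcongr; exact e1.trans (by gcongr)
        _ ≤ min 1 ((A ^ (1 / s) / L) ^ s) + ∫⁻ z, T t (2 * b z) ∂μ := by
            rcases le_total 1 ((A ^ (1 / s) / L) ^ s) with h1 | h1
            · rw [min_eq_left h1]; exact (min_le_left _ _).trans le_self_add
            · rw [min_eq_right h1]; exact min_le_right _ _
    · split_ifs with hD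
      · have e1 : ∫⁻ z, abovePart L (g z) ∂μ ≤ L * (A / L ^ s + B / L ^ p) := by
          rw [hA, hB, ← lintegral_div_rpow ha2 hs.le, ← lintegral_div_rpow hb2 hp0.le,
            ← lintegral_add_left ((ha2.div_const L).pow_const s), ← lintegral_const_mul' _ _ ht1]
          refine lintegral_mono_ae (h.mono fun z hz => ?_)
          rcases le_total (a z) (b z) with hab | hab
          · refine (abovePart_le_mul_rpow hp ht0 ht1 (x' := 2 * b z) ?_).trans ?_
            · rw [two_mul]; exact hz.trans (by gcongr)
            · gcongr; exact le_add_self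
          · refine (abovePart_le_mul_rpow (by linarith) ht0 ht1 (q := s) (x' := 2 * a z) ?_).trans ?_
            · rw [two_mul]; exact hz.trans (by gcongr)
            · gcongr; exact le_self_add
        -- One of the two summands then exceeds one half, which puts `t` below `(2 * A) ^ (1 / s)`
        -- or `(2 * B) ^ (1 / p)`, where the corresponding truncation equals one.
        have e2 : 1 < A / L ^ s + B / L ^ p := by
          have := hD.trans_le e1
          by_contra hc
          exact absurd this (not_lt.2 (by
            calc _ ≤ L * 1 := by gcongr; exact not_lt.1 hc
              _ = L := mul_one _))
        have hk : ∀ {q : ℝ} {x : ℝ≥0∞}, 0 < q → 2⁻¹ < x / L ^ q → T t ((2 * x) ^ (1 / q)) = 1 := by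
          intro q x hq hx
          refine truncPow_of_lt hs.le ht0 ?_
          have hLq : L ^ q ≠ 0 := by simp [ht0, ht1]
          have hLq' : L ^ q ≠ ∞ := ENNReal.rpow_ne_top_of_nonneg hq.le ht1
          have h3 : L ^ q < 2 * x := by
            rw [ENNReal.lt_div_iff_mul_lt (Or.inl hLq) (Or.inl hLq')] at hx
            have := ENNReal.mul_lt_mul_right (a := 2) (by simp) (by simp) hx
            rwa [← mul_assoc, ENNReal.mul_inv_cancel (by simp) (by simp), one_mul] at this
          have h4 := ENNReal.rpow_lt_rpow h3 (one_div_pos.2 hq)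
          rwa [← ENNReal.rpow_mul, mul_one_div_cancel hq.ne', ENNReal.rpow_one] at h4
        by_cases h5 : 2⁻¹ < A / L ^ s
        · rw [hk hs h5]; exact le_self_add
        · by_cases h6 : 2⁻¹ < B / L ^ p
          · rw [hk hp0 h6]; exact le_add_self
          · refine absurd e2 (not_lt.2 ?_)
            calc A / L ^ s + B / L ^ p ≤ 2⁻¹ + 2⁻¹ := add_le_add (not_lt.1 h5) (not_lt.1 h6)
              _ = 1 := ENNReal.inv_two_add_inv_two
      · exact zero_le
  have hswap : ∫⁻ t in Ioi (0 : ℝ), ∫⁻ z, T t (2 * b z) * w t ∂μ ≤ truncPowConst p s * B := by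
    have hm : Measurable (Function.uncurry fun (t : ℝ) (z : E) => T t (2 * b z) * w t) :=
      hTb.mul (hw.comp measurable_fst)
    rw [lintegral_lintegral_swap hm.aemeasurable, hB, ← lintegral_const_mul _ (hb2.pow_const p)]
    exact lintegral_mono fun z => lintegral_truncPow_le hp0 hps _
  have hint : levelFunctional p s (fun f => ∫⁻ z, f (g z) ∂μ) ≤
      (truncPowConst p s * (A ^ (1 / s)) ^ p + truncPowConst p s * B) +
        (truncPowConst p s * ((2 * A) ^ (1 / s)) ^ p + truncPowConst p s * ((2 * B) ^ (1 / p)) ^ p) := by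
    refine (setLIntegral_mono' measurableSet_Ioi hpt).trans ?_
    have hm2 : Measurable fun t => T t (A ^ (1 / s)) * w t := (hTx _).mul hw
    have hm3 : Measurable fun t => T t ((2 * A) ^ (1 / s)) * w t := (hTx _).mul hw
    have hm4 : Measurable fun t => T t ((2 * B) ^ (1 / p)) * w t := (hTx _).mul hw
    have hm5 : Measurable fun t => T t ((2 * A) ^ (1 / s)) * w t + T t ((2 * B) ^ (1 / p)) * w t :=
      hm3.add hm4
    rw [lintegral_add_right _ hm5, lintegral_add_left hm2, lintegral_add_left hm3]
    gcongr
    · exact lintegral_truncPow_le hp0 hps _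
    · exact lintegral_truncPow_le hp0 hps _
    · exact lintegral_truncPow_le hp0 hps _
  refine hint.trans ?_
  have hA' : A = 2 ^ s * ∫⁻ z, a z ^ s ∂μ := by
    rw [hA, ← lintegral_const_mul _ (ha.pow_const s)]
    simp_rw [ENNReal.mul_rpow_of_nonneg _ _ hs.le]
  have hB' : B = 2 ^ p * ∫⁻ z, b z ^ p ∂μ := by
    rw [hB, ← lintegral_const_mul _ (hb.pow_const p)]
    simp_rw [ENNReal.mul_rpow_of_nonneg _ _ hp0.le]
  have e1 : (A ^ (1 / s)) ^ p = 2 ^ p * (∫⁻ z, a z ^ s ∂μ) ^ (p / s) := by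
    rw [← ENNReal.rpow_mul, hA', ENNReal.mul_rpow_of_nonneg _ _ (by positivity), ← ENNReal.rpow_mul]
    congr 2 <;> field_simp
  have e2 : ((2 * A) ^ (1 / s)) ^ p = 2 ^ (p / s) * (2 ^ p * (∫⁻ z, a z ^ s ∂μ) ^ (p / s)) := by
    rw [← e1, ← ENNReal.rpow_mul, ← ENNReal.rpow_mul,
      ENNReal.mul_rpow_of_nonneg _ _ (by positivity : 0 ≤ 1 / s * p)]
    congr 2; ring
  have e3 : ((2 * B) ^ (1 / p)) ^ p = 2 * B := by
    rw [← ENNReal.rpow_mul, one_div_mul_cancel hp0.ne', ENNReal.rpow_one]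
  rw [e1, e2, e3, hB']
  set Q := (∫⁻ z, a z ^ s ∂μ) ^ (p / s)
  set R := ∫⁻ z, b z ^ p ∂μ
  set c : ℝ≥0∞ := (truncPowConst p s : ℝ≥0∞)
  calc _ = c * 2 ^ p * ((1 + 2 ^ (p / s)) * Q + 3 * R) := by ring
    _ ≤ c * 2 ^ p * ((3 + 2 ^ (p / s)) * Q + (3 + 2 ^ (p / s)) * R) := by
      gcongr
      · norm_num
      · exact le_self_add
    _ = _ := by ring

end LevelFunctional

/-! ### Simple processes as transforms -/

instance : SigmaFinite lebesgueHalfLine := by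
  refine ⟨⟨⟨fun n => Iic n, fun _ => mem_univ _, fun n => ?_, ?_⟩⟩⟩
  · have h : MeasurableEmbedding ((↑) : ℝ≥0 → ℝ) :=
      MeasurableEmbedding.subtype_coe measurableSet_Ici
    rw [lebesgueHalfLine, h.comap_apply]
    refine lt_of_le_of_lt (measure_mono (t := Icc (0 : ℝ) n) ?_) (by simp)
    rintro _ ⟨y, hy, rfl⟩
    exact ⟨y.2, by exact_mod_cast hy⟩
  · rw [eq_univ_iff_forall]
    intro x
    obtain ⟨n, hn⟩ := exists_nat_ge x
    exact mem_iUnion.2 ⟨n, hn⟩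

lemma lebesgueHalfLine_Ioc (a b : ℝ≥0) : lebesgueHalfLine (Ioc a b) = ENNReal.ofReal (b - a) := by
  have h : MeasurableEmbedding ((↑) : ℝ≥0 → ℝ) :=
    MeasurableEmbedding.subtype_coe measurableSet_Ici
  rw [lebesgueHalfLine, h.comap_apply, ← Real.volume_Ioc]
  congr 1
  ext x
  constructor
  · rintro ⟨y, hy, rfl⟩
    exact ⟨NNReal.coe_lt_coe.2 hy.1, NNReal.coe_le_coe.2 hy.2⟩
  · intro hx
    exact ⟨⟨x, a.2.trans hx.1.le⟩, ⟨NNReal.coe_lt_coe.1 hx.1, NNReal.coe_le_coe.1 hx.2⟩, rfl⟩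

lemma lebesgueHalfLine_Ioc_lt_top (a b : ℝ≥0) : lebesgueHalfLine (Ioc a b) < ∞ := by
  rw [lebesgueHalfLine_Ioc]; exact ENNReal.ofReal_lt_top

section Cells

variable {Ω J : Type*} [MeasurableSpace Ω] [MeasurableSpace J]
variable {𝕜 V : Type*} [RCLike 𝕜] [NormedAddCommGroup V] [NormedSpace 𝕜 V]
  {P : Measure Ω} {ν : Measure J} {N : Kernel Ω (ℝ≥0 × J)}

namespace SimpleAdaptedProcess

/-- The value on the `(i, j)`-th cell. -/
def coefAt (φ : SimpleAdaptedProcess 𝕜 V P ν N) (i : Fin φ.l) (j : Fin φ.m) (ω : Ω) : V :=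
  ∑ k, φ.F i j k ω • φ.x i j k

/-- The cells `(t_i, t_{i+1}] × A_j`. -/
def cellAt (φ : SimpleAdaptedProcess 𝕜 V P ν N) (i : Fin φ.l) (j : Fin φ.m) : Set (ℝ≥0 × J) :=
  Ioc (φ.time i.castSucc) (φ.time i.succ) ×ˢ φ.A j

/-- The cells `(t_i, t_{i+1}] × (A_j ∩ B)` in lexicographic order. -/
def cell (φ : SimpleAdaptedProcess 𝕜 V P ν N) (B : Set J) (k : ℕ) : Set (ℝ≥0 × J) :=
  if h : k < φ.l * φ.m then
    φ.cellAt (finProdFinEquiv.symm ⟨k, h⟩).1 (finProdFinEquiv.symm ⟨k, h⟩).2 ∩ univ ×ˢ B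
  else ∅

/-- The values on the cells in lexicographic order. -/
def coef (φ : SimpleAdaptedProcess 𝕜 V P ν N) (k : ℕ) : Ω → V :=
  if h : k < φ.l * φ.m then
    φ.coefAt (finProdFinEquiv.symm ⟨k, h⟩).1 (finProdFinEquiv.symm ⟨k, h⟩).2
  else 0

variable (φ : SimpleAdaptedProcess 𝕜 V P ν N) {B : Set J}

lemma value_eq (ω : Ω) (z : ℝ≥0 × J) :
    φ.value ω z = ∑ i, ∑ j, (φ.cellAt i j).indicator (fun _ => φ.coefAt i j ω) z := by
  unfold value coefAt cellAt
  refine Finset.sum_congr rfl fun i _ => Finset.sum_congr rfl fun j _ => ?_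
  by_cases hz : z ∈ Ioc (φ.time i.castSucc) (φ.time i.succ) ×ˢ φ.A j
  · simp only [indicator_of_mem hz]
  · simp only [indicator_of_notMem hz, Finset.sum_const_zero]

lemma measurableSet_cellAt (i : Fin φ.l) (j : Fin φ.m) : MeasurableSet (φ.cellAt i j) :=
  measurableSet_Ioc.prod (φ.measurableSet_A j)

lemma disjoint_cellAt {q q' : Fin φ.l × Fin φ.m} (h : q ≠ q') :
    Disjoint (φ.cellAt q.1 q.2) (φ.cellAt q'.1 q'.2) := by
  rw [Set.disjoint_left]
  rintro z ⟨hz1, hz2⟩ ⟨hz1', hz2'⟩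
  refine h (Prod.ext ?_ ?_)
  · by_contra hne
    rcases lt_or_gt_of_ne hne with hlt | hlt
    · have : φ.time q.1.succ ≤ φ.time q'.1.castSucc :=
        φ.time_strictMono.monotone (Fin.succ_le_castSucc_iff.2 hlt)
      exact absurd (hz1.2.trans this) (not_le.2 hz1'.1)
    · have : φ.time q'.1.succ ≤ φ.time q.1.castSucc :=
        φ.time_strictMono.monotone (Fin.succ_le_castSucc_iff.2 hlt)
      exact absurd (hz1'.2.trans this) (not_le.2 hz1.1)
  · by_contra hne
    exact (Set.disjoint_left.1 (φ.disjoint_A _ _ hne)) hz2 hz2'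

lemma measurableSet_cell (hB : MeasurableSet B) (k : ℕ) : MeasurableSet (φ.cell B k) := by
  unfold cell
  split_ifs with h
  · exact (φ.measurableSet_cellAt _ _).inter (MeasurableSet.univ.prod hB)
  · exact MeasurableSet.empty

lemma disjoint_cell {k k' : ℕ} (h : k ≠ k') : Disjoint (φ.cell B k) (φ.cell B k') := by
  unfold cell
  split_ifs with h1 h2
  · refine (φ.disjoint_cellAt ?_).mono inter_subset_left inter_subset_left
    intro he
    have := finProdFinEquiv.symm.injective he
    exact h (by simpa using this)
  all_goals simp

lemma sum_range_eq {M : Type*} [AddCommMonoid M] (f : ℕ → M) (l m : ℕ) :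
    ∑ k ∈ Finset.range (l * m), f k = ∑ i : Fin l, ∑ j : Fin m, f (finProdFinEquiv (i, j)) := by
  rw [Finset.sum_range, ← finProdFinEquiv.sum_comp, Fintype.sum_prod_type]

lemma cell_finProdFinEquiv (i : Fin φ.l) (j : Fin φ.m) :
    φ.cell B (finProdFinEquiv (i, j)) = φ.cellAt i j ∩ univ ×ˢ B := by
  unfold cell
  rw [dif_pos (finProdFinEquiv (i, j)).2, Fin.eta, Equiv.symm_apply_apply]

lemma coef_finProdFinEquiv (i : Fin φ.l) (j : Fin φ.m) :
    φ.coef (finProdFinEquiv (i, j)) = φ.coefAt i j := by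
  unfold coef
  rw [dif_pos (finProdFinEquiv (i, j)).2, Fin.eta, Equiv.symm_apply_apply]

lemma restrictMarks_value_eq (ω : Ω) (z : ℝ≥0 × J) :
    restrictMarks φ.value B ω z =
      ∑ k ∈ Finset.range (φ.l * φ.m), (φ.cell B k).indicator (fun _ => φ.coef k ω) z := by
  rw [sum_range_eq]
  simp_rw [cell_finProdFinEquiv, coef_finProdFinEquiv]
  unfold restrictMarks
  by_cases hz : z ∈ (univ : Set ℝ≥0) ×ˢ B
  · rw [indicator_of_mem hz, value_eq]
    refine Finset.sum_congr rfl fun i _ => Finset.sum_congr rfl fun j _ => ?_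
    by_cases hz' : z ∈ φ.cellAt i j
    · rw [indicator_of_mem hz', indicator_of_mem (show z ∈ φ.cellAt i j ∩ univ ×ˢ B from ⟨hz', hz⟩)]
    · rw [indicator_of_notMem hz', indicator_of_notMem fun h => hz' h.1]
  · rw [indicator_of_notMem hz]
    symm
    refine Finset.sum_eq_zero fun i _ => Finset.sum_eq_zero fun j _ => ?_
    exact indicator_of_notMem (fun h => hz h.2) _

/-- The cells are disjoint, so at most one term of the sum is nonzero, and `f 0 = 0` takes care of
points in no cell. Powers, `truncPow` and `abovePart` are all treated at once. -/
lemma comp_restrictMarks_value_eq {f : ℝ≥0∞ → ℝ≥0∞} (hf : f 0 = 0) (ω : Ω) (z : ℝ≥0 × J) :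
    f ‖restrictMarks φ.value B ω z‖ₑ =
      ∑ k ∈ Finset.range (φ.l * φ.m), (φ.cell B k).indicator (fun _ => f ‖φ.coef k ω‖ₑ) z := by
  rw [restrictMarks_value_eq]
  by_cases hz : ∃ k ∈ Finset.range (φ.l * φ.m), z ∈ φ.cell B k
  · obtain ⟨k, hk, hzk⟩ := hz
    have hne : ∀ k' ≠ k, z ∉ φ.cell B k' := fun k' hk' hz' =>
      (Set.disjoint_left.1 (φ.disjoint_cell hk')) hz' hzk
    rw [Finset.sum_eq_single_of_mem k hk fun k' _ hk' => indicator_of_notMem (hne k' hk') _,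
      Finset.sum_eq_single_of_mem k hk fun k' _ hk' => indicator_of_notMem (hne k' hk') _,
      indicator_of_mem hzk, indicator_of_mem hzk]
  · push Not at hz
    rw [Finset.sum_eq_zero fun k hk => indicator_of_notMem (hz k hk) _,
      Finset.sum_eq_zero fun k hk => indicator_of_notMem (hz k hk) _, enorm_zero, hf]

lemma lintegral_comp_restrictMarks_value (hB : MeasurableSet B) {μ : Measure (ℝ≥0 × J)}
    {f : ℝ≥0∞ → ℝ≥0∞} (hf : f 0 = 0) (ω : Ω) :
    ∫⁻ z, f ‖restrictMarks φ.value B ω z‖ₑ ∂μ =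
      ∑ k ∈ Finset.range (φ.l * φ.m), μ (φ.cell B k) * f ‖φ.coef k ω‖ₑ := by
  simp_rw [φ.comp_restrictMarks_value_eq hf]
  rw [lintegral_finsetSum _ fun k _ => measurable_const.indicator (φ.measurableSet_cell hB k)]
  refine Finset.sum_congr rfl fun k _ => ?_
  rw [lintegral_indicator_const (φ.measurableSet_cell hB k), mul_comm]

/-- The region whose random measure is known before the `k`-th cell is examined. -/
def pastRegion (B : Set J) (k : ℕ) : Set (ℝ≥0 × J) := (⋃ (i : ℕ) (_ : k ≤ i), φ.cell B i)ᶜ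

lemma measurableSet_pastRegion (hB : MeasurableSet B) (k : ℕ) :
    MeasurableSet (φ.pastRegion B k) :=
  (MeasurableSet.iUnion fun i => MeasurableSet.iUnion fun _ => φ.measurableSet_cell hB i).compl

lemma pastRegion_mono : Monotone (φ.pastRegion B) := by
  intro k k' h
  refine compl_subset_compl.2 ?_
  exact iUnion_mono fun i => iUnion_mono' fun hi => ⟨h.trans hi, le_rfl⟩

lemma disjoint_pastRegion_cell (k : ℕ) : Disjoint (φ.pastRegion B k) (φ.cell B k) := by
  rw [Set.disjoint_left]
  intro z hz hz'
  exact hz (mem_iUnion₂.2 ⟨k, le_rfl, hz'⟩)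

lemma cell_subset_pastRegion (k : ℕ) : φ.cell B k ⊆ φ.pastRegion B (k + 1) := by
  intro z hz hz'
  obtain ⟨i, hi, hzi⟩ := mem_iUnion₂.1 hz'
  exact (Set.disjoint_left.1 (φ.disjoint_cell (by omega : k ≠ i))) hz hzi

/-- The filtration generated by the regions `pastRegion`. -/
def cellFiltration (B : Set J) : Filtration ℕ ‹MeasurableSpace Ω› where
  seq k := regionHistory N (φ.pastRegion B k)
  mono' _ _ h := regionHistory_mono (φ.pastRegion_mono h)
  le' _ := regionHistory_le _

lemma poissonHistory_le_regionHistory {t : ℝ≥0} {D : Set (ℝ≥0 × J)}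
    (h : Ioc 0 t ×ˢ univ ⊆ D) : poissonHistory N t ≤ regionHistory N D := by
  refine iSup_le fun s => iSup_le fun u => iSup_le fun A => iSup_le fun _ => iSup_le fun hu =>
    iSup_le fun hA => ?_
  refine (measurable_regionHistory (measurableSet_Ioc.prod hA) ?_).comap_le
  exact (Set.prod_mono (Ioc_subset_Ioc zero_le hu) (subset_univ A)).trans h

/-- Cells of index at least `k` lie in time slabs no earlier than that of the `k`-th cell. The past
is taken as the complement of the remaining cells, not as the union of the earlier ones, because
`poissonHistory` also sees marks outside `B` and outside all `A j`. -/
lemma Ioc_subset_pastRegion {k : ℕ} (h : k < φ.l * φ.m) :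
    Ioc 0 (φ.time (finProdFinEquiv.symm ⟨k, h⟩).1.castSucc) ×ˢ univ ⊆ φ.pastRegion B k := by
  rintro z ⟨hz, -⟩ hz'
  obtain ⟨i, hi, hzi⟩ := mem_iUnion₂.1 hz'
  unfold cell at hzi
  split_ifs at hzi with h'
  · have h1 := hzi.1.1.1
    refine absurd hz.2 (not_le.2 (lt_of_le_of_lt (φ.time_strictMono.monotone ?_) h1))
    rw [Fin.castSucc_le_castSucc_iff, Fin.le_def]
    exact Nat.div_le_div_right hi
  · exact hzi

lemma exists_norm_F_le (i : Fin φ.l) (j : Fin φ.m) (k : Fin φ.n) :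
    ∃ K : ℝ, ∀ᵐ ω ∂P, ‖φ.F i j k ω‖ ≤ K := by
  have h := (φ.bounded i j k).2
  rw [eLpNorm_exponent_top] at h
  refine ⟨(eLpNormEssSup (φ.F i j k) P).toReal, ?_⟩
  filter_upwards [enorm_ae_le_eLpNormEssSup (φ.F i j k) P] with ω hω
  rw [← toReal_enorm]
  exact ENNReal.toReal_mono h.ne hω

lemma exists_norm_coefAt_le (i : Fin φ.l) (j : Fin φ.m) :
    ∃ K : ℝ, ∀ᵐ ω ∂P, ‖φ.coefAt i j ω‖ ≤ K := by
  choose K hK using fun k => φ.exists_norm_F_le i j k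
  refine ⟨∑ k, K k * ‖φ.x i j k‖, ?_⟩
  filter_upwards [ae_all_iff.2 hK] with ω hω
  refine (norm_sum_le _ _).trans (Finset.sum_le_sum fun k _ => ?_)
  rw [norm_smul]
  gcongr
  exact hω k

lemma isBoundedPredictable_coef : IsBoundedPredictable P (φ.cellFiltration B) φ.coef where
  stronglyMeasurable k := by
    unfold coef
    split_ifs with h
    · refine Finset.stronglyMeasurable_fun_sum _ fun i _ => ?_
      refine StronglyMeasurable.smul_const ((φ.adapted _ _ i).mono ?_) _
      exact poissonHistory_le_regionHistory (φ.Ioc_subset_pastRegion h)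
    · exact stronglyMeasurable_zero
  bounded k := by
    unfold coef
    split_ifs with h
    · exact φ.exists_norm_coefAt_le _ _
    · exact ⟨0, by simp⟩

end SimpleAdaptedProcess

end Cells

/-- Independence comes from the disjointness of `C k` and `D k`. For the jump bound, `N` is integer
valued, so it is at least one on `C k` unless it vanishes there, and Markov's inequality applies
with the mean `μ (C k)`. -/
lemma IsPoissonRandomMeasure.isNoise {Ω E : Type*} [MeasurableSpace Ω] [MeasurableSpace E]
    {P : Measure Ω} [IsProbabilityMeasure P] {μ : Measure E} {N : Kernel Ω E}
    (hN : IsPoissonRandomMeasure P μ N) {𝒢 : Filtration ℕ ‹MeasurableSpace Ω›} {D C : ℕ → Set E}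
    (hD : ∀ k, MeasurableSet (D k)) (hC : ∀ k, MeasurableSet (C k))
    (hDC : ∀ k, Disjoint (D k) (C k)) (hCD : ∀ k, C k ⊆ D (k + 1)) (hμ : ∀ k, μ (C k) ≤ 1)
    (h𝒢 : ∀ k, 𝒢 k = regionHistory N (D k)) :
    IsNoise P 𝒢 (fun k => compensated μ N (C k)) (fun k => μ (C k)) compensatedMomentConst where
  measurable k := by
    rw [h𝒢]
    exact measurable_compensated (measurable_regionHistory (hC k) (hCD k))
  indep k := by
    rw [h𝒢]
    refine indep_of_indep_of_le_right (hN.indep_regionHistory (hD k) (hC k) (hDC k)) ?_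
    exact (measurable_compensated (comap_measurable fun ω => N ω (C k))).comap_le
  integral_eq_zero k := hN.integral_compensated (hC k) ((hμ k).trans_lt ENNReal.one_lt_top)
  moment r hr k := hN.lintegral_compensated_rpow_le (hC k) (hμ k) hr
  le_one := hμ
  jump k := by
    have h1 : {ω | compensated μ N (C k) ω ≠ -(μ (C k)).toReal} ⊆ {ω | 1 ≤ N ω (C k)} := by
      intro ω hω
      rcases hN.integer_valued ω (C k) (hC k) with h | ⟨n, hn⟩
      · simp [h]
      · rcases Nat.eq_zero_or_pos n with rfl | hpos
        · exact absurd (by simp [compensated, hn]) hω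
        · rw [mem_ofPred_eq, hn]; exact_mod_cast hpos
    refine (measure_mono h1).trans ?_
    have := mul_meas_ge_le_lintegral (μ := P) (N.measurable_coe (hC k)) 1
    rw [one_mul] at this
    exact this.trans_eq (hN.lintegral_eq (hC k) ((hμ k).trans_lt ENNReal.one_lt_top))

/-! ### Integrals at partition points as partial sums of transforms. -/

section Discrete

variable {Ω J : Type*} [MeasurableSpace Ω] [MeasurableSpace J]
variable {𝕜 V : Type*} [RCLike 𝕜] [NormedAddCommGroup V] [NormedSpace 𝕜 V]
  [NormedSpace ℝ V] [IsScalarTower ℝ 𝕜 V]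
  {P : Measure Ω} {ν : Measure J} {N : Kernel Ω (ℝ≥0 × J)}

namespace SimpleAdaptedProcess

variable (φ : SimpleAdaptedProcess 𝕜 V P ν N) {B : Set J}

lemma integral_eq (t : ℝ≥0) (ω : Ω) :
    φ.integral t B ω = ∑ i, ∑ j, compensated (lebesgueHalfLine.prod ν) N
      (Ioc (min (φ.time i.castSucc) t) (min (φ.time i.succ) t) ×ˢ (φ.A j ∩ B)) ω •
        φ.coefAt i j ω := by
  unfold integral coefAt
  refine Finset.sum_congr rfl fun i _ => Finset.sum_congr rfl fun j _ => ?_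
  rw [Finset.smul_sum]
  refine Finset.sum_congr rfl fun k _ => ?_
  rw [mul_comm, mul_smul, RCLike.real_smul_eq_coe_smul (K := 𝕜)]

lemma compensated_empty {E : Type*} [MeasurableSpace E] {μ : Measure E} {N : Kernel Ω E} (ω : Ω) :
    compensated μ N ∅ ω = 0 := by
  simp [compensated]

/-- In lexicographic order the first `i * φ.m` cells are precisely those within `(0, t_i]`. -/
lemma transformSum_eq_integral (i : Fin (φ.l + 1)) (ω : Ω) :
    transformSum (fun k => compensated (lebesgueHalfLine.prod ν) N (φ.cell B k)) φ.coef
      (i * φ.m) ω = φ.integral (φ.time i) B ω := by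
  rw [integral_eq, transformSum]
  have h1 : Finset.range (i * φ.m) = (Finset.range (φ.l * φ.m)).filter (fun k => k < i * φ.m) := by
    ext k
    simp only [Finset.mem_range, Finset.mem_filter]
    refine ⟨fun h => ⟨h.trans_le (Nat.mul_le_mul_right _ (Nat.lt_succ_iff.1 i.2)), h⟩, fun h => h.2⟩
  rw [h1, Finset.sum_filter, sum_range_eq]
  refine Finset.sum_congr rfl fun i' _ => Finset.sum_congr rfl fun j _ => ?_
  rw [cell_finProdFinEquiv, coef_finProdFinEquiv]
  have h2 : ((finProdFinEquiv (i', j) : Fin (φ.l * φ.m)) : ℕ) < i * φ.m ↔ (i' : ℕ) < i := by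
    rw [finProdFinEquiv_apply_val]
    have hj := j.2
    constructor
    · intro h
      by_contra hc
      have : (i : ℕ) * φ.m ≤ i' * φ.m := Nat.mul_le_mul_right _ (not_lt.1 hc)
      simp only at h
      rw [mul_comm φ.m] at h
      omega
    · intro h
      have : ((i' : ℕ) + 1) * φ.m ≤ i * φ.m := Nat.mul_le_mul_right _ h
      rw [add_mul, one_mul] at this
      simp only
      rw [mul_comm φ.m]
      omega
  by_cases h : (i' : ℕ) < i
  · rw [if_pos (h2.2 h)]
    have e1 : φ.time i'.castSucc ≤ φ.time i := φ.time_strictMono.monotone (by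
      rw [Fin.le_def]; simpa using h.le)
    have e2 : φ.time i'.succ ≤ φ.time i := φ.time_strictMono.monotone (by
      rw [Fin.le_def]; simpa using h)
    rw [min_eq_left e1, min_eq_left e2]
    congr 2
    unfold cellAt
    rw [Set.prod_inter_prod, inter_univ]
  · rw [if_neg (h2.not.2 h)]
    have e1 : φ.time i ≤ φ.time i'.castSucc := φ.time_strictMono.monotone (by
      rw [Fin.le_def]; simpa using not_lt.1 h)
    have e2 : φ.time i ≤ φ.time i'.succ := e1.trans (φ.time_strictMono.monotone
      (Fin.castSucc_le_succ i'))
    rw [min_eq_right e1, min_eq_right e2, Ioc_self, empty_prod, compensated_empty, zero_smul]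

/-- All cells have measure at most one. -/
def IsFine (φ : SimpleAdaptedProcess 𝕜 V P ν N) : Prop :=
  ∀ i j, lebesgueHalfLine.prod ν (φ.cellAt i j) ≤ 1

variable {φ} in
lemma IsFine.measure_cell_le_one (h : φ.IsFine) (k : ℕ) :
    lebesgueHalfLine.prod ν (φ.cell B k) ≤ 1 := by
  unfold cell
  split_ifs
  · exact (measure_mono inter_subset_left).trans (h _ _)
  · simp

variable {φ} in
lemma IsFine.isNoise [IsProbabilityMeasure P] (h : φ.IsFine)
    (hN : IsPoissonRandomMeasure P (lebesgueHalfLine.prod ν) N) (hB : MeasurableSet B) :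
    IsNoise P (φ.cellFiltration B) (fun k => compensated (lebesgueHalfLine.prod ν) N (φ.cell B k))
      (fun k => lebesgueHalfLine.prod ν (φ.cell B k)) compensatedMomentConst :=
  hN.isNoise (φ.measurableSet_pastRegion hB) (φ.measurableSet_cell hB) φ.disjoint_pastRegion_cell
    φ.cell_subset_pastRegion h.measure_cell_le_one fun _ => rfl

/-- The maximal function of the integral over the partition points. -/
def gridMax (φ : SimpleAdaptedProcess 𝕜 V P ν N) (B : Set J) (ω : Ω) : ℝ≥0∞ :=
  ⨆ i, ‖φ.integral (φ.time i) B ω‖ₑ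

lemma gridMax_le_transformMax (ω : Ω) :
    φ.gridMax B ω ≤ transformMax (fun k => compensated (lebesgueHalfLine.prod ν) N (φ.cell B k))
      φ.coef (φ.l * φ.m) ω := by
  refine iSup_le fun i => ?_
  rw [← transformSum_eq_integral]
  exact enorm_transformSum_le_transformMax
    (Nat.mul_le_mul_right _ (Nat.lt_succ_iff.1 i.2)) ω

end SimpleAdaptedProcess

end Discrete

/-- Maximal inequality over the partition points, for exponents at least the martingale type. -/
theorem HasMartingaleType.exists_gridMax_le_of_le {V : Type u} [NormedAddCommGroup V]
    [NormedSpace ℝ V] [CompleteSpace V] {s : ℝ} (hV : HasMartingaleType.{w} V s) (hs : 1 ≤ s)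
    {p : ℝ} (hp : 1 ≤ p) (𝕜 : Type*) [RCLike 𝕜] [NormedSpace 𝕜 V] [IsScalarTower ℝ 𝕜 V] :
    ∃ K : ℝ≥0, ∀ (Ω : Type w) [MeasurableSpace Ω] (P : Measure Ω) [IsProbabilityMeasure P]
      (J : Type v) [MeasurableSpace J] (ν : Measure J) (N : Kernel Ω (ℝ≥0 × J)),
      IsPoissonRandomMeasure P (lebesgueHalfLine.prod ν) N →
      ∀ (φ : SimpleAdaptedProcess 𝕜 V P ν N), φ.IsFine → ∀ B : Set J, MeasurableSet B →
      ∫⁻ ω, φ.gridMax B ω ^ p ∂P ≤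
        K * (∫⁻ ω, (∫⁻ z, ‖restrictMarks φ.value B ω z‖ₑ ^ s ∂lebesgueHalfLine.prod ν) ^ (p / s) ∂P +
          ∫⁻ ω, ∫⁻ z, ‖restrictMarks φ.value B ω z‖ₑ ^ p ∂lebesgueHalfLine.prod ν ∂P) := by
  obtain ⟨C, hC⟩ := hV.exists_transformBound hs compensatedMomentConst
  obtain ⟨K, hK⟩ := exists_lintegral_transformMax_rpow_le hs C compensatedMomentConst hp
  refine ⟨K, fun Ω _ P _ J _ ν N hN φ hφ B hB => ?_⟩
  have hn := hφ.isNoise hN hB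
  refine (lintegral_mono fun ω => ENNReal.rpow_le_rpow (φ.gridMax_le_transformMax ω)
    (by linarith)).trans ((hK (hC Ω P _ _ _ hn) hn φ.isBoundedPredictable_coef _).trans_eq ?_)
  have h0 : ∀ r : ℝ, 1 ≤ r → (0 : ℝ≥0∞) ^ r = 0 := fun r hr =>
    ENNReal.zero_rpow_of_pos (by linarith)
  simp_rw [φ.lintegral_comp_restrictMarks_value hB (f := fun x => x ^ s) (h0 s hs),
    φ.lintegral_comp_restrictMarks_value hB (f := fun x => x ^ p) (h0 p hp)]

/-- Maximal inequality over the partition points, for exponents below the martingale type. -/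
theorem HasMartingaleType.exists_gridMax_le_of_lt {V : Type u} [NormedAddCommGroup V]
    [NormedSpace ℝ V] [CompleteSpace V] {s : ℝ} (hV : HasMartingaleType.{w} V s)
    {p : ℝ} (hp : 1 ≤ p) (hps : p < s) (𝕜 : Type*) [RCLike 𝕜] [NormedSpace 𝕜 V]
    [IsScalarTower ℝ 𝕜 V] :
    ∃ K : ℝ≥0, ∀ (Ω : Type w) [MeasurableSpace Ω] (P : Measure Ω) [IsProbabilityMeasure P]
      (J : Type v) [MeasurableSpace J] (ν : Measure J) [SigmaFinite ν] (N : Kernel Ω (ℝ≥0 × J)),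
      IsPoissonRandomMeasure P (lebesgueHalfLine.prod ν) N →
      ∀ (φ : SimpleAdaptedProcess 𝕜 V P ν N), φ.IsFine → ∀ B : Set J, MeasurableSet B →
      ∀ a b : Ω × (ℝ≥0 × J) → ℝ≥0∞, Measurable a → Measurable b →
      (∀ᵐ ω ∂P, ∀ᵐ z ∂lebesgueHalfLine.prod ν,
        ‖restrictMarks φ.value B ω z‖ₑ ≤ a (ω, z) + b (ω, z)) →
      ∫⁻ ω, φ.gridMax B ω ^ p ∂P ≤
        K * (∫⁻ ω, (∫⁻ z, a (ω, z) ^ s ∂lebesgueHalfLine.prod ν) ^ (p / s) ∂P +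
          ∫⁻ ω, ∫⁻ z, b (ω, z) ^ p ∂lebesgueHalfLine.prod ν ∂P) := by
  have hs : 1 ≤ s := by linarith
  have hs0 : 0 < s := by linarith
  have hp0 : 0 < p := by linarith
  obtain ⟨C, hC⟩ := hV.exists_transformBound hs compensatedMomentConst
  refine ⟨2 ^ p * (p.toNNReal * ((C + 2) * (truncPowConst p s * 2 ^ p * (3 + 2 ^ (p / s))))),
    fun Ω _ P _ J _ ν _ N hN φ hφ B hB a b ha hb hab => ?_⟩
  have hn := hφ.isNoise hN hB
  have h1 := (hC Ω P _ _ _ hn).lintegral_transformMax_rpow_le_levelFunctional hs0 hn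
    φ.isBoundedPredictable_coef (φ.l * φ.m) hp0
  refine (lintegral_mono fun ω => ENNReal.rpow_le_rpow (φ.gridMax_le_transformMax ω)
    (by linarith)).trans (h1.trans ?_)
  -- Weighted sums over cells are integrals of the process itself, since `truncPow` and `abovePart`
  -- vanish at zero. Only in this form can the process be compared with `a + b`, which need not be
  -- constant on cells.
  have h2 : ∀ ω, levelFunctional p s (fun f => ∑ k ∈ Finset.range (φ.l * φ.m),
      lebesgueHalfLine.prod ν (φ.cell B k) * f ‖φ.coef k ω‖ₑ) =
      levelFunctional p s (fun f =>
        ∫⁻ z, f ‖restrictMarks φ.value B ω z‖ₑ ∂lebesgueHalfLine.prod ν) := by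
    intro ω
    unfold levelFunctional
    refine lintegral_congr fun t => ?_
    beta_reduce
    rw [φ.lintegral_comp_restrictMarks_value hB (f := truncPow s (ENNReal.ofReal t)),
      φ.lintegral_comp_restrictMarks_value hB (f := abovePart (ENNReal.ofReal t))]
    · simp [abovePart]
    · simp [truncPow, hs0]
  have h3 : ∫⁻ ω, levelFunctional p s (fun f => ∑ k ∈ Finset.range (φ.l * φ.m),
      lebesgueHalfLine.prod ν (φ.cell B k) * f ‖φ.coef k ω‖ₑ) ∂P ≤
      truncPowConst p s * 2 ^ p * (3 + 2 ^ (p / s)) *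
        (∫⁻ ω, (∫⁻ z, a (ω, z) ^ s ∂lebesgueHalfLine.prod ν) ^ (p / s) ∂P +
          ∫⁻ ω, ∫⁻ z, b (ω, z) ^ p ∂lebesgueHalfLine.prod ν ∂P) := by
    have hm1 : Measurable fun ω => (∫⁻ z, a (ω, z) ^ s ∂lebesgueHalfLine.prod ν) ^ (p / s) :=
      (ha.pow_const s).lintegral_prod_right'.pow_const _
    have hm2 : Measurable fun ω => ∫⁻ z, b (ω, z) ^ p ∂lebesgueHalfLine.prod ν :=
      (hb.pow_const p).lintegral_prod_right'
    have hm3 : Measurable fun ω => (∫⁻ z, a (ω, z) ^ s ∂lebesgueHalfLine.prod ν) ^ (p / s) +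
      ∫⁻ z, b (ω, z) ^ p ∂lebesgueHalfLine.prod ν := hm1.add hm2
    rw [← lintegral_add_left hm1, ← lintegral_const_mul _ hm3]
    refine lintegral_mono_ae (hab.mono fun ω hω => ?_)
    rw [h2]
    exact levelFunctional_le hp hps (ha.comp measurable_prodMk_left)
      (hb.comp measurable_prodMk_left) hω
  calc _ ≤ 2 ^ p * (ENNReal.ofReal p * ((C + 2) * (truncPowConst p s * 2 ^ p * (3 + 2 ^ (p / s)) *
        (∫⁻ ω, (∫⁻ z, a (ω, z) ^ s ∂lebesgueHalfLine.prod ν) ^ (p / s) ∂P +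
          ∫⁻ ω, ∫⁻ z, b (ω, z) ^ p ∂lebesgueHalfLine.prod ν ∂P)))) := by gcongr
    _ = _ := by
      push_cast
      rw [ENNReal.coe_rpow_of_nonneg _ hp0.le, ENNReal.coe_rpow_of_nonneg _ (by positivity),
        ENNReal.ofReal]
      push_cast
      ring

/-! ### Discretisation in time -/

/-- The largest point of the grid `G` strictly to the left of `u`. -/
def leftPt (G : Finset ℝ≥0) (u : ℝ≥0) : ℝ≥0 := (G.filter (· < u)).sup id

lemma leftPt_lt (G : Finset ℝ≥0) {u : ℝ≥0} (hu : 0 < u) : leftPt G u < u :=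
  (Finset.sup_lt_iff (bot_eq_zero (α := ℝ≥0) ▸ hu)).2 fun _ h => (Finset.mem_filter.1 h).2

lemma le_leftPt {G : Finset ℝ≥0} {g u : ℝ≥0} (hg : g ∈ G) (h : g < u) : g ≤ leftPt G u :=
  Finset.le_sup (f := id) (Finset.mem_filter.2 ⟨hg, h⟩)

lemma leftPt_lt_iff {G : Finset ℝ≥0} {t u : ℝ≥0} (ht : t ∈ G) (hu : 0 < u) :
    leftPt G u < t ↔ u ≤ t :=
  ⟨fun h => not_lt.1 fun h' => absurd (le_leftPt ht h') (not_le.2 h), (leftPt_lt G hu).trans_le⟩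

lemma leftPt_mem {G : Finset ℝ≥0} (h0 : 0 ∈ G) {u : ℝ≥0} (hu : 0 < u) : leftPt G u ∈ G := by
  obtain ⟨g, hg, h⟩ := Finset.exists_mem_eq_sup (G.filter (· < u))
    ⟨0, Finset.mem_filter.2 ⟨h0, hu⟩⟩ id
  rw [leftPt, h]
  exact (Finset.mem_filter.1 hg).1

lemma tendsto_leftPt {G : ℕ → Finset ℝ≥0}
    (hG : ∀ a b : ℝ≥0, a < b → ∀ᶠ n in atTop, ∃ g ∈ G n, a < g ∧ g < b) {u : ℝ≥0} (hu : 0 < u) :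
    Tendsto (fun n => leftPt (G n) u) atTop (𝓝[<] u) := by
  refine tendsto_nhdsWithin_iff.2 ⟨?_, Eventually.of_forall fun n => leftPt_lt _ hu⟩
  refine tendsto_order.2 ⟨fun a ha => ?_, fun b hb => Eventually.of_forall fun n =>
    (leftPt_lt _ hu).trans hb⟩
  filter_upwards [hG a u ha] with n ⟨g, hg, hag, hgu⟩
  exact hag.trans_le (le_leftPt hg hgu)

/-- The points of a grid containing zero, in increasing order. -/
def gridEnum (G : Finset ℝ≥0) (h0 : 0 ∈ G) : Fin (G.card - 1 + 1) ↪o ℝ≥0 :=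
  G.orderEmbOfFin (Nat.sub_add_cancel (Finset.card_pos.2 ⟨0, h0⟩)).symm

lemma gridEnum_mem {G : Finset ℝ≥0} (h0 : 0 ∈ G) (i) : gridEnum G h0 i ∈ G :=
  Finset.orderEmbOfFin_mem _ _ _

lemma exists_gridEnum_eq {G : Finset ℝ≥0} (h0 : 0 ∈ G) {g : ℝ≥0} (hg : g ∈ G) :
    ∃ i, gridEnum G h0 i = g := by
  have : g ∈ range (gridEnum G h0) := by
    rw [gridEnum, Finset.range_orderEmbOfFin]; exact hg
  exact this

lemma gridEnum_zero {G : Finset ℝ≥0} (h0 : 0 ∈ G) : gridEnum G h0 0 = 0 := by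
  obtain ⟨i, hi⟩ := exists_gridEnum_eq h0 h0
  refine le_antisymm ?_ zero_le
  rw [← hi]
  exact (gridEnum G h0).monotone (Fin.zero_le i)

lemma leftPt_eq_gridEnum {G : Finset ℝ≥0} (h0 : 0 ∈ G) {i : Fin (G.card - 1)} {u : ℝ≥0}
    (hu : u ∈ Ioc (gridEnum G h0 i.castSucc) (gridEnum G h0 i.succ)) :
    leftPt G u = gridEnum G h0 i.castSucc := by
  refine le_antisymm (Finset.sup_le fun g hg => ?_) (le_leftPt (gridEnum_mem _ _) hu.1)
  obtain ⟨hg, hgu⟩ := Finset.mem_filter.1 hg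
  obtain ⟨k, rfl⟩ := exists_gridEnum_eq h0 hg
  have := (gridEnum G h0).lt_iff_lt.1 (hgu.trans_le hu.2)
  exact (gridEnum G h0).monotone (Fin.le_castSucc_iff.2 this)

lemma exists_mem_Ioc_gridEnum {G : Finset ℝ≥0} (h0 : 0 ∈ G) {b u : ℝ≥0} (hb : b ∈ G) (hu : 0 < u)
    (hub : u ≤ b) : ∃ i : Fin (G.card - 1),
      u ∈ Ioc (gridEnum G h0 i.castSucc) (gridEnum G h0 i.succ) := by
  obtain ⟨k, hk⟩ := exists_gridEnum_eq h0 (leftPt_mem h0 hu)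
  obtain ⟨k', rfl⟩ := exists_gridEnum_eq h0 hb
  have hlt : k < k' := by
    rw [← (gridEnum G h0).lt_iff_lt, hk]; exact (leftPt_lt G hu).trans_le hub
  obtain ⟨i, rfl⟩ := Fin.exists_castSucc_eq.2 (hlt.trans_le (Fin.le_last k')).ne
  refine ⟨i, ?_, ?_⟩
  · rw [hk]; exact leftPt_lt G hu
  · by_contra h
    have := le_leftPt (gridEnum_mem h0 i.succ) (not_le.1 h)
    rw [← hk, (gridEnum G h0).le_iff_le] at this
    exact absurd this (not_le.2 Fin.castSucc_lt_succ)

/-- Exactly one grid interval contains a given `u ∈ (a, b]`. As `a` and `b` are grid points, each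
grid interval lies either inside `(a, b]` or outside it, so testing its left end suffices. -/
lemma sum_indicator_gridEnum {M : Type*} [AddCommMonoid M] {G : Finset ℝ≥0} (h0 : 0 ∈ G)
    {a b : ℝ≥0} (ha : a ∈ G) (hb : b ∈ G) (f : ℝ≥0 → M) (u : ℝ≥0) :
    ∑ i : Fin (G.card - 1), (Ioc (gridEnum G h0 i.castSucc) (gridEnum G h0 i.succ)).indicator
      (fun _ => if a ≤ gridEnum G h0 i.castSucc ∧ gridEnum G h0 i.castSucc < b then
        f (gridEnum G h0 i.castSucc) else 0) u = (Ioc a b).indicator (fun _ => f (leftPt G u)) u := by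
  by_cases hu : u ∈ Ioc a b
  · have hu0 : 0 < u := lt_of_le_of_lt zero_le hu.1
    obtain ⟨i, hi⟩ := exists_mem_Ioc_gridEnum h0 hb hu0 hu.2
    have hl := leftPt_eq_gridEnum h0 hi
    rw [Finset.sum_eq_single i, indicator_of_mem hi, indicator_of_mem hu, if_pos, hl]
    · rw [← hl]
      exact ⟨le_leftPt ha hu.1, (leftPt_lt G hu0).trans_le hu.2⟩
    · intro k _ hk
      refine indicator_of_notMem (fun hk' => hk ?_) _
      have := (leftPt_eq_gridEnum h0 hk').symm.trans hl
      exact Fin.castSucc_injective _ ((gridEnum G h0).injective this)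
    · simp
  · rw [indicator_of_notMem hu]
    refine Finset.sum_eq_zero fun i _ => indicator_apply_eq_zero.2 fun hi => if_neg fun h => hu ?_
    refine ⟨h.1.trans_lt hi.1, hi.2.trans ?_⟩
    obtain ⟨k, rfl⟩ := exists_gridEnum_eq h0 hb
    exact (gridEnum G h0).monotone (Fin.castSucc_lt_iff_succ_le.1 ((gridEnum G h0).lt_iff_lt.1 h.2))

section Approx

variable {Ω J : Type*} [MeasurableSpace Ω] [MeasurableSpace J]
variable {𝕜 X V : Type*} [RCLike 𝕜] [NormedAddCommGroup X] [NormedSpace 𝕜 X]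
  [NormedAddCommGroup V] [NormedSpace 𝕜 V]
  {P : Measure Ω} {ν : Measure J} {N : Kernel Ω (ℝ≥0 × J)}

lemma poissonHistory_mono : Monotone (poissonHistory N) := by
  intro t t' h
  refine iSup_mono fun s => iSup_mono fun u => iSup_mono fun A => iSup_mono fun _ => ?_
  exact iSup_mono' fun hu => ⟨hu.trans h, le_rfl⟩

namespace SimpleAdaptedProcess

/-- The simple process `T(u_G) φ(u)`, where `u_G` is the grid point to the left of `u`. -/
def approx (φ : SimpleAdaptedProcess 𝕜 X P ν N) (T : ℝ≥0 → X →L[𝕜] V) (G : Finset ℝ≥0)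
    (h0 : 0 ∈ G) : SimpleAdaptedProcess 𝕜 V P ν N where
  l := G.card - 1
  m := φ.m
  -- The index encodes an original time interval together with an original `k`. The coefficient is
  -- kept only if the grid interval lies in that time interval, which also gives adaptedness at the
  -- later grid time.
  n := φ.l * φ.n
  time := gridEnum G h0
  time_zero := gridEnum_zero h0
  time_strictMono := (gridEnum G h0).strictMono
  A := φ.A
  measurableSet_A := φ.measurableSet_A
  measure_A_lt_top := φ.measure_A_lt_top
  disjoint_A := φ.disjoint_A
  F i j q := if φ.time (finProdFinEquiv.symm q).1.castSucc ≤ gridEnum G h0 i.castSucc ∧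
    gridEnum G h0 i.castSucc < φ.time (finProdFinEquiv.symm q).1.succ then
    φ.F (finProdFinEquiv.symm q).1 j (finProdFinEquiv.symm q).2 else 0
  adapted i j q := by
    split_ifs with h
    · exact (φ.adapted _ _ _).mono (poissonHistory_mono h.1)
    · exact stronglyMeasurable_zero
  bounded i j q := by
    split_ifs with h
    · exact φ.bounded _ _ _
    · exact MemLp.zero
  x i j q := T (gridEnum G h0 i.castSucc)
    (φ.x (finProdFinEquiv.symm q).1 j (finProdFinEquiv.symm q).2)

lemma value_approx (φ : SimpleAdaptedProcess 𝕜 X P ν N) (T : ℝ≥0 → X →L[𝕜] V) {G : Finset ℝ≥0}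
    (h0 : 0 ∈ G) (hφ : ∀ i, φ.time i ∈ G) (ω : Ω) (z : ℝ≥0 × J) :
    (φ.approx T G h0).value ω z = T (leftPt G z.1) (φ.value ω z) := by
  have key : ∀ (i' : Fin φ.l) (j : Fin φ.m) (k : Fin φ.n),
      ∑ i : Fin (G.card - 1), (Ioc (gridEnum G h0 i.castSucc) (gridEnum G h0 i.succ) ×ˢ
        φ.A j).indicator (fun _ => (if φ.time i'.castSucc ≤ gridEnum G h0 i.castSucc ∧
          gridEnum G h0 i.castSucc < φ.time i'.succ then φ.F i' j k else 0) ω •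
            T (gridEnum G h0 i.castSucc) (φ.x i' j k)) z =
      T (leftPt G z.1) ((Ioc (φ.time i'.castSucc) (φ.time i'.succ) ×ˢ φ.A j).indicator
        (fun _ => φ.F i' j k ω • φ.x i' j k) z) := by
    intro i' j k
    by_cases hz : z.2 ∈ φ.A j
    · have h1 : ∀ (s : Set ℝ≥0) (v : V),
          (s ×ˢ φ.A j).indicator (fun _ => v) z = s.indicator (fun _ => v) z.1 := by
        intro s v
        by_cases h : z.1 ∈ s
        · rw [indicator_of_mem h, indicator_of_mem (show z ∈ s ×ˢ φ.A j from ⟨h, hz⟩)]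
        · rw [indicator_of_notMem h, indicator_of_notMem fun h' => h h'.1]
      have h2 : T (leftPt G z.1) ((Ioc (φ.time i'.castSucc) (φ.time i'.succ) ×ˢ φ.A j).indicator
          (fun _ => φ.F i' j k ω • φ.x i' j k) z) =
          (Ioc (φ.time i'.castSucc) (φ.time i'.succ) ×ˢ φ.A j).indicator
          (fun _ => φ.F i' j k ω • T (leftPt G z.1) (φ.x i' j k)) z := by
        by_cases h : z ∈ Ioc (φ.time i'.castSucc) (φ.time i'.succ) ×ˢ φ.A j
        · simp only [indicator_of_mem h, map_smul]
        · simp only [indicator_of_notMem h, map_zero]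
      rw [h2, h1, ← sum_indicator_gridEnum h0 (hφ _) (hφ _)
        (fun g => φ.F i' j k ω • T g (φ.x i' j k))]
      refine Finset.sum_congr rfl fun i _ => ?_
      rw [h1]
      congr 1
      funext _
      split_ifs <;> simp
    · rw [indicator_of_notMem fun h => hz h.2, map_zero]
      exact Finset.sum_eq_zero fun i _ => indicator_of_notMem (fun h => hz h.2) _
  unfold value
  simp only [map_sum, ← key]
  change ∑ i : Fin (G.card - 1), ∑ j : Fin φ.m, ∑ q : Fin (φ.l * φ.n), _ = _
  rw [Finset.sum_comm, Finset.sum_comm (s := (Finset.univ : Finset (Fin φ.l)))]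
  refine Finset.sum_congr rfl fun j _ => ?_
  rw [Finset.sum_comm, ← finProdFinEquiv.sum_comp, Fintype.sum_prod_type]
  refine Finset.sum_congr rfl fun i' _ => Finset.sum_congr rfl fun k _ =>
    Finset.sum_congr rfl fun i _ => ?_
  simp only [approx, Equiv.symm_apply_apply]

end SimpleAdaptedProcess

end Approx

/-! ### Pathwise integrals -/

lemma memLp_and_tendsto_eLpNorm_of_dominated {Ω V : Type*} [MeasurableSpace Ω] {P : Measure Ω}
    [NormedAddCommGroup V] {p : ℝ} (hp : 0 < p) {F : ℕ → Ω → V} {f : Ω → V} {h : Ω → ℝ}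
    (hF : ∀ n, AEStronglyMeasurable (F n) P) (hh : MemLp h (ENNReal.ofReal p) P)
    (hle : ∀ n, ∀ᵐ ω ∂P, ‖F n ω‖ ≤ h ω)
    (hlim : ∀ᵐ ω ∂P, Tendsto (fun n => F n ω) atTop (𝓝 (f ω))) :
    MemLp f (ENNReal.ofReal p) P ∧
      Tendsto (fun n => eLpNorm (F n - f) (ENNReal.ofReal p) P) atTop (𝓝 0) := by
  have hf : AEStronglyMeasurable f P := aestronglyMeasurable_of_tendsto_ae atTop hF hlim
  have hfle : ∀ᵐ ω ∂P, ‖f ω‖ ≤ h ω := by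
    filter_upwards [hlim, ae_all_iff.2 hle] with ω h1 h2
    exact le_of_tendsto h1.norm (Eventually.of_forall h2)
  have hp0 : ENNReal.ofReal p ≠ 0 := by simpa using hp
  refine ⟨hh.mono' hf hfle, ?_⟩
  have h2 := (hh.const_mul 2).2
  rw [eLpNorm_lt_top_iff_lintegral_rpow_enorm_lt_top hp0 (by simp),
    ENNReal.toReal_ofReal hp.le] at h2
  have h3 : Tendsto (fun n => ∫⁻ ω, ‖(F n - f) ω‖ₑ ^ p ∂P) atTop (𝓝 (∫⁻ _, 0 ∂P)) := by
    refine tendsto_lintegral_of_dominated_convergence' (fun ω => ‖2 * h ω‖ₑ ^ p)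
      (fun n => (((hF n).sub hf).enorm).pow_const p) (fun n => ?_) h2.ne ?_
    · filter_upwards [hle n, hfle] with ω h4 h5
      refine ENNReal.rpow_le_rpow (enorm_le_iff_norm_le.2 ?_) hp.le
      have h6 : 0 ≤ h ω := (norm_nonneg _).trans h4
      rw [Real.norm_of_nonneg (by positivity)]
      exact (norm_sub_le _ _).trans (by linarith)
    · filter_upwards [hlim] with ω h4
      have h5 : Tendsto (fun n => ‖F n ω - f ω‖ₑ) atTop (𝓝 0) := by
        have := (h4.sub_const (f ω)).enorm
        simpa using this
      have h6 := (ENNReal.continuous_rpow_const (y := p)).continuousAt.tendsto.comp h5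
      rw [ENNReal.zero_rpow_of_pos hp] at h6
      exact h6
  rw [lintegral_zero] at h3
  have h7 := (ENNReal.continuous_rpow_const (y := 1 / p)).continuousAt.tendsto.comp h3
  rw [ENNReal.zero_rpow_of_pos (by positivity)] at h7
  refine h7.congr fun n => ?_
  rw [eLpNorm_eq_lintegral_rpow_enorm_toReal hp0 (by simp), ENNReal.toReal_ofReal hp.le]
  rfl

section Pathwise

variable {Ω J : Type*} [MeasurableSpace Ω] [MeasurableSpace J]
variable {𝕜 X V : Type*} [RCLike 𝕜] [NormedAddCommGroup X] [NormedSpace 𝕜 X]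
  [NormedAddCommGroup V] [NormedSpace 𝕜 V]
  {P : Measure Ω} {ν : Measure J} {N : Kernel Ω (ℝ≥0 × J)} {B : Set J}

namespace SimpleAdaptedProcess

/-- The measure `ρ` is finite on bounded time intervals and the sets of marks of `φ`. -/
def FiniteOnStrips (φ : SimpleAdaptedProcess 𝕜 X P ν N) (ρ : Measure (ℝ≥0 × J)) : Prop :=
  ∀ (n : ℕ) (j : Fin φ.m), ρ (Ioc 0 (n : ℝ≥0) ×ˢ φ.A j) < ∞

lemma finiteOnStrips_prod [SigmaFinite ν] (φ : SimpleAdaptedProcess 𝕜 X P ν N) :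
    φ.FiniteOnStrips (lebesgueHalfLine.prod ν) := fun n j => by
  rw [Measure.prod_prod]
  exact ENNReal.mul_lt_top (lebesgueHalfLine_Ioc_lt_top _ _) (φ.measure_A_lt_top j)

lemma ae_finiteOnStrips [SigmaFinite ν] (φ : SimpleAdaptedProcess 𝕜 X P ν N)
    (hN : IsPoissonRandomMeasure P (lebesgueHalfLine.prod ν) N) :
    ∀ᵐ ω ∂P, φ.FiniteOnStrips (N ω) :=
  ae_all_iff.2 fun n => ae_all_iff.2 fun j =>
    hN.ae_lt_top (measurableSet_Ioc.prod (φ.measurableSet_A j)) (φ.finiteOnStrips_prod n j)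

section Measure

variable {φ : SimpleAdaptedProcess 𝕜 X P ν N} {ρ : Measure (ℝ≥0 × J)}

lemma FiniteOnStrips.cellAt_lt_top (h : φ.FiniteOnStrips ρ) (i : Fin φ.l) (j : Fin φ.m) :
    ρ (φ.cellAt i j) < ∞ := by
  obtain ⟨n, hn⟩ := exists_nat_ge (φ.time i.succ)
  exact lt_of_le_of_lt (measure_mono (prod_mono (Ioc_subset_Ioc zero_le hn) subset_rfl)) (h n j)

lemma FiniteOnStrips.integrable_value (h : φ.FiniteOnStrips ρ) (ω : Ω) :
    Integrable (φ.value ω) ρ := by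
  simp_rw [funext (φ.value_eq ω)]
  refine integrable_finsetSum _ fun i _ => integrable_finsetSum _ fun j _ => ?_
  exact (integrable_indicator_iff (φ.measurableSet_cellAt i j)).2
    (integrableOn_const (h.cellAt_lt_top i j).ne)

lemma stronglyMeasurable_value (φ : SimpleAdaptedProcess 𝕜 X P ν N) (ω : Ω) :
    StronglyMeasurable (φ.value ω) := by
  simp_rw [funext (φ.value_eq ω)]
  refine Finset.stronglyMeasurable_fun_sum _ fun i _ => Finset.stronglyMeasurable_fun_sum _ fun j _ =>
    stronglyMeasurable_const.indicator (φ.measurableSet_cellAt i j)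

lemma FiniteOnStrips.integral_norm_value_le (h : φ.FiniteOnStrips ρ) (ω : Ω) :
    ∫ z, ‖φ.value ω z‖ ∂ρ ≤ ∑ i, ∑ j, (ρ (φ.cellAt i j)).toReal * ‖φ.coefAt i j ω‖ := by
  have hi : ∀ i j, Integrable ((φ.cellAt i j).indicator fun _ => ‖φ.coefAt i j ω‖) ρ := fun i j =>
    (integrable_indicator_iff (φ.measurableSet_cellAt i j)).2
      (integrableOn_const (h.cellAt_lt_top i j).ne)
  calc ∫ z, ‖φ.value ω z‖ ∂ρ
      ≤ ∫ z, ∑ i, ∑ j, (φ.cellAt i j).indicator (fun _ => ‖φ.coefAt i j ω‖) z ∂ρ := by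
        refine integral_mono (h.integrable_value ω).norm
          (integrable_finsetSum _ fun i _ => integrable_finsetSum _ fun j _ => hi i j) fun z => ?_
        simp only [value_eq]
        refine norm_sum_le_of_le _ fun i _ => norm_sum_le_of_le _ fun j _ => ?_
        rw [norm_indicator_eq_indicator_norm]
    _ = _ := by
        rw [integral_finsetSum _ fun i _ => integrable_finsetSum _ fun j _ => hi i j]
        refine Finset.sum_congr rfl fun i _ => ?_
        rw [integral_finsetSum _ fun j _ => hi i j]
        refine Finset.sum_congr rfl fun j _ => ?_
        rw [integral_indicator_const _ (φ.measurableSet_cellAt i j), smul_eq_mul, Measure.real]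

lemma cellAt_inter (φ : SimpleAdaptedProcess 𝕜 X P ν N) (i : Fin φ.l) (j : Fin φ.m) (t : ℝ≥0)
    (B : Set J) : φ.cellAt i j ∩ Ioc 0 t ×ˢ B =
      Ioc (min (φ.time i.castSucc) t) (min (φ.time i.succ) t) ×ˢ (φ.A j ∩ B) := by
  rw [cellAt, prod_inter_prod]
  congr 1
  ext u
  simp only [mem_inter_iff, mem_Ioc, min_lt_iff, le_min_iff]
  constructor
  · rintro ⟨⟨h1, h2⟩, h3, h4⟩
    exact ⟨Or.inl h1, h2, h4⟩
  · rintro ⟨h1 | h1, h2, h3⟩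
    · exact ⟨⟨h1, h2⟩, lt_of_le_of_lt zero_le h1, h3⟩
    · exact absurd h3 (not_le.2 h1)

variable [NormedSpace ℝ X] [CompleteSpace X] in
lemma FiniteOnStrips.setIntegral_value (h : φ.FiniteOnStrips ρ) (t : ℝ≥0) (ω : Ω) :
    ∫ z in Ioc 0 t ×ˢ B, φ.value ω z ∂ρ = ∑ i, ∑ j,
      (ρ (Ioc (min (φ.time i.castSucc) t) (min (φ.time i.succ) t) ×ˢ (φ.A j ∩ B))).toReal •
        φ.coefAt i j ω := by
  have hi : ∀ i j, Integrable ((φ.cellAt i j).indicator fun _ => φ.coefAt i j ω)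
      (ρ.restrict (Ioc 0 t ×ˢ B)) := fun i j =>
    ((integrable_indicator_iff (φ.measurableSet_cellAt i j)).2
      (integrableOn_const (h.cellAt_lt_top i j).ne)).mono_measure Measure.restrict_le_self
  simp_rw [value_eq]
  rw [integral_finsetSum _ fun i _ => integrable_finsetSum _ fun j _ => hi i j]
  refine Finset.sum_congr rfl fun i _ => ?_
  rw [integral_finsetSum _ fun j _ => hi i j]
  refine Finset.sum_congr rfl fun j _ => ?_
  rw [integral_indicator_const _ (φ.measurableSet_cellAt i j), Measure.real,
    Measure.restrict_apply (φ.measurableSet_cellAt i j), cellAt_inter]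

end Measure

end SimpleAdaptedProcess

variable [NormedSpace ℝ V]

/-- The integral over `(0, t] × B` with respect to the path `N ω - dt × ν`. -/
def pathIntegral (ν : Measure J) (N : Kernel Ω (ℝ≥0 × J)) (ω : Ω) (t : ℝ≥0) (B : Set J)
    (f : ℝ≥0 × J → V) : V :=
  ∫ z in Ioc 0 t ×ˢ B, f z ∂N ω - ∫ z in Ioc 0 t ×ˢ B, f z ∂lebesgueHalfLine.prod ν

namespace SimpleAdaptedProcess

/-- A random variable dominating the integrals of processes that are dominated by `φ`. -/
def pathBound (φ : SimpleAdaptedProcess 𝕜 X P ν N) (ω : Ω) : ℝ :=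
  ∑ i, ∑ j, ((N ω (φ.cellAt i j)).toReal + (lebesgueHalfLine.prod ν (φ.cellAt i j)).toReal) *
    ‖φ.coefAt i j ω‖

/-- On such a path both `N ω` and the intensity are finite on every cell, so the two Bochner
integrals are finite sums and can be subtracted cell by cell. -/
lemma pathIntegral_value [SigmaFinite ν] [IsScalarTower ℝ 𝕜 V] [CompleteSpace V]
    (φ : SimpleAdaptedProcess 𝕜 V P ν N)
    {ω : Ω} (h : φ.FiniteOnStrips (N ω)) (t : ℝ≥0) :
    pathIntegral ν N ω t B (φ.value ω) = φ.integral t B ω := by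
  rw [pathIntegral, h.setIntegral_value, φ.finiteOnStrips_prod.setIntegral_value, integral_eq,
    ← Finset.sum_sub_distrib]
  refine Finset.sum_congr rfl fun i _ => ?_
  rw [← Finset.sum_sub_distrib]
  refine Finset.sum_congr rfl fun j _ => ?_
  rw [← sub_smul]
  rfl

lemma norm_pathIntegral_le [SigmaFinite ν] (φ : SimpleAdaptedProcess 𝕜 X P ν N) {ω : Ω}
    (h : φ.FiniteOnStrips (N ω)) {M : ℝ} (hM : 0 ≤ M) {f : ℝ≥0 × J → V}
    (hf : ∀ z, ‖f z‖ ≤ M * ‖φ.value ω z‖) (t : ℝ≥0) :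
    ‖pathIntegral ν N ω t B f‖ ≤ M * φ.pathBound ω := by
  have key : ∀ ρ : Measure (ℝ≥0 × J), φ.FiniteOnStrips ρ → ‖∫ z in Ioc 0 t ×ˢ B, f z ∂ρ‖ ≤
      M * ∑ i, ∑ j, (ρ (φ.cellAt i j)).toReal * ‖φ.coefAt i j ω‖ := by
    intro ρ hρ
    refine (norm_integral_le_of_norm_le ((hρ.integrable_value ω).norm.const_mul M).restrict
      (Eventually.of_forall hf)).trans ?_
    refine (setIntegral_le_integral ((hρ.integrable_value ω).norm.const_mul M)
      (Eventually.of_forall fun z => by positivity)).trans ?_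
    rw [integral_const_mul]
    gcongr
    exact hρ.integral_norm_value_le ω
  refine (norm_sub_le _ _).trans ((add_le_add (key _ h) (key _ φ.finiteOnStrips_prod)).trans_eq ?_)
  rw [← mul_add, ← Finset.sum_add_distrib, pathBound]
  congr 1
  refine Finset.sum_congr rfl fun i _ => ?_
  rw [← Finset.sum_add_distrib]
  exact Finset.sum_congr rfl fun j _ => (add_mul _ _ _).symm

lemma tendsto_pathIntegral [SigmaFinite ν] (φ : SimpleAdaptedProcess 𝕜 X P ν N) {ω : Ω}
    (h : φ.FiniteOnStrips (N ω)) {M : ℝ} {F : ℕ → ℝ≥0 × J → V} {f : ℝ≥0 × J → V}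
    (hF : ∀ n, StronglyMeasurable (F n)) (hM : ∀ n z, ‖F n z‖ ≤ M * ‖φ.value ω z‖)
    (hlim : ∀ z, Tendsto (fun n => F n z) atTop (𝓝 (f z))) (t : ℝ≥0) :
    Tendsto (fun n => pathIntegral ν N ω t B (F n)) atTop (𝓝 (pathIntegral ν N ω t B f)) := by
  have key : ∀ ρ : Measure (ℝ≥0 × J), φ.FiniteOnStrips ρ →
      Tendsto (fun n => ∫ z in Ioc 0 t ×ˢ B, F n z ∂ρ) atTop (𝓝 (∫ z in Ioc 0 t ×ˢ B, f z ∂ρ)) :=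
    fun ρ hρ => tendsto_integral_of_dominated_convergence (fun z => M * ‖φ.value ω z‖)
      (fun n => (hF n).aestronglyMeasurable) ((hρ.integrable_value ω).norm.const_mul M).restrict
      (fun n => Eventually.of_forall (hM n)) (Eventually.of_forall hlim)
  exact (key _ h).sub (key _ φ.finiteOnStrips_prod)

lemma stronglyMeasurable_F (φ : SimpleAdaptedProcess 𝕜 X P ν N) (i : Fin φ.l) (j : Fin φ.m)
    (k : Fin φ.n) : StronglyMeasurable (φ.F i j k) :=
  (φ.adapted i j k).mono
    ((poissonHistory_le_regionHistory (subset_univ _)).trans (regionHistory_le univ))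

lemma stronglyMeasurable_coefAt (φ : SimpleAdaptedProcess 𝕜 X P ν N) (i : Fin φ.l)
    (j : Fin φ.m) : StronglyMeasurable (φ.coefAt i j) :=
  Finset.stronglyMeasurable_fun_sum _ fun k _ => (φ.stronglyMeasurable_F i j k).smul_const _

lemma stronglyMeasurable_integral [IsScalarTower ℝ 𝕜 V] (φ : SimpleAdaptedProcess 𝕜 V P ν N)
    (t : ℝ≥0) (hB : MeasurableSet B) : StronglyMeasurable (φ.integral t B) := by
  simp_rw [funext (φ.integral_eq t)]
  refine Finset.stronglyMeasurable_fun_sum _ fun i _ => Finset.stronglyMeasurable_fun_sum _ fun j _ =>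
    StronglyMeasurable.smul ?_ (φ.stronglyMeasurable_coefAt i j)
  exact (measurable_compensated (N.measurable_coe
    (measurableSet_Ioc.prod ((φ.measurableSet_A j).inter hB)))).stronglyMeasurable

/-- `pathBound` depends neither on the time, nor on `B`, nor on the grid, so it yields one
dominating function for all approximations simultaneously. -/
lemma memLp_pathBound [IsProbabilityMeasure P] [SigmaFinite ν]
    (φ : SimpleAdaptedProcess 𝕜 X P ν N)
    (hN : IsPoissonRandomMeasure P (lebesgueHalfLine.prod ν) N) {p : ℝ} (hp : 1 ≤ p) :
    MemLp φ.pathBound (ENNReal.ofReal p) P := by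
  refine memLp_finsetSum _ fun i _ => memLp_finsetSum _ fun j _ => ?_
  obtain ⟨K, hK⟩ := φ.exists_norm_coefAt_le i j
  have h1 : MemLp (fun ω => (N ω (φ.cellAt i j)).toReal +
      (lebesgueHalfLine.prod ν (φ.cellAt i j)).toReal) (ENNReal.ofReal p) P :=
    (hN.memLp_toReal (φ.measurableSet_cellAt i j) (φ.finiteOnStrips_prod.cellAt_lt_top i j)
      hp).add (memLp_const _)
  refine (h1.mul_const K).mono' ?_ ?_
  · exact h1.1.mul (φ.stronglyMeasurable_coefAt i j).norm.aestronglyMeasurable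
  · filter_upwards [hK] with ω hω
    rw [Real.norm_of_nonneg (by positivity)]
    gcongr

section Integrability

variable [IsScalarTower ℝ 𝕜 V] [CompleteSpace V] [SigmaFinite ν]
  (φ : SimpleAdaptedProcess 𝕜 X P ν N) {T : ℝ≥0 → X →L[𝕜] V} {M : ℝ}
  {G : ℕ → Finset ℝ≥0} {f : Ω → ℝ≥0 × J → V}

lemma norm_value_approx_le (hT : ∀ u, ‖T u‖ ≤ M) {G : Finset ℝ≥0} (h0 : 0 ∈ G)
    (hφ : ∀ i, φ.time i ∈ G) (ω : Ω) (z : ℝ≥0 × J) :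
    ‖(φ.approx T G h0).value ω z‖ ≤ M * ‖φ.value ω z‖ := by
  rw [value_approx φ T h0 hφ]
  exact (T _).le_of_opNorm_le (hT _) _

lemma tendsto_integral_approx (hT : ∀ u, ‖T u‖ ≤ M) (h0 : ∀ n, 0 ∈ G n)
    (hφ : ∀ n i, φ.time i ∈ G n) {ω : Ω} (h : φ.FiniteOnStrips (N ω))
    (hf : ∀ z, Tendsto (fun n => T (leftPt (G n) z.1) (φ.value ω z)) atTop (𝓝 (f ω z)))
    (t : ℝ≥0) :
    Tendsto (fun n => (φ.approx T (G n) (h0 n)).integral t B ω) atTop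
      (𝓝 (pathIntegral ν N ω t B (f ω))) := by
  have h1 := φ.tendsto_pathIntegral (B := B) h
    (fun n => (φ.approx T (G n) (h0 n)).stronglyMeasurable_value ω)
    (fun n z => φ.norm_value_approx_le hT (h0 n) (hφ n) ω z) (f := f ω)
    (fun z => (hf z).congr fun n => (φ.value_approx T (h0 n) (hφ n) ω z).symm) t
  refine h1.congr fun n => (φ.approx T (G n) (h0 n)).pathIntegral_value h t

lemma norm_integral_approx_le (hT : ∀ u, ‖T u‖ ≤ M) {G : Finset ℝ≥0} (h0 : 0 ∈ G)
    (hφ : ∀ i, φ.time i ∈ G) {ω : Ω} (h : φ.FiniteOnStrips (N ω)) (t : ℝ≥0) :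
    ‖(φ.approx T G h0).integral t B ω‖ ≤ M * φ.pathBound ω := by
  rw [← (φ.approx T G h0).pathIntegral_value h t]
  exact φ.norm_pathIntegral_le h ((norm_nonneg _).trans (hT 0))
    (φ.norm_value_approx_le hT h0 hφ ω) t

lemma memLp_and_tendsto_integral_approx [IsProbabilityMeasure P]
    (hN : IsPoissonRandomMeasure P (lebesgueHalfLine.prod ν) N) {p : ℝ} (hp : 1 ≤ p)
    (hT : ∀ u, ‖T u‖ ≤ M) (h0 : ∀ n, 0 ∈ G n) (hφ : ∀ n i, φ.time i ∈ G n)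
    (hf : ∀ ω z, Tendsto (fun n => T (leftPt (G n) z.1) (φ.value ω z)) atTop (𝓝 (f ω z)))
    (t : ℝ≥0) (hB : MeasurableSet B) {I : Ω → V}
    (hI : ∀ᵐ ω ∂P, I ω = pathIntegral ν N ω t B (f ω)) :
    MemLp I (ENNReal.ofReal p) P ∧ Tendsto (fun n => eLpNorm
      ((φ.approx T (G n) (h0 n)).integral t B - I) (ENNReal.ofReal p) P) atTop (𝓝 0) := by
  refine memLp_and_tendsto_eLpNorm_of_dominated (by linarith)
    (fun n => (stronglyMeasurable_integral _ t hB).aestronglyMeasurable)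
    ((φ.memLp_pathBound hN hp).const_mul M) (fun n => ?_) ?_
  · filter_upwards [φ.ae_finiteOnStrips hN] with ω hω
    exact φ.norm_integral_approx_le hT (h0 n) (hφ n) hω t
  · filter_upwards [φ.ae_finiteOnStrips hN, hI] with ω hω hIω
    rw [hIω]
    exact φ.tendsto_integral_approx hT h0 hφ hω (hf ω) t

/-- Freezing the deterministic operators at left grid points gives simple adapted processes. The
limits over all sets `(0, t'] × B'` are identified as pathwise integrals, so no Cauchy argument in
`L^p` is needed. -/
lemma isLpStochIntegral [IsProbabilityMeasure P]
    (hN : IsPoissonRandomMeasure P (lebesgueHalfLine.prod ν) N) {p : ℝ} (hp : 1 ≤ p)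
    (hT : ∀ u, ‖T u‖ ≤ M) (h0 : ∀ n, 0 ∈ G n) (hφ : ∀ n i, φ.time i ∈ G n)
    (hf : ∀ ω z, Tendsto (fun n => T (leftPt (G n) z.1) (φ.value ω z)) atTop (𝓝 (f ω z)))
    (t : ℝ≥0) (hB : MeasurableSet B) {I : Ω → V}
    (hI : ∀ᵐ ω ∂P, I ω = pathIntegral ν N ω t B (f ω)) :
    IsLpStochIntegral 𝕜 P ν N p f t B I := by
  refine ⟨fun n => φ.approx T (G n) (h0 n), Eventually.of_forall fun z => ?_, fun t' B' _ hB' =>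
    ⟨fun ω => pathIntegral ν N ω t' B' (f ω), ?_⟩, ?_⟩
  · refine (hf z.1 z.2).congr fun n => ?_
    rw [value_approx φ T (h0 n) (hφ n)]
  · exact φ.memLp_and_tendsto_integral_approx hN hp hT h0 hφ hf t' hB' (ae_of_all _ fun _ => rfl)
  · exact φ.memLp_and_tendsto_integral_approx hN hp hT h0 hφ hf t hB hI

end Integrability

end SimpleAdaptedProcess

end Pathwise

/-! ### Dyadic grids -/

/-- The dyadic points of level `n` in `[0, n]`, together with the points of `F`. -/
def dyadicGrid (F : Finset ℝ≥0) (n : ℕ) : Finset ℝ≥0 :=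
  (Finset.range (n * 2 ^ n + 1)).image (fun k : ℕ => (k : ℝ≥0) / 2 ^ n) ∪ F

lemma mem_dyadicGrid_of_le {F : Finset ℝ≥0} {n k : ℕ} (h : k ≤ n * 2 ^ n) :
    (k : ℝ≥0) / 2 ^ n ∈ dyadicGrid F n :=
  Finset.mem_union_left _ (Finset.mem_image.2 ⟨k, by simpa [Nat.lt_succ_iff] using h, rfl⟩)

lemma zero_mem_dyadicGrid (F : Finset ℝ≥0) (n : ℕ) : 0 ∈ dyadicGrid F n := by
  simpa using mem_dyadicGrid_of_le (F := F) (Nat.zero_le (n * 2 ^ n))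

lemma subset_dyadicGrid (F : Finset ℝ≥0) (n : ℕ) : F ⊆ dyadicGrid F n :=
  Finset.subset_union_right

lemma dyadicGrid_mono (F : Finset ℝ≥0) : Monotone (dyadicGrid F) := by
  refine monotone_nat_of_le_succ fun n g hg => ?_
  rcases Finset.mem_union.1 hg with hg | hg
  · obtain ⟨k, hk, rfl⟩ := Finset.mem_image.1 hg
    rw [Finset.mem_range, Nat.lt_succ_iff] at hk
    have h : (k : ℝ≥0) / 2 ^ n = ((2 * k : ℕ) : ℝ≥0) / 2 ^ (n + 1) := by
      push_cast
      rw [pow_succ, mul_comm (2 ^ n : ℝ≥0) 2, mul_div_mul_left _ _ two_ne_zero]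
    rw [h]
    refine mem_dyadicGrid_of_le ?_
    rw [pow_succ]
    nlinarith [Nat.zero_le (2 ^ n)]
  · exact Finset.mem_union_right _ hg

lemma exists_mem_dyadicGrid (F : Finset ℝ≥0) {n : ℕ} {a : ℝ≥0} (ha : a < n) :
    ∃ g ∈ dyadicGrid F n, a < g ∧ g ≤ a + (2 ^ n)⁻¹ := by
  have h2 : (0 : ℝ≥0) < 2 ^ n := by positivity
  have hf : (⌊a * 2 ^ n⌋₊ : ℝ≥0) ≤ a * 2 ^ n := Nat.floor_le zero_le
  -- The first dyadic point strictly to the right of `a`; it stays within `[0, n]` because `a < n`.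
  refine ⟨((⌊a * 2 ^ n⌋₊ + 1 : ℕ) : ℝ≥0) / 2 ^ n, mem_dyadicGrid_of_le ?_, ?_, ?_⟩
  · have : (⌊a * 2 ^ n⌋₊ : ℝ≥0) < ((n * 2 ^ n : ℕ) : ℝ≥0) := by
      push_cast
      exact hf.trans_lt (mul_lt_mul_of_pos_right ha h2)
    exact_mod_cast this
  · rw [lt_div_iff₀ h2]
    push_cast
    exact Nat.lt_floor_add_one _
  · rw [div_le_iff₀ h2, add_mul, inv_mul_cancel₀ h2.ne']
    push_cast
    gcongr

lemma eventually_exists_mem_dyadicGrid (F : Finset ℝ≥0) {a b : ℝ≥0} (hab : a < b) :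
    ∀ᶠ n in atTop, ∃ g ∈ dyadicGrid F n, a < g ∧ g < b := by
  obtain ⟨n₁, hn₁⟩ := exists_nat_gt a
  have h : Tendsto (fun n : ℕ => a + (2 ^ n : ℝ≥0)⁻¹) atTop (𝓝 (a + 0)) := by
    refine tendsto_const_nhds.add ?_
    simp_rw [← inv_pow]
    exact NNReal.tendsto_pow_atTop_nhds_zero_of_lt_one (by
      rw [inv_lt_one₀ (by norm_num)]; norm_num)
  rw [add_zero] at h
  filter_upwards [h.eventually_lt_const hab, eventually_ge_atTop n₁] with n h1 h2
  obtain ⟨g, hg, hag, hgb⟩ := exists_mem_dyadicGrid F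
    (hn₁.trans_le (by exact_mod_cast h2 : (n₁ : ℝ≥0) ≤ n))
  exact ⟨g, hg, hag, hgb.trans_lt h1⟩

lemma le_of_mem_dyadicGrid {F : Finset ℝ≥0} {n : ℕ} (hF : ∀ g ∈ F, g ≤ n) {g : ℝ≥0}
    (hg : g ∈ dyadicGrid F n) : g ≤ n := by
  rcases Finset.mem_union.1 hg with hg | hg
  · obtain ⟨k, hk, rfl⟩ := Finset.mem_image.1 hg
    rw [Finset.mem_range, Nat.lt_succ_iff] at hk
    rw [div_le_iff₀ (by positivity)]
    exact_mod_cast hk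
  · exact hF g hg

lemma gridEnum_succ_le {F : Finset ℝ≥0} {n : ℕ} (hF : ∀ g ∈ F, g ≤ n)
    (i : Fin ((dyadicGrid F n).card - 1)) :
    gridEnum _ (zero_mem_dyadicGrid F n) i.succ ≤
      gridEnum _ (zero_mem_dyadicGrid F n) i.castSucc + (2 ^ n)⁻¹ := by
  set τ := gridEnum _ (zero_mem_dyadicGrid F n)
  have h1 : τ i.castSucc < n := lt_of_lt_of_le (τ.lt_iff_lt.2 Fin.castSucc_lt_succ)
    (le_of_mem_dyadicGrid hF (gridEnum_mem _ i.succ))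
  obtain ⟨g, hg, hag, hgb⟩ := exists_mem_dyadicGrid F h1
  obtain ⟨k, rfl⟩ := exists_gridEnum_eq (zero_mem_dyadicGrid F n) hg
  exact (τ.monotone (Fin.castSucc_lt_iff_succ_le.1 (τ.lt_iff_lt.1 hag))).trans hgb

/-! ### Path regularity and the maximal function -/

section SetIntegral

variable {J V : Type*} [MeasurableSpace J] [NormedAddCommGroup V] [NormedSpace ℝ V]

/-- Dominated convergence with majorant `‖f‖`: as `u` decreases to `t` the sets `(0, u]` shrink to
`(0, t]`, and as `u` increases strictly to `t` they fill `(0, t)`, which gives the left limit. -/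
lemma isCadlagPath_setIntegral {ρ : Measure (ℝ≥0 × J)} {B : Set J}
    (hB : MeasurableSet B) {f : ℝ≥0 × J → V} (hf : Integrable f ρ) :
    IsCadlagPath fun t => ∫ z in Ioc 0 t ×ˢ B, f z ∂ρ := by
  have key : ∀ (l : Filter ℝ≥0) [l.IsCountablyGenerated] (D : Set (ℝ≥0 × J)), MeasurableSet D →
      (∀ z, ∀ᶠ t in l, (z ∈ Ioc 0 t ×ˢ B ↔ z ∈ D)) →
      Tendsto (fun t => ∫ z in Ioc 0 t ×ˢ B, f z ∂ρ) l (𝓝 (∫ z in D, f z ∂ρ)) := by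
    intro l _ D hD h
    have hm : ∀ t : ℝ≥0, MeasurableSet (Ioc 0 t ×ˢ B) := fun t => measurableSet_Ioc.prod hB
    simp_rw [← integral_indicator (hm _)]
    rw [← integral_indicator hD]
    refine tendsto_integral_filter_of_dominated_convergence (fun z => ‖f z‖)
      (Eventually.of_forall fun t => hf.1.indicator (hm t))
      (Eventually.of_forall fun t => Eventually.of_forall fun z => norm_indicator_le_norm_self _ _)
      hf.norm (Eventually.of_forall fun z => ?_)
    refine tendsto_const_nhds.congr' ((h z).mono fun t ht => ?_)
    beta_reduce
    by_cases hz : z ∈ D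
    · rw [indicator_of_mem hz, indicator_of_mem (ht.2 hz)]
    · rw [indicator_of_notMem hz, indicator_of_notMem (ht.not.2 hz)]
  intro t
  constructor
  · refine key _ _ (measurableSet_Ioc.prod hB) fun z => ?_
    rcases le_or_gt z.1 t with hz | hz
    · filter_upwards [self_mem_nhdsWithin] with u hu
      exact ⟨fun h => ⟨⟨h.1.1, hz⟩, h.2⟩, fun h => ⟨⟨h.1.1, hz.trans hu⟩, h.2⟩⟩
    · filter_upwards [mem_nhdsWithin_of_mem_nhds (Iio_mem_nhds hz)] with u hu
      exact ⟨fun h => absurd h.1.2 (not_le.2 hu), fun h => absurd h.1.2 (not_le.2 hz)⟩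
  · refine ⟨_, key _ (Ioo 0 t ×ˢ B) (measurableSet_Ioo.prod hB) fun z => ?_⟩
    rcases lt_or_ge z.1 t with hz | hz
    · filter_upwards [mem_nhdsWithin_of_mem_nhds (Ioi_mem_nhds hz)] with u hu
      exact ⟨fun h => ⟨⟨h.1.1, hz⟩, h.2⟩, fun h => ⟨⟨h.1.1, (mem_Ioi.1 hu).le⟩, h.2⟩⟩
    · filter_upwards [self_mem_nhdsWithin] with u hu
      exact ⟨fun h => absurd h.1.2 (not_le.2 ((mem_Iio.1 hu).trans_le hz)),
        fun h => absurd h.1.2 (not_lt.2 hz)⟩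

end SetIntegral

lemma IsCadlagPath.sub {V : Type*} [NormedAddCommGroup V] {f g : ℝ≥0 → V} (hf : IsCadlagPath f)
    (hg : IsCadlagPath g) : IsCadlagPath fun t => f t - g t := by
  intro t
  obtain ⟨x, hx⟩ := (hf t).2
  obtain ⟨x', hx'⟩ := (hg t).2
  exact ⟨(hf t).1.sub (hg t).1, _, hx.sub hx'⟩

section Maximal

variable {Ω J : Type*} [MeasurableSpace Ω] [MeasurableSpace J]
variable {𝕜 X V : Type*} [RCLike 𝕜] [NormedAddCommGroup X] [NormedSpace 𝕜 X]
  [NormedAddCommGroup V] [NormedSpace 𝕜 V] [NormedSpace ℝ V]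
  {P : Measure Ω} {ν : Measure J} {N : Kernel Ω (ℝ≥0 × J)} {B : Set J}
  {T : ℝ≥0 → X →L[𝕜] V} {M : ℝ} {G : ℕ → Finset ℝ≥0} {f : ℝ≥0 × J → V}

namespace SimpleAdaptedProcess

/-- The grid intervals have length at most `2⁻ⁿ`, while the measures of the finitely many mark sets
are finite and independent of `n`. -/
lemma eventually_isFine_approx (φ : SimpleAdaptedProcess 𝕜 X P ν N) [SigmaFinite ν]
    (T : ℝ≥0 → X →L[𝕜] V) (F : Finset ℝ≥0) :
    ∀ᶠ n in atTop, (φ.approx T (dyadicGrid F n) (zero_mem_dyadicGrid F n)).IsFine := by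
  obtain ⟨n₁, hn₁⟩ := exists_nat_ge (F.sup id)
  have hc : ∑ j, ν (φ.A j) ≠ ∞ := (ENNReal.sum_lt_top.2 fun j _ => φ.measure_A_lt_top j).ne
  obtain ⟨n₂, hn₂⟩ := ENNReal.exists_nat_gt hc
  filter_upwards [eventually_ge_atTop n₁, eventually_ge_atTop n₂] with n h1 h2 i j
  have hF : ∀ g ∈ F, g ≤ n := fun g hg =>
    ((Finset.le_sup (f := id) hg).trans hn₁).trans (by exact_mod_cast h1)
  change lebesgueHalfLine.prod ν (Ioc (gridEnum _ (zero_mem_dyadicGrid F n) _)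
    (gridEnum _ (zero_mem_dyadicGrid F n) _) ×ˢ φ.A j) ≤ 1
  rw [Measure.prod_prod, lebesgueHalfLine_Ioc]
  have h3 : ENNReal.ofReal (gridEnum _ (zero_mem_dyadicGrid F n) i.succ -
      gridEnum _ (zero_mem_dyadicGrid F n) i.castSucc) ≤ (2 ^ n)⁻¹ := by
    have h4 := NNReal.coe_le_coe.2 (gridEnum_succ_le hF i)
    push_cast at h4
    have h5 : ((2 : ℝ≥0∞) ^ n)⁻¹ = ENNReal.ofReal ((2 ^ n)⁻¹) := by
      rw [ENNReal.ofReal_inv_of_pos (by positivity), ENNReal.ofReal_pow (by norm_num)]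
      simp
    rw [h5]
    exact ENNReal.ofReal_le_ofReal (sub_le_iff_le_add'.2 h4)
  have h6 : ν (φ.A j) ≤ 2 ^ n := by
    refine (Finset.single_le_sum (f := fun j => ν (φ.A j)) (fun _ _ => zero_le)
      (Finset.mem_univ j)).trans (hn₂.le.trans ?_)
    have : n₂ ≤ 2 ^ n := h2.trans (Nat.lt_two_pow_self).le
    exact_mod_cast this
  calc _ ≤ ((2 : ℝ≥0∞) ^ n)⁻¹ * 2 ^ n := mul_le_mul' h3 h6
    _ = 1 := ENNReal.inv_mul_cancel (by simp) (by simp)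

variable (φ : SimpleAdaptedProcess 𝕜 X P ν N)

lemma measurable_gridMax [IsScalarTower ℝ 𝕜 V] (ψ : SimpleAdaptedProcess 𝕜 V P ν N)
    (hB : MeasurableSet B) : Measurable (ψ.gridMax B) :=
  .iSup fun i => (ψ.stronglyMeasurable_integral (ψ.time i) hB).enorm

lemma FiniteOnStrips.integrable_of_tendsto {φ : SimpleAdaptedProcess 𝕜 X P ν N}
    {ρ : Measure (ℝ≥0 × J)} (hρ : φ.FiniteOnStrips ρ) {ω : Ω}
    (hT : ∀ u, ‖T u‖ ≤ M) (h0 : ∀ n, 0 ∈ G n) (hφ : ∀ n i, φ.time i ∈ G n)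
    (hf : ∀ z, Tendsto (fun n => T (leftPt (G n) z.1) (φ.value ω z)) atTop (𝓝 (f z))) :
    Integrable f ρ := by
  refine ((hρ.integrable_value ω).norm.const_mul M).mono' ?_ (Eventually.of_forall fun z => ?_)
  · refine aestronglyMeasurable_of_tendsto_ae atTop (f := fun n =>
      (φ.approx T (G n) (h0 n)).value ω) (fun n =>
        ((φ.approx T (G n) (h0 n)).stronglyMeasurable_value ω).aestronglyMeasurable)
      (Eventually.of_forall fun z => (hf z).congr fun n =>
        (φ.value_approx T (h0 n) (hφ n) ω z).symm)
  · exact le_of_tendsto (hf z).norm (Eventually.of_forall fun n => (T _).le_of_opNorm_le (hT _) _)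

lemma isCadlagPath_pathIntegral [SigmaFinite ν] (hB : MeasurableSet B) {ω : Ω}
    (h : φ.FiniteOnStrips (N ω)) (hT : ∀ u, ‖T u‖ ≤ M) (h0 : ∀ n, 0 ∈ G n)
    (hφ : ∀ n i, φ.time i ∈ G n)
    (hf : ∀ z, Tendsto (fun n => T (leftPt (G n) z.1) (φ.value ω z)) atTop (𝓝 (f z))) :
    IsCadlagPath fun t => pathIntegral ν N ω t B f :=
  (isCadlagPath_setIntegral hB (h.integrable_of_tendsto hT h0 hφ hf)).sub
    (isCadlagPath_setIntegral hB (φ.finiteOnStrips_prod.integrable_of_tendsto hT h0 hφ hf))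

/-- A grid point remains a partition point of all finer grids, where the frozen integrals converge
to the path integral. Other times are reached through grid points to their right, by
right-continuity. -/
lemma enorm_pathIntegral_rpow_le_liminf [IsScalarTower ℝ 𝕜 V] [CompleteSpace V] [SigmaFinite ν]
    (hB : MeasurableSet B) {ω : Ω}
    (h : φ.FiniteOnStrips (N ω)) (hT : ∀ u, ‖T u‖ ≤ M) (h0 : ∀ n, 0 ∈ G n)
    (hφ : ∀ n i, φ.time i ∈ G n) (hG : Monotone G)
    (hdense : ∀ a b : ℝ≥0, a < b → ∀ᶠ n in atTop, ∃ g ∈ G n, a < g ∧ g < b)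
    (hf : ∀ z, Tendsto (fun n => T (leftPt (G n) z.1) (φ.value ω z)) atTop (𝓝 (f z)))
    {p : ℝ} (hp : 0 ≤ p) (t : ℝ≥0) :
    ‖pathIntegral ν N ω t B f‖ₑ ^ p ≤
      liminf (fun n => (φ.approx T (G n) (h0 n)).gridMax B ω ^ p) atTop := by
  have h1 : ∀ m, ∀ g ∈ G m, ‖pathIntegral ν N ω g B f‖ₑ ^ p ≤
      liminf (fun n => (φ.approx T (G n) (h0 n)).gridMax B ω ^ p) atTop := by
    intro m g hg
    have h2 := (ENNReal.continuous_rpow_const (y := p)).continuousAt.tendsto.comp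
      (φ.tendsto_integral_approx (B := B) (f := fun _ => f) hT h0 hφ h hf g).enorm
    refine h2.liminf_eq.symm.le.trans (liminf_le_liminf ?_)
    filter_upwards [eventually_ge_atTop m] with n hn
    refine ENNReal.rpow_le_rpow ?_ hp
    obtain ⟨i, hi⟩ := exists_gridEnum_eq (h0 n) (hG hn hg)
    subst hi
    exact le_iSup (fun i => ‖(φ.approx T (G n) (h0 n)).integral
      ((φ.approx T (G n) (h0 n)).time i) B ω‖ₑ) i
  have h3 : Tendsto (fun u => ‖pathIntegral ν N ω u B f‖ₑ ^ p) (𝓝[>] t)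
      (𝓝 (‖pathIntegral ν N ω t B f‖ₑ ^ p)) :=
    (ENNReal.continuous_rpow_const (y := p)).continuousAt.tendsto.comp
      ((φ.isCadlagPath_pathIntegral hB h hT h0 hφ hf t).1.mono Ioi_subset_Ici_self).enorm
  refine isClosed_Iic.mem_of_frequently_of_tendsto (b := 𝓝[>] t) ?_ h3
  refine (nhdsGT_basis t).frequently_iff.2 fun {b} hb => ?_
  obtain ⟨n, g, hg, htg, hgb⟩ := (hdense t b hb).exists
  exact ⟨g, ⟨htg, hgb⟩, h1 n g hg⟩

end SimpleAdaptedProcess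

end Maximal

/-! ### Dilations -/

/-- A strongly continuous one-parameter group of isometries, with an operator `Q` into its space and
an operator `L` back that compress the group to the semigroup `S`. -/
structure IsCompression {𝕜 X Y : Type*} [RCLike 𝕜] [NormedAddCommGroup X] [NormedSpace 𝕜 X]
    [NormedAddCommGroup Y] [NormedSpace 𝕜 Y] (S : ℝ≥0 → X →L[𝕜] X) (Q : X →L[𝕜] Y)
    (L : Y →L[𝕜] X) (U : ℝ → Y ≃ₗᵢ[𝕜] Y) : Prop where
  map_add : ∀ t u y, U (t + u) y = U t (U u y)
  strong_continuous : ∀ y, Continuous fun t => U t y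
  compression : ∀ (t : ℝ≥0) x, L (U t (Q x)) = S t x

/-- The operator back to `X` is `Q⁻¹ R`: it is defined because the ranges of `R` and `Q` agree, and
the lower bound on `Q` makes it linear and bounded by `c⁻¹ * ‖R‖`. -/
lemma HasIsometricDilation.exists_isCompression {𝕜 X Y : Type*} [RCLike 𝕜] [NormedAddCommGroup X]
    [NormedSpace 𝕜 X] [NormedAddCommGroup Y] [NormedSpace 𝕜 Y] {S : ℝ≥0 → X →L[𝕜] X}
    (h : HasIsometricDilation S Y) (hS : IsBoundedC0Semigroup S) :
    ∃ (Q : X →L[𝕜] Y) (L : Y →L[𝕜] X) (U : ℝ → Y ≃ₗᵢ[𝕜] Y), IsCompression S Q L U := by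
  obtain ⟨Q, R, U, ⟨c, hc, hQ⟩, hR, hRQ, hU0, hUadd, hUc, hSU⟩ := h
  have hinj : Function.Injective Q := by
    refine (injective_iff_map_eq_zero Q).2 fun x hx => norm_le_zero_iff.1 ?_
    have := hQ x
    rw [hx, norm_zero] at this
    exact nonpos_of_mul_nonpos_right this hc
  have hL : ∀ y, ∃ x, Q x = R y := fun y => by
    have : R y ∈ range Q := hRQ ▸ mem_range_self y
    exact this
  choose L hL using hL
  let L' : Y →ₗ[𝕜] X :=
    { toFun := L
      map_add' := fun y y' => hinj (by simp only [hL, _root_.map_add])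
      map_smul' := fun a y => hinj (by simp only [hL, map_smul, RingHom.id_apply]) }
  refine ⟨Q, L'.mkContinuous (c⁻¹ * ‖R‖) fun y => ?_, U, hUadd, hUc, fun t x => ?_⟩
  · rw [mul_assoc, ← div_eq_inv_mul, le_div_iff₀' hc]
    exact (hQ _).trans ((congrArg norm (hL y)).le.trans (R.le_opNorm y))
  · refine hinj ((hL _).trans ?_)
    -- The dilation identity is given for `t > 0` only; at zero it amounts to the projection `R`
    -- fixing the range of `Q`.
    rcases eq_or_ne t 0 with rfl | ht
    · obtain ⟨y, hy⟩ : Q x ∈ range R := hRQ ▸ mem_range_self x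
      rw [NNReal.coe_zero, hU0, hS.map_zero, ContinuousLinearMap.id_apply, ← hy]
      exact congrArg (fun T : Y →L[𝕜] Y => T y) hR
    · exact (hSU t (pos_iff_ne_zero.2 ht) x).symm

/-! ### The stochastic convolution through the dilation. -/

section Convolution

variable {𝕜 X Y : Type*} [RCLike 𝕜] [NormedAddCommGroup X] [NormedSpace 𝕜 X]
  [NormedAddCommGroup Y] [NormedSpace 𝕜 Y] {S : ℝ≥0 → X →L[𝕜] X} {Q : X →L[𝕜] Y}
  {L : Y →L[𝕜] X} {U : ℝ → Y ≃ₗᵢ[𝕜] Y}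

/-- Strong continuity of a group of isometries is automatically joint: the error from varying the
vector keeps its norm under the group. -/
lemma IsCompression.tendsto (h : IsCompression S Q L U) {ι : Type*} {l : Filter ι} {a : ι → ℝ}
    {b : ℝ} {w : ι → Y} {x : Y} (ha : Tendsto a l (𝓝 b)) (hw : Tendsto w l (𝓝 x)) :
    Tendsto (fun i => U (a i) (w i)) l (𝓝 (U b x)) := by
  have h1 : Tendsto (fun i => U (a i) (w i - x)) l (𝓝 0) := by
    rw [tendsto_zero_iff_norm_tendsto_zero]
    simp only [LinearIsometryEquiv.norm_map]
    have := (hw.sub_const x).norm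
    rwa [sub_self, norm_zero] at this
  have h2 := (((h.strong_continuous x).tendsto b).comp ha).add h1
  rw [add_zero] at h2
  refine h2.congr fun i => ?_
  simp

/-- The operator `U(-u) Q`. -/
def dilatedOperator (Q : X →L[𝕜] Y) (U : ℝ → Y ≃ₗᵢ[𝕜] Y) (u : ℝ≥0) : X →L[𝕜] Y :=
  ((U (-u)).toContinuousLinearEquiv : Y →L[𝕜] Y).comp Q

lemma dilatedOperator_apply (u : ℝ≥0) (x : X) : dilatedOperator Q U u x = U (-u) (Q x) := rfl

lemma norm_dilatedOperator_le (u : ℝ≥0) : ‖dilatedOperator Q U u‖ ≤ ‖Q‖ := by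
  refine ContinuousLinearMap.opNorm_le_bound _ (norm_nonneg _) fun x => ?_
  rw [dilatedOperator_apply, LinearIsometryEquiv.norm_map]
  exact Q.le_opNorm x

variable {Ω J : Type*} [MeasurableSpace Ω] [MeasurableSpace J] {P : Measure Ω} {ν : Measure J}
  {N : Kernel Ω (ℝ≥0 × J)} {B : Set J} {G : ℕ → Finset ℝ≥0}

namespace SimpleAdaptedProcess

variable (φ : SimpleAdaptedProcess 𝕜 X P ν N)

/-- At time zero `leftPt` has its default value and is not strictly to the left, so the convergence
statements below must treat that time separately. -/
lemma value_of_fst_eq_zero (ω : Ω) {z : ℝ≥0 × J} (hz : z.1 = 0) : φ.value ω z = 0 := by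
  rw [value_eq]
  refine Finset.sum_eq_zero fun i _ => Finset.sum_eq_zero fun j _ => indicator_of_notMem ?_ _
  intro h
  exact absurd h.1.1 (by rw [hz]; exact not_lt.2 zero_le)

lemma tendsto_dilatedOperator_leftPt (h : IsCompression S Q L U)
    (hdense : ∀ a b : ℝ≥0, a < b → ∀ᶠ n in atTop, ∃ g ∈ G n, a < g ∧ g < b) (ω : Ω)
    (z : ℝ≥0 × J) :
    Tendsto (fun n => dilatedOperator Q U (leftPt (G n) z.1) (φ.value ω z)) atTop
      (𝓝 (dilatedOperator Q U z.1 (φ.value ω z))) := by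
  rcases eq_or_ne z.1 0 with hz | hz
  · simp [φ.value_of_fst_eq_zero ω hz]
  · have h1 := (tendsto_leftPt hdense (pos_iff_ne_zero.2 hz)).mono_right nhdsWithin_le_nhds
    exact h.tendsto (NNReal.tendsto_coe.2 h1).neg tendsto_const_nhds

/-- With `t` a grid point, the left grid point of `u` is below `t` exactly when `u ≤ t`. The cutoff
at `t` is thus reproduced without error, and only `S` has to converge. -/
lemma tendsto_semigroup_leftPt (hS : IsBoundedC0Semigroup S)
    (hdense : ∀ a b : ℝ≥0, a < b → ∀ᶠ n in atTop, ∃ g ∈ G n, a < g ∧ g < b) {t : ℝ≥0}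
    (ht : ∀ n, t ∈ G n) (ω : Ω) (z : ℝ≥0 × J) :
    Tendsto (fun n => (if leftPt (G n) z.1 < t then S (t - leftPt (G n) z.1) else 0)
      (φ.value ω z)) atTop
      (𝓝 ((Ioc 0 t ×ˢ univ).indicator (fun z => S (t - z.1) (φ.value ω z)) z)) := by
  rcases eq_or_ne z.1 0 with hz | hz
  · rw [φ.value_of_fst_eq_zero ω hz, indicator_of_notMem fun h => h.1.1.ne' hz]
    simp
  · have hz' := pos_iff_ne_zero.2 hz
    have h1 := (tendsto_leftPt hdense hz').mono_right nhdsWithin_le_nhds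
    simp_rw [leftPt_lt_iff (ht _) hz']
    by_cases hzt : z.1 ≤ t
    · rw [indicator_of_mem (show z ∈ Ioc 0 t ×ˢ univ from ⟨⟨hz', hzt⟩, mem_univ _⟩)]
      simp_rw [if_pos hzt]
      exact ((hS.strong_continuous _).tendsto _).comp (tendsto_const_nhds.sub h1)
    · rw [indicator_of_notMem fun h => hzt h.1.2]
      simp_rw [if_neg hzt]
      simp

end SimpleAdaptedProcess

variable [NormedSpace ℝ X] [NormedSpace ℝ Y]

/-- The stochastic convolution, obtained from the dilation. -/
def dilatedConvolution (Q : X →L[𝕜] Y) (L : Y →L[𝕜] X) (U : ℝ → Y ≃ₗᵢ[𝕜] Y)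
    (φ : SimpleAdaptedProcess 𝕜 X P ν N) (B : Set J) (t : ℝ≥0) (ω : Ω) : X :=
  open Classical in
  if φ.FiniteOnStrips (N ω) then
    L (U t (pathIntegral ν N ω t B fun z => dilatedOperator Q U z.1 (φ.value ω z)))
  -- On paths with infinite strips, almost surely absent for a Poisson random measure with this
  -- intensity, the value zero keeps every path càdlàg.
  else 0

variable [IsScalarTower ℝ 𝕜 X] [CompleteSpace X] [IsScalarTower ℝ 𝕜 Y] [CompleteSpace Y]
  [SigmaFinite ν] (φ : SimpleAdaptedProcess 𝕜 X P ν N)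

/-- The bounded operator `L U(t)` passes through both Bochner integrals, and `L U(t) U(-u) Q = L U(t
- u) Q = S (t - u)` for `u ≤ t`. -/
lemma IsCompression.dilatedConvolution_eq (h : IsCompression S Q L U) (hB : MeasurableSet B)
    {ω : Ω} (hω : φ.FiniteOnStrips (N ω)) (t : ℝ≥0) :
    dilatedConvolution Q L U φ B t ω = pathIntegral ν N ω t B
      ((Ioc 0 t ×ˢ univ).indicator fun z => S (t - z.1) (φ.value ω z)) := by
  rw [dilatedConvolution, if_pos hω]
  set F : Finset ℝ≥0 := Finset.univ.image φ.time
  have hφ : ∀ n i, φ.time i ∈ dyadicGrid F n := fun n i =>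
    subset_dyadicGrid F n (Finset.mem_image_of_mem _ (Finset.mem_univ i))
  let LU : Y →L[𝕜] X := L.comp ((U t).toContinuousLinearEquiv : Y →L[𝕜] Y)
  have key : ∀ ρ : Measure (ℝ≥0 × J), φ.FiniteOnStrips ρ →
      LU (∫ z in Ioc 0 t ×ˢ B, dilatedOperator Q U z.1 (φ.value ω z) ∂ρ) =
      ∫ z in Ioc 0 t ×ˢ B,
        (Ioc 0 t ×ˢ univ).indicator (fun z => S (t - z.1) (φ.value ω z)) z ∂ρ := by
    intro ρ hρ
    have hi := hρ.integrable_of_tendsto (T := dilatedOperator Q U) (M := ‖Q‖)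
      norm_dilatedOperator_le (zero_mem_dyadicGrid F) hφ
      (φ.tendsto_dilatedOperator_leftPt h (fun a b => eventually_exists_mem_dyadicGrid F) ω)
    rw [← LU.integral_comp_comm hi.restrict]
    refine setIntegral_congr_fun (measurableSet_Ioc.prod hB) fun z hz => ?_
    rw [indicator_of_mem (show z ∈ Ioc 0 t ×ˢ univ from ⟨hz.1, mem_univ _⟩)]
    change L (U t (U (-z.1) (Q (φ.value ω z)))) = _
    rw [← h.map_add, ← sub_eq_add_neg, ← NNReal.coe_sub hz.1.2, h.compression]
  change LU _ = _
  rw [pathIntegral, map_sub, key _ hω, key _ φ.finiteOnStrips_prod]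
  rfl

lemma IsCompression.isStochConvolution [IsProbabilityMeasure P] (h : IsCompression S Q L U)
    (hS : IsBoundedC0Semigroup S) (hN : IsPoissonRandomMeasure P (lebesgueHalfLine.prod ν) N)
    {p : ℝ} (hp : 1 ≤ p) (hB : MeasurableSet B) :
    IsStochConvolution p S φ B (dilatedConvolution Q L U φ B) where
  integral t ht := by
    set F : Finset ℝ≥0 := insert t (Finset.univ.image φ.time)
    obtain ⟨M, hM⟩ := hS.bounded
    refine φ.isLpStochIntegral (T := fun u => if u < t then S (t - u) else 0) (M := M) hN hp
      (fun u => ?_) (zero_mem_dyadicGrid F) (fun n i => subset_dyadicGrid F n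
        (Finset.mem_insert_of_mem (Finset.mem_image_of_mem _ (Finset.mem_univ i))))
      (φ.tendsto_semigroup_leftPt hS (fun a b => eventually_exists_mem_dyadicGrid F)
        fun n => subset_dyadicGrid F n (Finset.mem_insert_self _ _)) t hB ?_
    · split_ifs
      · exact hM _
      · rw [norm_zero]; exact (norm_nonneg _).trans (hM 0)
    · filter_upwards [φ.ae_finiteOnStrips hN] with ω hω
      exact h.dilatedConvolution_eq φ hB hω t
  cadlag ω := by
    by_cases hω : φ.FiniteOnStrips (N ω)
    · simp only [dilatedConvolution, if_pos hω]
      set F : Finset ℝ≥0 := Finset.univ.image φ.time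
      have hc := φ.isCadlagPath_pathIntegral hB hω norm_dilatedOperator_le (zero_mem_dyadicGrid F)
        (fun n i => subset_dyadicGrid F n (Finset.mem_image_of_mem _ (Finset.mem_univ i)))
        (φ.tendsto_dilatedOperator_leftPt h (fun a b => eventually_exists_mem_dyadicGrid F) ω)
      intro t
      have ht : ∀ s : Set ℝ≥0, Tendsto (fun u : ℝ≥0 => (u : ℝ)) (𝓝[s] t) (𝓝 t) := fun s =>
        (NNReal.continuous_coe.tendsto t).mono_left nhdsWithin_le_nhds
      obtain ⟨x, hx⟩ := (hc t).2
      exact ⟨(L.continuous.tendsto _).comp (h.tendsto (ht _) (hc t).1),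
        _, (L.continuous.tendsto _).comp (h.tendsto (ht _) hx)⟩
    · simp only [dilatedConvolution, if_neg hω]
      exact fun t => ⟨continuousWithinAt_const, 0, tendsto_const_nhds⟩

/-- A bound for the partition maxima of all fine simple processes dominated by `φ` carries over to
the stochastic convolution. -/
lemma IsCompression.lintegral_iSup_le (h : IsCompression S Q L U)
    (hN : IsPoissonRandomMeasure P (lebesgueHalfLine.prod ν) N)
    {p : ℝ} (hp : 0 ≤ p) (hB : MeasurableSet B) {b : ℝ≥0∞}
    (hb : ∀ ψ : SimpleAdaptedProcess 𝕜 Y P ν N, ψ.IsFine →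
      (∀ ω z, ‖ψ.value ω z‖ ≤ ‖Q‖ * ‖φ.value ω z‖) → ∫⁻ ω, ψ.gridMax B ω ^ p ∂P ≤ b) :
    ∫⁻ ω, (⨆ t : Ioi (0 : ℝ≥0), ‖dilatedConvolution Q L U φ B t ω‖ₑ ^ p) ∂P ≤ ‖L‖ₑ ^ p * b := by
  set F : Finset ℝ≥0 := Finset.univ.image φ.time
  have hφ : ∀ n i, φ.time i ∈ dyadicGrid F n := fun n i =>
    subset_dyadicGrid F n (Finset.mem_image_of_mem _ (Finset.mem_univ i))
  have h0 := zero_mem_dyadicGrid F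
  set ψ : ℕ → SimpleAdaptedProcess 𝕜 Y P ν N := fun n =>
    φ.approx (dilatedOperator Q U) (dyadicGrid F n) (h0 n)
  have h1 : ∀ᵐ ω ∂P, (⨆ t : Ioi (0 : ℝ≥0), ‖dilatedConvolution Q L U φ B t ω‖ₑ ^ p) ≤
      ‖L‖ₑ ^ p * liminf (fun n => (ψ n).gridMax B ω ^ p) atTop := by
    filter_upwards [φ.ae_finiteOnStrips hN] with ω hω
    refine iSup_le fun t => ?_
    have h2 := φ.enorm_pathIntegral_rpow_le_liminf hB hω norm_dilatedOperator_le h0 hφ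
      (dyadicGrid_mono F) (fun a b => eventually_exists_mem_dyadicGrid F)
      (φ.tendsto_dilatedOperator_leftPt h (fun a b => eventually_exists_mem_dyadicGrid F) ω) hp t
    rw [dilatedConvolution, if_pos hω]
    refine le_trans ?_ (mul_le_mul_right h2 _)
    rw [← ENNReal.mul_rpow_of_nonneg _ _ hp]
    refine ENNReal.rpow_le_rpow ((L.le_opENorm _).trans_eq ?_) hp
    -- Here the dilation pays off: the isometry `U t` disappears and the bound no longer depends on
    -- the time `t`.
    rw [LinearIsometryEquiv.enorm_map]
  refine (lintegral_mono_ae h1).trans ?_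
  rw [lintegral_const_mul' _ _ (ENNReal.rpow_ne_top_of_nonneg hp enorm_ne_top)]
  gcongr
  -- Fatou's lemma; the hypothesis is only needed along the grids that are already fine.
  refine (lintegral_liminf_le fun n => ((ψ n).measurable_gridMax hB).pow_const p).trans ?_
  refine liminf_le_of_le (by isBoundedDefault) fun c hc => ?_
  obtain ⟨n, hn, hfine⟩ := (hc.and (φ.eventually_isFine_approx (dilatedOperator Q U) F)).exists
  exact hn.trans (hb _ hfine fun ω z =>
    φ.norm_value_approx_le norm_dilatedOperator_le (h0 n) (hφ n) ω z)

end Convolution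

/-! ### Norm computations and the main theorem. -/

section Norms

variable {Ω E X : Type*} [MeasurableSpace Ω] [MeasurableSpace E] [NormedAddCommGroup X]

lemma lintegral_mul_rpow_rpow {P : Measure Ω} {μ : Measure E} {p q : ℝ} (hp : 0 ≤ p) (hq : 0 < q)
    (k : ℝ≥0) (f : Ω → E → ℝ≥0∞) :
    ∫⁻ ω, (∫⁻ z, (k * f ω z) ^ q ∂μ) ^ (p / q) ∂P =
      k ^ p * ∫⁻ ω, (∫⁻ z, f ω z ^ q ∂μ) ^ (p / q) ∂P := by
  rw [← lintegral_const_mul' _ _ (ENNReal.rpow_ne_top_of_nonneg hp ENNReal.coe_ne_top)]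
  refine lintegral_congr fun ω => ?_
  simp_rw [ENNReal.mul_rpow_of_nonneg _ _ hq.le]
  rw [lintegral_const_mul' _ _ (ENNReal.rpow_ne_top_of_nonneg hq.le ENNReal.coe_ne_top),
    ENNReal.mul_rpow_of_nonneg _ _ (by positivity), ← ENNReal.rpow_mul, mul_div_cancel₀ _ hq.ne']

lemma mixedNorm_rpow {P : Measure Ω} {μ : Measure E} {p : ℝ} (hp : 0 < p) (q : ℝ)
    (φ : Ω → E → X) :
    mixedNorm P μ p q φ ^ p = ∫⁻ ω, (∫⁻ z, ‖φ ω z‖ₑ ^ q ∂μ) ^ (p / q) ∂P := by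
  rw [mixedNorm, ← ENNReal.rpow_mul, one_div_mul_cancel hp.ne', ENNReal.rpow_one]

end Norms

section Norms

/-- The `p`-th root is subadditive because `1 / p ≤ 1`, so a sum of `p`-th powers becomes a sum of
norms. -/
lemma rpow_one_div_le_of_le {x a b : ℝ≥0∞} {l K q : ℝ≥0} {p : ℝ} (hp : 1 ≤ p)
    (h : x ≤ l ^ p * (K * (q ^ p * a ^ p + q ^ p * b ^ p))) :
    x ^ (1 / p) ≤ (l * K ^ (1 / p) * q : ℝ≥0) * (a + b) := by
  have hp0 : 0 < p := by linarith
  have h0 : 0 ≤ 1 / p := by positivity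
  have hc : ∀ c : ℝ≥0∞, (c ^ p) ^ (1 / p) = c := fun c => by
    rw [← ENNReal.rpow_mul, mul_one_div_cancel hp0.ne', ENNReal.rpow_one]
  calc x ^ (1 / p) ≤ (l ^ p * (K * (q ^ p * (a ^ p + b ^ p)))) ^ (1 / p) := by
        rw [mul_add]
        exact ENNReal.rpow_le_rpow h h0
    _ = l * (K ^ (1 / p) * (q * (a ^ p + b ^ p) ^ (1 / p))) := by
        rw [ENNReal.mul_rpow_of_nonneg _ _ h0, ENNReal.mul_rpow_of_nonneg _ _ h0,
          ENNReal.mul_rpow_of_nonneg _ _ h0, hc, hc]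
    _ ≤ l * (K ^ (1 / p) * (q * (a + b))) := by
        gcongr
        refine (ENNReal.rpow_add_le_add_rpow _ _ h0 ((div_le_one hp0).2 hp)).trans_eq ?_
        rw [hc, hc]
    _ = _ := by
        push_cast
        rw [ENNReal.coe_rpow_of_nonneg _ h0]
        ring

lemma enorm_restrictMarks_le {Ω J X Y : Type*} [NormedAddCommGroup X]
    [NormedAddCommGroup Y] {φ : Ω → ℝ≥0 × J → X} {ψ : Ω → ℝ≥0 × J → Y} {q : ℝ≥0}
    (h : ∀ ω z, ‖ψ ω z‖ ≤ q * ‖φ ω z‖) (B : Set J) (ω : Ω) (z : ℝ≥0 × J) :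
    ‖restrictMarks ψ B ω z‖ₑ ≤ q * ‖restrictMarks φ B ω z‖ₑ := by
  by_cases hz : z ∈ (univ : Set ℝ≥0) ×ˢ B
  · rw [restrictMarks, restrictMarks, indicator_of_mem hz, indicator_of_mem hz]
    have : ‖ψ ω z‖₊ ≤ q * ‖φ ω z‖₊ := h ω z
    rw [enorm_eq_nnnorm, enorm_eq_nnnorm]
    exact_mod_cast this
  · rw [restrictMarks, indicator_of_notMem hz, enorm_zero]
    exact zero_le

end Norms

end

theorem mainTheorem4 {𝕜 : Type*} [RCLike 𝕜]
    {X : Type u} [NormedAddCommGroup X] [NormedSpace 𝕜 X] [NormedSpace ℝ X] [IsScalarTower ℝ 𝕜 X]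
    [CompleteSpace X]
    {Y : Type y} [NormedAddCommGroup Y] [NormedSpace 𝕜 Y] [NormedSpace ℝ Y] [IsScalarTower ℝ 𝕜 Y]
    [CompleteSpace Y]
    (s : ℝ) (hs : 1 < s) (hs' : s ≤ 2)
    (hX : HasMartingaleType.{w} X s) (hY : HasMartingaleType.{w} Y s)
    (S : ℝ≥0 → X →L[𝕜] X) (hS : IsBoundedC0Semigroup S) (hdil : HasIsometricDilation S Y)
    (p : ℝ) :
    (s ≤ p → ∃ C : ℝ≥0,
      ∀ (Ω : Type w) [MeasurableSpace Ω] (P : Measure Ω) [IsProbabilityMeasure P]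
        (J : Type v) [MeasurableSpace J] (ν : Measure J) [SigmaFinite ν]
        (N : Kernel Ω (ℝ≥0 × J)), IsPoissonRandomMeasure P (lebesgueHalfLine.prod ν) N →
        ∀ (φ : SimpleAdaptedProcess 𝕜 X P ν N) (B : Set J), MeasurableSet B →
          ∃ Z : ℝ≥0 → Ω → X, IsStochConvolution p S φ B Z ∧
            maximalNorm P p Z ≤
              C * intersectionNorm P (lebesgueHalfLine.prod ν) p s
                (restrictMarks φ.value B)) ∧
    (1 ≤ p → p < s → ∃ C : ℝ≥0,
      ∀ (Ω : Type w) [MeasurableSpace Ω] (P : Measure Ω) [IsProbabilityMeasure P]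
        (J : Type v) [MeasurableSpace J] (ν : Measure J) [SigmaFinite ν]
        (N : Kernel Ω (ℝ≥0 × J)), IsPoissonRandomMeasure P (lebesgueHalfLine.prod ν) N →
        ∀ (φ : SimpleAdaptedProcess 𝕜 X P ν N) (B : Set J), MeasurableSet B →
          ∃ Z : ℝ≥0 → Ω → X, IsStochConvolution p S φ B Z ∧
            maximalNorm P p Z ≤
              C * sumNorm P (lebesgueHalfLine.prod ν) p s
                (restrictMarks φ.value B)) := by
  obtain ⟨Q, L, U, h⟩ := hdil.exists_isCompression hS
  have hs0 : 0 < s := by linarith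
  refine ⟨fun hsp => ?_, fun hp hps => ?_⟩
  · have hp : 1 ≤ p := by linarith
    have hp0 : 0 < p := by linarith
    obtain ⟨K, hK⟩ := hY.exists_gridMax_le_of_le hs.le hp 𝕜
    -- The factor 2 bounds the sum of the two norms by their maximum.
    refine ⟨‖L‖₊ * K ^ (1 / p) * ‖Q‖₊ * 2, fun Ω _ P _ J _ ν _ N hN φ B hB =>
      ⟨_, h.isStochConvolution φ hS hN hp hB, ?_⟩⟩
    refine (rpow_one_div_le_of_le hp (h.lintegral_iSup_le φ hN hp0.le hB
      (b := K * (‖Q‖₊ ^ p * mixedNorm P (lebesgueHalfLine.prod ν) p s (restrictMarks φ.value B) ^ p +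
        ‖Q‖₊ ^ p * mixedNorm P (lebesgueHalfLine.prod ν) p p (restrictMarks φ.value B) ^ p))
      fun ψ hψ hle => (hK Ω P J ν N hN ψ hψ B hB).trans ?_)).trans ?_
    · have hr := enorm_restrictMarks_le (q := ‖Q‖₊) hle B
      rw [mixedNorm_rpow hp0, mixedNorm_rpow hp0, ← lintegral_mul_rpow_rpow hp0.le hs0,
        ← lintegral_mul_rpow_rpow hp0.le hp0]
      simp only [div_self hp0.ne', ENNReal.rpow_one]
      gcongr with ω z ω z
      · exact hr ω z
      · exact hr ω z
    · rw [ENNReal.coe_mul (y := 2), mul_assoc (_ : ℝ≥0∞)]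
      refine mul_le_mul' le_rfl ?_
      rw [ENNReal.coe_ofNat, two_mul]
      exact add_le_add (le_max_left _ _) (le_max_right _ _)
  · have hp0 : 0 < p := by linarith
    obtain ⟨K, hK⟩ := hY.exists_gridMax_le_of_lt hp hps 𝕜
    -- The summand 1 makes the constant nonzero, so that it can be moved inside the infimum over
    -- decompositions even when that infimum is infinite.
    refine ⟨‖L‖₊ * K ^ (1 / p) * ‖Q‖₊ + 1, fun Ω _ P _ J _ ν _ N hN φ B hB =>
      ⟨_, h.isStochConvolution φ hS hN hp hB, ?_⟩⟩
    have hne : ((‖L‖₊ * K ^ (1 / p) * ‖Q‖₊ + 1 : ℝ≥0) : ℝ≥0∞) ≠ 0 := by simp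
    simp only [sumNorm, ENNReal.mul_iInf_of_ne hne ENNReal.coe_ne_top]
    refine le_iInf fun φ₁ => le_iInf fun φ₂ => le_iInf fun h₁ => le_iInf fun h₂ =>
      le_iInf fun hdec => ?_
    refine (rpow_one_div_le_of_le hp (h.lintegral_iSup_le φ hN hp0.le hB
      (b := K * (‖Q‖₊ ^ p * mixedNorm P (lebesgueHalfLine.prod ν) p s φ₁ ^ p +
        ‖Q‖₊ ^ p * mixedNorm P (lebesgueHalfLine.prod ν) p p φ₂ ^ p))
      fun ψ hψ hle => ?_)).trans (mul_le_mul_left (ENNReal.coe_le_coe.2 le_self_add) _)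
    have hr := enorm_restrictMarks_le (q := ‖Q‖₊) hle B
    -- The parts of the decomposition are only almost everywhere measurable; their norms are
    -- replaced by measurable versions, which agree for almost every `ω` at almost every point.
    have e₁ := Measure.ae_ae_of_ae_prod h₁.enorm.ae_eq_mk
    have e₂ := Measure.ae_ae_of_ae_prod h₂.enorm.ae_eq_mk
    refine (hK Ω P J ν N hN ψ hψ B hB (fun x => ‖Q‖₊ * h₁.enorm.mk _ x)
      (fun x => ‖Q‖₊ * h₂.enorm.mk _ x) (h₁.enorm.measurable_mk.const_mul _)
      (h₂.enorm.measurable_mk.const_mul _) ?_).trans ?_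
    · filter_upwards [Measure.ae_ae_of_ae_prod hdec, e₁, e₂] with ω hω h₁ω h₂ω
      filter_upwards [hω, h₁ω, h₂ω] with z hz h₁z h₂z
      rw [← h₁z, ← h₂z, ← mul_add]
      refine (hr ω z).trans (mul_le_mul_right ?_ _)
      exact (congrArg _ hz).le.trans (enorm_add_le _ _)
    · rw [mixedNorm_rpow hp0, mixedNorm_rpow hp0, ← lintegral_mul_rpow_rpow hp0.le hs0,
        ← lintegral_mul_rpow_rpow hp0.le hp0]
      simp only [div_self hp0.ne', ENNReal.rpow_one]
      refine mul_le_mul_right (add_le_add (le_of_eq ?_) (le_of_eq ?_)) _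
      · refine lintegral_congr_ae (e₁.mono fun ω hω => ?_)
        exact congrArg (· ^ (p / s)) (lintegral_congr_ae (hω.mono fun z hz => by
          simp only [← hz]; rfl))
      · refine lintegral_congr_ae (e₂.mono fun ω hω => ?_)
        exact lintegral_congr_ae (hω.mono fun z hz => by simp only [← hz]; rfl)
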